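/- **Setting.** Let $X\in\mathbb R^d$ be a centered random vector with unknown law $\mathrm P$ and $\mathbb E\|X\|^4<\infty$, let $\Sigma=\mathbb E[XX^\top]$ with eigenvalues $\lambda_1\ge\dots\ge\lambda_d$, and put $$\kappa=\sup_{\theta:\ \mathbb E\langle\theta,X\rangle^2>0}\frac{\mathbb E\langle\theta,X\rangle^4}{(\mathbb E\langle\theta,X\rangle^2)^2},\qquad m=\mathbb E[\|X\|^4]^{1/2}.$$ Let $X_1,\dots,X_n$ ($n\ge1$) be an i.i.d. sample from $\mathrm P$. Let $\varepsilon>0$, $\sigma>0$, $\|A\|_{HS}^2=\mathrm{Tr}(A^\top A)$, and let $\Theta_\delta$ be a finite $\delta$-net of the unit sphere $\mathbb S_d$ (a finite $\Theta_\delta\subset\mathbb S_d$ such that every $\theta\in\mathbb S_d$ is within distance $\delta$ of it). **Estimator.** Let $\psi$ be the odd function with $\psi(t)=-\log(1-t+t^2/2)$ on $[0,1]$ and $\psi(t)=\log 2$ for $t\ge1$. For $\lambda>0$ let $\widehat\alpha_{\theta,\lambda}\in(0,\infty]$ be the supremum of the $\alpha\ge0$ with $\sum_{i}\psi(\alpha^2\langle\theta,X_i\rangle^2-\lambda)\le0$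 (the largest solution of $\sum_i\psi(\alpha^2\langle\theta,X_i\rangle^2-\lambda)=0$ when there is one), and let $\tau=\lambda/\widehat\alpha_{\theta,\lambda}^2$. Let $\Lambda$ be a finite non-empty set of triples $(\lambda,\beta,w)$ of positive reals with $\sum_{\Lambda}w\le1$. With $c=\frac{15}{8\log2(\sqrt2-1)}e^{(1+2\sqrt2)/2}$ put, for each triple, $$\xi=\tfrac{\kappa\lambda}2,\quad \mu=(\kappa-1)\lambda+\tfrac{(2+c)\sqrt\kappa\, m}{\beta},\quad \bar\gamma=\tfrac{(\kappa-1)\lambda}2+\tfrac{(2+c)\sqrt\kappa\, m}{\beta}+\tfrac{(2+3c)m^2}{2\beta^2\lambda}+\tfrac{\log(1/(w\varepsilon))}{n\lambda},\quad b=\tfrac{\beta\|\theta\|^2}{2n}.$$ With $D_\pm=1\mp\mu-\xi$, let $$B_-(\theta,\lambda,\beta,w)=\max\Bigl\{0,\ \tau-\tfrac{\bar\gamma\tau+b}{D_-}\Bigr\}\ \text{ if } D_->0,\ \text{ and } 0 \text{ otherwise},$$ $$B_+(\theta,\lambda,\beta,w)=\tau_++\tfrac{\bar\gamma\tau_++b}{D_+},\quad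 \tau_+=\max\Bigl\{\tau,\tfrac{b}{D_+-\bar\gamma}\Bigr\},\ \text{ if } \bar\gamma<D_+,\ \text{ and } +\infty \text{ otherwise}.$$ Let $B_-(\theta)=\max_\Lambda B_-(\theta,\cdot)$ and $B_+(\theta)=\min_\Lambda B_+(\theta,\cdot)$. The estimator $\widehat\Sigma$ is the symmetric matrix of minimal Frobenius norm among those with $B_-(\theta)\le\theta^\top\widehat\Sigma\theta\le B_+(\theta)$ for all $\theta\in\Theta_\delta$ (and $\widehat\Sigma=0$ if there are none). Let $\widehat\lambda_1\ge\dots\ge\widehat\lambda_d$ be the eigenvalues of its positive part $\widehat\Sigma_+$. **Error level.** Let $$\gamma(t)=\sqrt{\frac{2.032(\kappa-1)}n\Bigl(\frac{0.73\,\mathrm{Tr}(\Sigma)}t+4.35+\log(\varepsilon^{-1})\Bigr)}+\sqrt{\frac{98.5\,\kappa\,\mathrm{Tr}(\Sigma)}{nt}},$$ $$\eta(t)=\frac{\gamma(\max\{t,\sigma\})}{1-4\gamma(\max\{t,\sigma\})}\ \text{ if } [6+(\kappa-1)^{-1}]\,\gamma(\max\{t,\sigma\})\le1,\qquad \eta(t)=+\infty\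 \text{ otherwise.}$$ **Statement.** For all $n\ge 1$, $\varepsilon>0$, $\kappa\ge3/2$ and $m$ there is a suitable finite grid $\Lambda$, depending only on $n,\varepsilon,\kappa,m$, such that for every $d$ and every law $\mathrm P$ as above with these values of $\kappa$ and $m$, every i.i.d. sample, every $\sigma>0$, every $\delta$-net $\Theta_\delta$ and every real $s_4$ the following holds. With probability at least $1-2\varepsilon$, the minimization problem defining $\widehat\Sigma$ has a solution and, for all $i=1,\dots,d$, $$|\max\{\lambda_i,\sigma\}-\max\{\widehat\lambda_i,\sigma\}|\le2\max\{\lambda_i,\sigma\}\,\eta(\lambda_i)+5\delta\|\Sigma\|_{HS},$$ $$|\max\{\lambda_i,\sigma\}-\max\{\widehat\lambda_i,\sigma\}|\le2\max\{\widehat\lambda_i,\sigma\}\,\eta(\min\{\widehat\lambda_i,s_4\})+5\delta\|\Sigma\|_{HS},$$ and consequently $$|\lambda_i-\widehat\lambda_i|\le2\max\{\lambda_i,\sigma\}\,\eta(\lambda_i)+5\delta\|\Sigma\|_{HS}+\sigma,$$ $$|\lambda_i-\widehat\lambda_i|\le2\max\{\widehat\lambda_i,\sigma\}\,\eta(\min\{\widehat\lambda_i,s_4\})+5\delta\|\Sigma\|_{HS}+\sigma.$$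 -/

import Mathlib

open MeasureTheory ProbabilityTheory

noncomputable section

namespace RobustPCA

/-! ### The unknown law -/

/-- Second-moment matrix `E[X Xᵀ]` of a law on `ℝ^d`; it is the covariance matrix when the law is
centered. -/
def covMatrix {d : ℕ} (P : Measure (EuclideanSpace ℝ (Fin d))) : Matrix (Fin d) (Fin d) ℝ :=
  Matrix.of fun i j => ∫ x, x i * x j ∂P

/-- The kurtosis `κ`: the supremum of `E⟨θ,X⟩⁴ / (E⟨θ,X⟩²)²` over the directions `θ` with
`E⟨θ,X⟩² > 0`. (If `E‖X‖⁴ < ∞` this is a supremum of a bounded set.) -/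
def kurtosis {d : ℕ} (P : Measure (EuclideanSpace ℝ (Fin d))) : ℝ :=
  sSup {r : ℝ | ∃ θ : EuclideanSpace ℝ (Fin d), 0 < ∫ x, (inner ℝ θ x) ^ 2 ∂P ∧
    r = (∫ x, (inner ℝ θ x) ^ 4 ∂P) / (∫ x, (inner ℝ θ x) ^ 2 ∂P) ^ 2}

/-- `E[‖X‖⁴]^{1/2}`. -/
def fourthMomentRoot {d : ℕ} (P : Measure (EuclideanSpace ℝ (Fin d))) : ℝ :=
  Real.sqrt (∫ x, ‖x‖ ^ 4 ∂P)

/-! ### Matrices -/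

/-- The quadratic form `θᵀ A θ`. -/
def quadForm {d : ℕ} (A : Matrix (Fin d) (Fin d) ℝ) (θ : EuclideanSpace ℝ (Fin d)) : ℝ :=
  θ.ofLp ⬝ᵥ A.mulVec θ.ofLp

/-- Frobenius (Hilbert-Schmidt) norm, `‖A‖² = Tr(Aᵀ A)`. -/
def hsNorm {d : ℕ} (A : Matrix (Fin d) (Fin d) ℝ) : ℝ :=
  Real.sqrt (A.transpose * A).trace

open Classical in
/-- Eigenvalues of a symmetric matrix, repeated with multiplicity, in non-increasing order
(by convention `0` if the matrix is not symmetric). -/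
def sortedEigenvalues {d : ℕ} (A : Matrix (Fin d) (Fin d) ℝ) (i : Fin d) : ℝ :=
  if h : A.IsHermitian then h.eigenvalues₀ (Fin.cast (Fintype.card_fin d).symm i) else 0

open Classical in
/-- Positive part of a symmetric matrix: same eigenvectors, each eigenvalue `t` replaced by
`max t 0` (by convention `0` if the matrix is not symmetric). -/
def positivePart {d : ℕ} (A : Matrix (Fin d) (Fin d) ℝ) : Matrix (Fin d) (Fin d) ℝ :=
  if h : A.IsHermitian then h.cfc (fun t => max t 0) else 0

/-! ### The truncated empirical energy -/

/-- The influence function on `[0, ∞)`. -/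
def psiPos (t : ℝ) : ℝ := if 1 ≤ t then Real.log 2 else -Real.log (1 - t + t ^ 2 / 2)

/-- The influence function `ψ`, the odd extension of `psiPos`. -/
def psi (t : ℝ) : ℝ := if 0 ≤ t then psiPos t else -psiPos (-t)

/-- `α̂_{θ,λ}`: the (largest) solution `α ≥ 0` of `∑ᵢ ψ(α² ⟨θ, xᵢ⟩² - λ) = 0`, that is the supremum
of the `α ≥ 0` at which this sum is non-positive; it is `∞` if the sum never becomes positive. -/
def alphaHat {d n : ℕ} (x : Fin n → EuclideanSpace ℝ (Fin d)) (θ : EuclideanSpace ℝ (Fin d))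
    (lam : ℝ) : ENNReal :=
  sSup {a : ENNReal | ∃ α : ℝ, 0 ≤ α ∧ a = ENNReal.ofReal α ∧
    ∑ i, psi (α ^ 2 * (inner ℝ θ (x i)) ^ 2 - lam) ≤ 0}

/-- The energy estimate `λ / α̂_{θ,λ}²` (it is `0` if `α̂_{θ,λ} = ∞`). -/
def energyHat {d n : ℕ} (x : Fin n → EuclideanSpace ℝ (Fin d)) (θ : EuclideanSpace ℝ (Fin d))
    (lam : ℝ) : ℝ :=
  (ENNReal.ofReal lam / alphaHat x θ lam ^ 2).toReal

/-! ### Confidence bounds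

What follows are the PAC-Bayesian confidence bounds on the energy `N(θ) = E⟨θ,X⟩²`. They come from
Gaussian perturbations `N(θ, β⁻¹ I)` of the direction `θ`, which give, for `r(θ) = (1/n) ∑ᵢ
ψ(⟨θ,Xᵢ⟩² - λ)` and `z = N(θ)/λ - 1`, with high probability and uniformly in `θ`,
`(1-μ) z - ξ z² - γ - (β/(2nλ)) ‖θ‖² ≤ r(θ)/λ ≤ (1+μ) z + ξ z² + γ + (β/(2nλ)) ‖θ‖²`.
Scaling `θ` by `α ≤ α̂_{θ,λ}` and solving for `N(θ)` yields the two bounds. -/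

/-- A point of the grid: the centering parameter `λ`, the inverse variance `β` of the
perturbation, and the share `w` of the error probability `ε` spent at this point. -/
structure GridPoint where
  lam : ℝ
  beta : ℝ
  weight : ℝ

/-- Admissible finite grids: positive parameters, shares summing up to at most one. -/
def IsGrid (Λ : Finset GridPoint) : Prop :=
  Λ.Nonempty ∧ (∀ g ∈ Λ, 0 < g.lam ∧ 0 < g.beta ∧ 0 < g.weight) ∧ ∑ g ∈ Λ, g.weight ≤ 1

/-- The numerical constant of the Gaussian perturbation, about `44.3`. -/
def cPert : ℝ :=
  15 / (8 * Real.log 2 * (Real.sqrt 2 - 1)) * Real.exp ((1 + 2 * Real.sqrt 2) / 2)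

/-- The known quantities: sample size `n`, error probability `ε`, kurtosis `κ` and
`m = E[‖X‖⁴]^{1/2}`. -/
structure Params where
  n : ℕ
  eps : ℝ
  kappa : ℝ
  m : ℝ

/-- `ξ = κ λ / 2`. -/
def xiCoef (p : Params) (g : GridPoint) : ℝ := p.kappa * g.lam / 2

/-- `μ = (κ-1) λ + (2+c) κ^{1/2} m / β`. -/
def muCoef (p : Params) (g : GridPoint) : ℝ :=
  (p.kappa - 1) * g.lam + (2 + cPert) * Real.sqrt p.kappa * p.m / g.beta

/-- `γ = (κ-1) λ / 2 + (2+c) κ^{1/2} m / β + (2+3c) m² / (2 β² λ) + log(1/(w ε)) / (n λ)`. -/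
def gammaCoef (p : Params) (g : GridPoint) : ℝ :=
  (p.kappa - 1) * g.lam / 2 + (2 + cPert) * Real.sqrt p.kappa * p.m / g.beta
    + (2 + 3 * cPert) * p.m ^ 2 / (2 * g.beta ^ 2 * g.lam)
    + Real.log (g.weight * p.eps)⁻¹ / (p.n * g.lam)

/-- The cost `β ‖θ‖² / (2n)` of the perturbation (Kullback divergence divided by `n`). -/
def perturbCost {d : ℕ} (p : Params) (g : GridPoint) (θ : EuclideanSpace ℝ (Fin d)) : ℝ :=
  g.beta * ‖θ‖ ^ 2 / (2 * p.n)

/-- `B₋(θ, λ)`: the lower confidence bound on the energy at one grid point. -/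
def lowerBoundAt {d : ℕ} (p : Params) (g : GridPoint)
    (x : Fin p.n → EuclideanSpace ℝ (Fin d)) (θ : EuclideanSpace ℝ (Fin d)) : ℝ :=
  let τ := energyHat x θ g.lam
  let D := 1 + muCoef p g - xiCoef p g
  if 0 < D then max 0 (τ - (gammaCoef p g * τ + perturbCost p g θ) / D) else 0

/-- `B₊(θ, λ)`: the upper confidence bound on the energy at one grid point; the estimated energy is
first brought up to the resolution of the bound, below which it carries no information. -/
def upperBoundAt {d : ℕ} (p : Params) (g : GridPoint)
    (x : Fin p.n → EuclideanSpace ℝ (Fin d)) (θ : EuclideanSpace ℝ (Fin d)) : EReal :=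
  let D := 1 - muCoef p g - xiCoef p g
  let τ := max (energyHat x θ g.lam) (perturbCost p g θ / (D - gammaCoef p g))
  if gammaCoef p g < D then ((τ + (gammaCoef p g * τ + perturbCost p g θ) / D : ℝ) : EReal) else ⊤

/-- `B₋(θ) = max_{λ ∈ Λ} B₋(θ, λ)`. -/
def lowerBound {d : ℕ} (p : Params) (Λ : Finset GridPoint)
    (x : Fin p.n → EuclideanSpace ℝ (Fin d)) (θ : EuclideanSpace ℝ (Fin d)) : EReal :=
  ⨆ g ∈ Λ, (lowerBoundAt p g x θ : EReal)

/-- `B₊(θ) = min_{λ ∈ Λ} B₊(θ, λ)`. -/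
def upperBound {d : ℕ} (p : Params) (Λ : Finset GridPoint)
    (x : Fin p.n → EuclideanSpace ℝ (Fin d)) (θ : EuclideanSpace ℝ (Fin d)) : EReal :=
  ⨅ g ∈ Λ, upperBoundAt p g x θ

/-! ### The estimator -/

/-- `Θ` is a finite `δ`-net of the unit sphere. -/
def IsSphereNet {d : ℕ} (Θ : Finset (EuclideanSpace ℝ (Fin d))) (δ : ℝ) : Prop :=
  (∀ ξ ∈ Θ, ‖ξ‖ = 1) ∧
    ∀ θ : EuclideanSpace ℝ (Fin d), ‖θ‖ = 1 → ∃ ξ ∈ Θ, ‖θ - ξ‖ ≤ δ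

/-- `Q` is symmetric and `B₋(θ) ≤ θᵀ Q θ ≤ B₊(θ)` for every `θ` in the net. -/
def IsFeasible {d : ℕ} (p : Params) (Λ : Finset GridPoint)
    (Θ : Finset (EuclideanSpace ℝ (Fin d))) (x : Fin p.n → EuclideanSpace ℝ (Fin d))
    (Q : Matrix (Fin d) (Fin d) ℝ) : Prop :=
  Q.IsSymm ∧ ∀ θ ∈ Θ, lowerBound p Λ x θ ≤ ((quadForm Q θ : ℝ) : EReal) ∧
    ((quadForm Q θ : ℝ) : EReal) ≤ upperBound p Λ x θ

/-- `Q` satisfies the constraints and has minimal Frobenius norm among the matrices that do. -/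
def IsMinimalFeasible {d : ℕ} (p : Params) (Λ : Finset GridPoint)
    (Θ : Finset (EuclideanSpace ℝ (Fin d))) (x : Fin p.n → EuclideanSpace ℝ (Fin d))
    (Q : Matrix (Fin d) (Fin d) ℝ) : Prop :=
  IsFeasible p Λ Θ x Q ∧ ∀ Q', IsFeasible p Λ Θ x Q' → hsNorm Q ≤ hsNorm Q'

open Classical in
/-- The robust estimator `Σ̂`: the feasible matrix of minimal Frobenius norm (and `0` for the samples
whose constraints cannot be satisfied). -/
def sigmaHat {d : ℕ} (p : Params) (Λ : Finset GridPoint)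
    (Θ : Finset (EuclideanSpace ℝ (Fin d))) (x : Fin p.n → EuclideanSpace ℝ (Fin d)) :
    Matrix (Fin d) (Fin d) ℝ :=
  if h : ∃ Q, IsMinimalFeasible p Λ Θ x Q then h.choose else 0

/-! ### The error level -/

/-- `γ(t)`, for sample size `n`, error probability `ε`, kurtosis `κ` and trace `T = Tr(Σ)`. -/
def gammaFun (n : ℕ) (ε κ T t : ℝ) : ℝ :=
  Real.sqrt (2.032 * (κ - 1) / n * (0.73 * T / t + 4.35 + Real.log ε⁻¹))
    + Real.sqrt (98.5 * κ * T / (n * t))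

open Classical in
/-- `η(t)`, with value `+∞` where `[6 + (κ-1)⁻¹] γ(max{t,σ}) > 1`. -/
def etaFun (n : ℕ) (ε κ T σ t : ℝ) : EReal :=
  if (6 + (κ - 1)⁻¹) * gammaFun n ε κ T (max t σ) ≤ 1 then
    ((gammaFun n ε κ T (max t σ) / (1 - 4 * gammaFun n ε κ T (max t σ)) : ℝ) : EReal)
  else ⊤

end RobustPCA

end

/-!
The proof is a PAC-Bayesian argument. Let `q(u) = 1 + u + u²/2` (`expTaylor`), so that `ψ ≤ log q`.

*Deviation inequality.* Let `G = ⟨θ',x⟩` for a random direction `θ'` with law `N(θ, β⁻¹ I)`. It has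
mean `⟨θ,x⟩` and variance `v = ‖x‖²/β`, and `ψ(±(⟨θ,x⟩² - λ))` is at most the mean over `θ'` of
`log (q(±(G² - v - λ)) + c v (G² + v/2))` (`psi_le_integral_perturbLog`). Indeed
`(log q)'' ≥ -1/4`, so averaging `log q` costs at most `Var(G²)/8`, and the correction term, whose
constant `c` exceeds `40`, regains more than that on an event of probability at least `1/6`; when
`Var(G²)` or `|⟨θ,x⟩² - λ|` is large the bounds `|ψ| ≤ log 2` suffice. The function under the
logarithm is positive and its moments are explicit. Averaging its `n`-fold product over a centred
Gaussian prior gives an exponential moment bounded by one (`exists_event_lintegral_exp_le`), and the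
change of measure to the Gaussian law centred at `θ` (`integral_shift_le_log`) costs the Kullback
divergence `β‖θ‖²/2`, uniformly in `θ`. The outcome is `exists_event_sum_psi_le`; a union bound over
the grid and the two signs gives `exists_event_deviationHolds`.

*Confidence bounds.* Applied to the multiples of `θ` the deviation inequality becomes a quadratic
inequality for the relative error of a candidate energy, from which
`B₋(θ,λ) ≤ E⟨θ,X⟩² ≤ B₊(θ,λ)` at every grid point (`lowerBoundAt_le`, `le_upperBoundAt`). Hence `Σ`
satisfies the constraints that define `Σ̂`; a minimizer exists by compactness, and `‖Σ̂‖ ≤ ‖Σ‖` in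
Frobenius norm.

*Eigenvalues.* At a grid point where `μ = γ̄`, two quadratic forms `N`, `N'` that both lie between
the bounds satisfy `N' ≤ s N + e` with slope `s = (1 + γ̄ - ξ) / (1 - γ̄ - ξ) ≤ 3/2`, unless `N'` is
below the resolution of the bound (`exists_slope`); evaluated at the level `t` the right-hand side is
at most `t (1 + 2 γ / (1 - 4γ))` as soon as `γ̄ + β/(2nt) ≤ γ`. By the Courant–Fischer principle the
`i`-th eigenvalues of two symmetric matrices are compared along one unit vector, and replacing that
vector by a point of the net costs `2δ‖Σ‖` for each of the two forms, hence
`(2 · 3/2 + 2) δ‖Σ‖ = 5δ‖Σ‖` in all (`abs_max_sub_max_le`). Taking the two matrices in either order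
gives the two families of bounds.

*Grid.* What remains is a finite grid that depends on `n`, `ε`, `κ`, `m` only, such that at each
level `t` where the error level is finite some grid point has `γ̄ + β/(2nt) ≤ γ(t)` (`exists_grid`).
Its points are tuned to the values `(3/2)^j / 1000` of the ratio `x = m / (√κ t)`: `λ_j` is chosen
so that `μ = γ̄`, and `β_j` minimizes the cost of the perturbation. A mismatch of the ratio by a
factor `3/2` is absorbed by the constant `98.5`, since `m ≤ √κ Tr Σ` (`fourthMomentRoot_le`), and
the share of `ε` spent at a point is paid for by `2.032` and `4.35` (`sum_gridWeight_le`). A finite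
error level forces `x ≤ n`, so that finitely many points suffice.
-/

noncomputable section

namespace RobustPCA

/-! ### The influence function -/

/-- The second-order Taylor polynomial `q(u) = 1 + u + u²/2` of the exponential, which defines the
influence function: `ψ(u) = -log q(-u)` on `[0, 1]`. -/
def expTaylor (u : ℝ) : ℝ := 1 + u + u ^ 2 / 2

lemma half_le_expTaylor (u : ℝ) : 1 / 2 ≤ expTaylor u := by
  unfold expTaylor; nlinarith [sq_nonneg (u + 1)]

lemma expTaylor_pos (u : ℝ) : 0 < expTaylor u := by linarith [half_le_expTaylor u]

/-- The restriction of a real number to the interval `[0, 1]`. -/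
def unitClamp (t : ℝ) : ℝ := min (max t 0) 1

lemma unitClamp_nonneg (t : ℝ) : 0 ≤ unitClamp t := le_min (le_max_right _ _) zero_le_one
lemma unitClamp_le_one (t : ℝ) : unitClamp t ≤ 1 := min_le_right _ _
lemma unitClamp_mono : Monotone unitClamp := fun _ _ h =>
  min_le_min_right _ (max_le_max_right _ h)
lemma continuous_unitClamp : Continuous unitClamp := by unfold unitClamp; fun_prop

/-- A formula for `ψ` without case distinctions. -/
lemma psi_eq (t : ℝ) :
    psi t = Real.log (expTaylor (-unitClamp (-t))) - Real.log (expTaylor (-unitClamp t)) := by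
  have h2 : Real.log (1 / 2) = -Real.log 2 := by rw [one_div, Real.log_inv]
  have e0 : expTaylor (-0) = 1 := by norm_num [expTaylor]
  have e1 : expTaylor (-1) = 1 / 2 := by norm_num [expTaylor]
  have pos : ∀ s : ℝ, 0 ≤ s → psiPos s = -Real.log (expTaylor (-unitClamp s)) := by
    intro s hs
    unfold psiPos
    split_ifs with h
    · have : unitClamp s = 1 := by rw [unitClamp, max_eq_left hs, min_eq_right h]
      rw [this, e1, h2, neg_neg]
    · have : unitClamp s = s := by
        rw [unitClamp, max_eq_left hs, min_eq_left (le_of_not_ge h)]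
      rw [this]; congr 2; unfold expTaylor; ring
  have zero : ∀ s : ℝ, s ≤ 0 → unitClamp s = 0 := by
    intro s hs
    rw [unitClamp, max_eq_right hs, min_eq_left zero_le_one]
  unfold psi
  split_ifs with h
  · rw [pos t h, zero (-t) (by linarith), e0, Real.log_one]; ring
  · rw [pos (-t) (by linarith), zero t (by linarith), e0, Real.log_one]; ring

lemma psi_neg (t : ℝ) : psi (-t) = -psi t := by
  rw [psi_eq, psi_eq, neg_neg]; ring

lemma continuous_psi : Continuous psi := by
  have : psi = fun t => Real.log (expTaylor (-unitClamp (-t)))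
      - Real.log (expTaylor (-unitClamp t)) := funext psi_eq
  rw [this]
  have h : Continuous expTaylor := by unfold expTaylor; fun_prop
  exact ((h.comp (continuous_unitClamp.comp continuous_neg).neg).log
    (fun t => (expTaylor_pos _).ne')).sub
    ((h.comp continuous_unitClamp.neg).log (fun t => (expTaylor_pos _).ne'))

lemma psi_mono : Monotone psi := by
  have key : ∀ s t : ℝ, s ≤ t → Real.log (expTaylor (-unitClamp t))
      ≤ Real.log (expTaylor (-unitClamp s)) := by
    intro s t h
    apply Real.log_le_log (expTaylor_pos _)
    have := unitClamp_mono h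
    have h1 := unitClamp_le_one t
    have h0 := unitClamp_nonneg s
    unfold expTaylor
    nlinarith
  intro s t h
  rw [psi_eq, psi_eq]
  linarith [key s t h, key (-t) (-s) (by linarith)]

lemma psi_eq_log_two {t : ℝ} (ht : 1 ≤ t) : psi t = Real.log 2 := by
  simp [psi, psiPos, ht, zero_le_one.trans ht]

lemma psi_le_log_two (t : ℝ) : psi t ≤ Real.log 2 := by
  rw [← psi_eq_log_two (le_max_right t 1)]
  exact psi_mono (le_max_left _ _)

lemma psi_of_le_neg_one {t : ℝ} (ht : t ≤ -1) : psi t = -Real.log 2 := by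
  have := psi_eq_log_two (t := -t) (by linarith)
  rw [psi_neg] at this; linarith

lemma psi_neg_of_neg {t : ℝ} (ht : t < 0) : psi t < 0 := by
  have h0 : unitClamp t = 0 := by
    rw [unitClamp, max_eq_right ht.le, min_eq_left zero_le_one]
  have h1 : 0 < unitClamp (-t) := by
    rw [unitClamp]; exact lt_min (lt_max_of_lt_left (by linarith)) one_pos
  have h2 := unitClamp_le_one (-t)
  rw [psi_eq, h0]
  have e0 : expTaylor (-0) = 1 := by norm_num [expTaylor]
  rw [e0, Real.log_one, sub_zero]
  apply Real.log_neg (expTaylor_pos _)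
  unfold expTaylor; nlinarith

lemma psi_le_log_expTaylor (u : ℝ) : psi u ≤ Real.log (expTaylor u) := by
  have h2 : Real.log (1 / 2) = -Real.log 2 := by rw [one_div, Real.log_inv]
  rcases le_total u (-1) with h | h
  · rw [psi_of_le_neg_one h, ← h2]
    exact Real.log_le_log (by norm_num) (half_le_expTaylor u)
  rcases le_total 1 u with h1 | h1
  · rw [psi_eq_log_two h1]
    apply Real.log_le_log (by norm_num)
    unfold expTaylor; nlinarith
  have hlow : ∀ t : ℝ, 0 ≤ t → t ≤ 1 → psi t = -Real.log (expTaylor (-t)) := by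
    intro t h0 h1
    have a1 : unitClamp t = t := by rw [unitClamp, max_eq_left h0, min_eq_left h1]
    have a2 : unitClamp (-t) = 0 := by
      rw [unitClamp, max_eq_right (by linarith), min_eq_left zero_le_one]
    rw [psi_eq, a1, a2]; norm_num [expTaylor]
  rcases le_total 0 u with h0 | h0
  · rw [hlow u h0 h1, ← Real.log_inv]
    apply Real.log_le_log (inv_pos.2 (expTaylor_pos _))
    rw [inv_le_iff_one_le_mul₀ (expTaylor_pos _)]
    unfold expTaylor; nlinarith [sq_nonneg (u ^ 2)]
  · have := hlow (-u) (by linarith) (by linarith)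
    rw [psi_neg, neg_neg] at this; linarith

/-- A quadratic minorant of `log q` at `u₀`: the second derivative of `log q` is at least `-1/4`. -/
lemma log_expTaylor_tangent (u₀ u : ℝ) :
    Real.log (expTaylor u₀) + (1 + u₀) / expTaylor u₀ * (u - u₀) - (u - u₀) ^ 2 / 8
      ≤ Real.log (expTaylor u) := by
  set h : ℝ → ℝ := fun u => Real.log (expTaylor u) - (1 + u₀) / expTaylor u₀ * (u - u₀)
    + (u - u₀) ^ 2 / 8 with hh
  have hd : ∀ u, HasDerivAt h ((1 + u) / expTaylor u - (1 + u₀) / expTaylor u₀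
      + (u - u₀) / 4) u := by
    intro u
    have hq : HasDerivAt expTaylor (1 + u) u := by
      have : HasDerivAt (fun u : ℝ => 1 + u + u ^ 2 / 2) (0 + 1 + (2 * u ^ (2 - 1) * 1) / 2) u :=
        ((hasDerivAt_const u (1 : ℝ)).add (hasDerivAt_id u)).add
          (((hasDerivAt_id u).pow 2).div_const 2)
      refine HasDerivAt.congr_deriv (f' := 0 + 1 + (2 * u ^ (2 - 1) * 1) / 2) this ?_
      norm_num
    have h1 := hq.log (expTaylor_pos u).ne'
    have h2 := ((hasDerivAt_id u).sub_const u₀).const_mul ((1 + u₀) / expTaylor u₀)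
    have h3 := (((hasDerivAt_id u).sub_const u₀).pow 2).div_const 8
    refine ((h1.sub h2).add h3).congr_deriv ?_
    simp; ring
  -- the numerator of the derivative of the difference is `u - u₀` times a sum of squares
  have hdiff : ∀ u, (1 + u) / expTaylor u - (1 + u₀) / expTaylor u₀ + (u - u₀) / 4
      = (u - u₀) * (((1 + u) * (1 + u₀) - 3) ^ 2 + (u - u₀) ^ 2)
        / (16 * expTaylor u * expTaylor u₀) := by
    intro u
    have p := (expTaylor_pos u).ne'
    have p0 := (expTaylor_pos u₀).ne'
    field_simp
    unfold expTaylor; ring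
  have hpos : ∀ u, 0 < 16 * expTaylor u * expTaylor u₀ := fun u => by
    have := expTaylor_pos u; have := expTaylor_pos u₀; positivity
  have key : h u₀ ≤ h u := by
    rcases le_total u₀ u with hu | hu
    · have : MonotoneOn h (Set.Ici u₀) := by
        apply monotoneOn_of_deriv_nonneg (convex_Ici _)
        · exact fun x _ => (hd x).continuousAt.continuousWithinAt
        · exact fun x _ => (hd x).differentiableAt.differentiableWithinAt
        · intro x hx
          rw [interior_Ici] at hx
          rw [(hd x).deriv, hdiff]
          exact div_nonneg (mul_nonneg (sub_nonneg.2 (le_of_lt hx)) (by positivity)) (hpos x).le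
      exact this (Set.self_mem_Ici) hu hu
    · have : AntitoneOn h (Set.Iic u₀) := by
        apply antitoneOn_of_deriv_nonpos (convex_Iic _)
        · exact fun x _ => (hd x).continuousAt.continuousWithinAt
        · exact fun x _ => (hd x).differentiableAt.differentiableWithinAt
        · intro x hx
          rw [interior_Iic] at hx
          rw [(hd x).deriv, hdiff]
          exact div_nonpos_of_nonpos_of_nonneg (mul_nonpos_of_nonpos_of_nonneg
            (sub_nonpos.2 (le_of_lt hx)) (by positivity)) (hpos x).le
      exact this hu (Set.self_mem_Iic) hu
  simp only [hh] at key
  simp at key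
  linarith

lemma log_expTaylor_gap {u : ℝ} (hu : 1 ≤ u) : psi u + 1 / 5 ≤ Real.log (expTaylor u) := by
  rw [psi_eq_log_two hu]
  have h1 : Real.log 2 + Real.log (5 / 4) ≤ Real.log (expTaylor u) := by
    rw [← Real.log_mul (by norm_num) (by norm_num)]
    apply Real.log_le_log (by norm_num)
    unfold expTaylor; nlinarith
  have h2 := Real.one_sub_inv_le_log_of_pos (show (0 : ℝ) < 5 / 4 by norm_num)
  norm_num at h2 ⊢; linarith

/-! ### Moments of the standard Gaussian law on the line -/

lemma integrable_pow_gaussian (k : ℕ) : Integrable (fun z : ℝ => z ^ k) (gaussianReal 0 1) := by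
  rcases Nat.eq_zero_or_pos k with rfl | hk
  · simp
  have := (memLp_id_gaussianReal' (μ := 0) (v := 1) (k : ENNReal) (by simp)).integrable_norm_pow
    hk.ne'
  refine this.mono' (by fun_prop) ?_
  filter_upwards with z
  simp

/-- The moments are the derivatives at `0` of the moment generating function `exp (t²/2)`. -/
lemma integral_pow_gaussian :
    ∫ z, z ∂(gaussianReal 0 1) = 0 ∧ ∫ z, z ^ 2 ∂(gaussianReal 0 1) = 1 ∧
    ∫ z, z ^ 3 ∂(gaussianReal 0 1) = 0 ∧ ∫ z, z ^ 4 ∂(gaussianReal 0 1) = 3 := by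
  have hm : ∀ k : ℕ, ∫ z, z ^ k ∂(gaussianReal 0 1)
      = iteratedDeriv k (fun t : ℝ => Real.exp (t ^ 2 / 2)) 0 := by
    intro k
    have h1 := iteratedDeriv_mgf_zero (X := id) (μ := gaussianReal 0 1) (by
      rw [integrableExpSet_id_gaussianReal]; simp) k
    rw [mgf_id_gaussianReal] at h1
    simpa using h1.symm
  have step : ∀ p p' : ℝ → ℝ, (∀ t, HasDerivAt p (p' t) t) →
      deriv (fun t : ℝ => p t * Real.exp (t ^ 2 / 2))
        = fun t => (p' t + t * p t) * Real.exp (t ^ 2 / 2) := by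
    intro p p' hp
    funext t
    have he : HasDerivAt (fun t : ℝ => Real.exp (t ^ 2 / 2)) (Real.exp (t ^ 2 / 2) * t) t := by
      have := (((hasDerivAt_id t).pow 2).div_const 2).exp
      refine this.congr_deriv ?_
      simp
    have := ((hp t).mul he).deriv
    rw [Pi.mul_def] at this
    rw [this]; ring
  have d0 : deriv (fun t : ℝ => Real.exp (t ^ 2 / 2)) = fun t => t * Real.exp (t ^ 2 / 2) := by
    have := step (fun _ => 1) (fun _ => 0) (fun t => hasDerivAt_const t 1)
    simpa using this
  have d1 : deriv (fun t : ℝ => t * Real.exp (t ^ 2 / 2))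
      = fun t => (1 + t ^ 2) * Real.exp (t ^ 2 / 2) := by
    rw [step (fun t => t) (fun _ => 1) (fun t => hasDerivAt_id t)]
    funext t; ring
  have d2 : deriv (fun t : ℝ => (1 + t ^ 2) * Real.exp (t ^ 2 / 2))
      = fun t => (3 * t + t ^ 3) * Real.exp (t ^ 2 / 2) := by
    rw [step (fun t => 1 + t ^ 2) (fun t => 2 * t) (fun t => by
      have := ((hasDerivAt_id t).pow 2).const_add 1
      refine this.congr_deriv ?_
      simp)]
    funext t; ring
  have d3 : deriv (fun t : ℝ => (3 * t + t ^ 3) * Real.exp (t ^ 2 / 2))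
      = fun t => (3 + 6 * t ^ 2 + t ^ 4) * Real.exp (t ^ 2 / 2) := by
    rw [step (fun t => 3 * t + t ^ 3) (fun t => 3 + 3 * t ^ 2) (fun t => by
      have := ((hasDerivAt_id t).const_mul 3).add ((hasDerivAt_id t).pow 3)
      refine this.congr_deriv ?_
      simp)]
    funext t; ring
  refine ⟨?_, ?_, ?_, ?_⟩
  · exact integral_id_gaussianReal
  · rw [hm 2]; simp only [iteratedDeriv_succ, iteratedDeriv_zero, d0, d1]; simp
  · rw [hm 3]; simp only [iteratedDeriv_succ, iteratedDeriv_zero, d0, d1, d2]; simp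
  · rw [hm 4]; simp only [iteratedDeriv_succ, iteratedDeriv_zero, d0, d1, d2, d3]; simp

lemma integrable_quartic_gaussian (p₀ p₁ p₂ p₃ p₄ : ℝ) :
    Integrable (fun z : ℝ => p₀ + p₁ * z + p₂ * z ^ 2 + p₃ * z ^ 3 + p₄ * z ^ 4)
      (gaussianReal 0 1) := by
  have h := integrable_pow_gaussian
  have h1 : Integrable (fun z : ℝ => z) (gaussianReal 0 1) := by simpa using h 1
  exact ((((integrable_const _).add (h1.const_mul _)).add ((h 2).const_mul _)).add
    ((h 3).const_mul _)).add ((h 4).const_mul _)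

lemma integral_quartic_gaussian (p₀ p₁ p₂ p₃ p₄ : ℝ) :
    ∫ z, (p₀ + p₁ * z + p₂ * z ^ 2 + p₃ * z ^ 3 + p₄ * z ^ 4) ∂(gaussianReal 0 1)
      = p₀ + p₂ + 3 * p₄ := by
  have h := integrable_pow_gaussian
  have h1 : Integrable (fun z : ℝ => z) (gaussianReal 0 1) := by simpa using h 1
  obtain ⟨m1, m2, m3, m4⟩ := integral_pow_gaussian
  have i0 := integrable_const (μ := gaussianReal 0 1) p₀
  have i1 : Integrable (fun z : ℝ => p₀ + p₁ * z) (gaussianReal 0 1) := i0.add (h1.const_mul _)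
  have i2 : Integrable (fun z : ℝ => p₀ + p₁ * z + p₂ * z ^ 2) (gaussianReal 0 1) :=
    i1.add ((h 2).const_mul _)
  have i3 : Integrable (fun z : ℝ => p₀ + p₁ * z + p₂ * z ^ 2 + p₃ * z ^ 3) (gaussianReal 0 1) :=
    i2.add ((h 3).const_mul _)
  rw [integral_add i3 ((h 4).const_mul _), integral_add i2 ((h 3).const_mul _),
    integral_add i1 ((h 2).const_mul _), integral_add i0 (h1.const_mul _)]
  have j1 : ∫ z, p₁ * z ∂(gaussianReal 0 1) = p₁ * ∫ z, z ∂(gaussianReal 0 1) :=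
    integral_const_mul p₁ _
  rw [m1] at j1
  simp only [integral_const_mul, j1, m2, m3, m4, integral_const]
  simp; ring

/-! ### The Gaussian perturbation of the influence function -/

lemma cPert_ge : 40 ≤ cPert := by
  have hs1 : Real.sqrt 2 ≤ 1.4143 := by
    rw [Real.sqrt_le_iff]; norm_num
  have hs0 : 1.4142 ≤ Real.sqrt 2 := by
    rw [Real.le_sqrt' (by norm_num)]; norm_num
  have hl1 := Real.log_two_lt_d9
  have hl0 := Real.log_two_gt_d9
  have he : 2.718281828 * 2.33 ≤ Real.exp ((1 + 2 * Real.sqrt 2) / 2) := by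
    have h1 : Real.exp 1 * (1 + 0.9142 + 0.9142 ^ 2 / 2) ≤ Real.exp ((1 + 2 * Real.sqrt 2) / 2) := by
      have h2 : Real.exp (1 + 0.9142) ≤ Real.exp ((1 + 2 * Real.sqrt 2) / 2) :=
        Real.exp_le_exp.2 (by linarith)
      rw [Real.exp_add] at h2
      refine le_trans (mul_le_mul_of_nonneg_left ?_ (Real.exp_pos _).le) h2
      exact Real.quadratic_le_exp_of_nonneg (by norm_num)
    have h3 := Real.exp_one_gt_d9
    nlinarith
  unfold cPert
  have hd : 0 < 8 * Real.log 2 * (Real.sqrt 2 - 1) := mul_pos (by linarith) (by linarith)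
  have hd2 : 8 * Real.log 2 * (Real.sqrt 2 - 1) ≤ 2.2976 := by nlinarith
  rw [div_mul_eq_mul_div, le_div_iff₀ hd]
  nlinarith

lemma cPert_le : cPert ≤ 45 := by
  have hs1 : Real.sqrt 2 ≤ 1.4143 := by
    rw [Real.sqrt_le_iff]; norm_num
  have hs0 : 1.4142 ≤ Real.sqrt 2 := by
    rw [Real.le_sqrt' (by norm_num)]; norm_num
  have hl0 := Real.log_two_gt_d9
  have he : Real.exp ((1 + 2 * Real.sqrt 2) / 2) ≤ 6.8 := by
    have h1 : Real.exp ((1 + 2 * Real.sqrt 2) / 2) ≤ Real.exp 2 * Real.exp (-0.0857) := by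
      rw [← Real.exp_add]; exact Real.exp_le_exp.2 (by linarith)
    have h2 : Real.exp (-0.0857) * (1 + 0.0857 + 0.0857 ^ 2 / 2) ≤ 1 := by
      have h3 := Real.quadratic_le_exp_of_nonneg (show (0 : ℝ) ≤ 0.0857 by norm_num)
      have h4 : Real.exp (-0.0857) * Real.exp 0.0857 = 1 := by
        rw [← Real.exp_add]; norm_num
      nlinarith [Real.exp_pos (-0.0857)]
    have h5 : Real.exp 2 = Real.exp 1 * Real.exp 1 := by rw [← Real.exp_add]; norm_num
    have h6 := Real.exp_one_lt_d9
    have h7 : Real.exp 2 ≤ 7.3891 := by rw [h5]; nlinarith [Real.exp_pos 1]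
    have h8 : Real.exp (-0.0857) ≤ 0.918 := by norm_num at h2 ⊢; linarith
    nlinarith [Real.exp_pos (-0.0857), Real.exp_pos 2]
  unfold cPert
  have hd : 0 < 8 * Real.log 2 * (Real.sqrt 2 - 1) := mul_pos (by linarith) (by linarith)
  have hd2 : 2.2967 ≤ 8 * Real.log 2 * (Real.sqrt 2 - 1) := by nlinarith
  rw [div_mul_eq_mul_div, div_le_iff₀ hd]
  nlinarith

lemma gaussian_Icc_ge : 1 / 6 ≤ (gaussianReal 0 1).real (Set.Icc 0 1) := by
  rw [measureReal_def, gaussianReal_apply_eq_integral _ one_ne_zero,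
    ENNReal.toReal_ofReal (integral_nonneg fun x => gaussianPDFReal_nonneg _ _ _)]
  have hb : ∀ x ∈ Set.Icc (0 : ℝ) 1, 1 / 6 ≤ gaussianPDFReal 0 1 x := by
    intro x hx
    rw [gaussianPDFReal_def]
    have h1 : 1 / 2 ≤ Real.exp (-(x - 0) ^ 2 / (2 * ((1 : NNReal) : ℝ))) := by
      have := Real.add_one_le_exp (-(x - 0) ^ 2 / (2 * ((1 : NNReal) : ℝ)))
      have h2 : -1 / 2 ≤ -(x - 0) ^ 2 / (2 * ((1 : NNReal) : ℝ)) := by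
        simp only [NNReal.coe_one]; nlinarith [hx.1, hx.2]
      linarith
    have h3 : 1 / 3 ≤ (Real.sqrt (2 * Real.pi * ((1 : NNReal) : ℝ)))⁻¹ := by
      rw [one_div]
      apply inv_anti₀ (by simp [Real.pi_pos])
      rw [Real.sqrt_le_left (by norm_num)]
      simp only [NNReal.coe_one]; nlinarith [Real.pi_lt_four]
    nlinarith
  have := setIntegral_ge_of_const_le_real (μ := volume) (measurableSet_Icc) (by simp)
    hb (integrable_gaussianPDFReal 0 1).integrableOn
  simpa using this

lemma gaussian_Ici_ge : 1 / 2 ≤ (gaussianReal 0 1).real (Set.Ici 0) := by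
  have h1 : (gaussianReal 0 1).real (Set.Iic 0) = (gaussianReal 0 1).real (Set.Ici 0) := by
    have h := gaussianReal_map_neg (μ := 0) (v := 1)
    rw [neg_zero] at h
    conv_rhs => rw [← h]
    rw [map_measureReal_apply (by fun_prop) measurableSet_Ici]
    congr 1; ext x; simp
  have h2 : (gaussianReal 0 1).real Set.univ ≤
      (gaussianReal 0 1).real (Set.Iic 0) + (gaussianReal 0 1).real (Set.Ici 0) := by
    rw [← Set.Iic_union_Ici (a := (0 : ℝ))]
    exact measureReal_union_le _ _
  simp at h2
  linarith

/-- `log (q(u₀ + s (G² - E G²)) + c v (G² + v/2))` for the Gaussian variable `G = a + r z` of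
variance `v = r²`; its mean dominates `ψ(u₀)`. -/
def perturbLog (a r u₀ s z : ℝ) : ℝ :=
  Real.log (expTaylor (u₀ + s * ((a + r * z) ^ 2 - r ^ 2 - a ^ 2))
    + cPert * r ^ 2 * ((a + r * z) ^ 2 + r ^ 2 / 2))

section
variable {a r u₀ s : ℝ}

/-- The term added to `q` inside the logarithm is non-negative. -/
lemma corr_nonneg (a r : ℝ) : 0 ≤ cPert * r ^ 2 * (a ^ 2 + r ^ 2 / 2) := by
  have := cPert_ge
  positivity

lemma continuous_perturbLog (a r u₀ s : ℝ) : Continuous (perturbLog a r u₀ s) := by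
  unfold perturbLog
  refine Continuous.log (by unfold expTaylor; fun_prop) fun z => ?_
  have := corr_nonneg (a + r * z) r
  have := expTaylor_pos (u₀ + s * ((a + r * z) ^ 2 - r ^ 2 - a ^ 2))
  linarith

lemma abs_log_le_of_half_le {F : ℝ} (hF : 1 / 2 ≤ F) : |Real.log F| ≤ 1 + F := by
  have h0 : (0 : ℝ) < F := by linarith
  rw [abs_le]
  constructor
  · have := Real.one_sub_inv_le_log_of_pos h0
    have h2 : F⁻¹ ≤ 2 := by rw [inv_le_comm₀ h0 (by norm_num)]; linarith
    linarith
  · linarith [Real.log_le_sub_one_of_pos h0]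

lemma integrable_perturbLog (a r u₀ s : ℝ) :
    Integrable (perturbLog a r u₀ s) (gaussianReal 0 1) := by
  have hp := integrable_quartic_gaussian
    (1 + (1 + (u₀ - s * r ^ 2) + (u₀ - s * r ^ 2) ^ 2 / 2) + cPert * r ^ 2 * (a ^ 2 + r ^ 2 / 2))
    (2 * a * r * (s * (1 + u₀ - s * r ^ 2) + cPert * r ^ 2))
    (r ^ 2 * (s * (1 + u₀ - s * r ^ 2) + cPert * r ^ 2) + s ^ 2 * (2 * a * r) ^ 2 / 2)
    (s ^ 2 * 2 * a * r * r ^ 2) (s ^ 2 * r ^ 4 / 2)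
  refine hp.mono' (continuous_perturbLog a r u₀ s).aestronglyMeasurable ?_
  filter_upwards with z
  have h1 := corr_nonneg (a + r * z) r
  have h2 := half_le_expTaylor (u₀ + s * ((a + r * z) ^ 2 - r ^ 2 - a ^ 2))
  refine (abs_log_le_of_half_le (by linarith)).trans (le_of_eq ?_)
  unfold expTaylor; ring

lemma perturbLog_ge_neg_log_two (a r u₀ s z : ℝ) : -Real.log 2 ≤ perturbLog a r u₀ s z := by
  rw [← Real.log_inv]
  have h1 := corr_nonneg (a + r * z) r
  have h2 := half_le_expTaylor (u₀ + s * ((a + r * z) ^ 2 - r ^ 2 - a ^ 2))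
  exact Real.log_le_log (by norm_num) (by norm_num at h2 ⊢; linarith)

lemma perturbLog_ge_log_expTaylor (a r u₀ s z : ℝ) :
    Real.log (expTaylor (u₀ + s * ((a + r * z) ^ 2 - r ^ 2 - a ^ 2))) ≤ perturbLog a r u₀ s z :=
  Real.log_le_log (expTaylor_pos _) (by linarith [corr_nonneg (a + r * z) r])

/-- The mean of the quadratic minorant of `log (q(u₀ + s (G² - E G²)))`: the linear term has mean
zero and the quadratic one costs `Var(G²)/8`. -/
lemma integral_minorant (a r u₀ : ℝ) (hs : s ^ 2 = 1) (k : ℝ) :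
    Integrable (fun z => Real.log (expTaylor u₀)
      + k * (u₀ + s * ((a + r * z) ^ 2 - r ^ 2 - a ^ 2) - u₀)
      - (u₀ + s * ((a + r * z) ^ 2 - r ^ 2 - a ^ 2) - u₀) ^ 2 / 8) (gaussianReal 0 1) ∧
    ∫ z, (Real.log (expTaylor u₀)
      + k * (u₀ + s * ((a + r * z) ^ 2 - r ^ 2 - a ^ 2) - u₀)
      - (u₀ + s * ((a + r * z) ^ 2 - r ^ 2 - a ^ 2) - u₀) ^ 2 / 8) ∂(gaussianReal 0 1)
      = Real.log (expTaylor u₀) - (2 * a ^ 2 * r ^ 2 + r ^ 4) / 4 := by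
  have e : (fun z : ℝ => Real.log (expTaylor u₀)
      + k * (u₀ + s * ((a + r * z) ^ 2 - r ^ 2 - a ^ 2) - u₀)
      - (u₀ + s * ((a + r * z) ^ 2 - r ^ 2 - a ^ 2) - u₀) ^ 2 / 8)
      = fun z => (Real.log (expTaylor u₀) - k * s * r ^ 2 - r ^ 4 / 8)
        + (k * s * (2 * a * r) + a * r ^ 3 / 2) * z
        + (k * s * r ^ 2 - a ^ 2 * r ^ 2 / 2 + r ^ 4 / 4) * z ^ 2
        + (-(a * r ^ 3 / 2)) * z ^ 3 + (-(r ^ 4 / 8)) * z ^ 4 := by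
    funext z
    have : (u₀ + s * ((a + r * z) ^ 2 - r ^ 2 - a ^ 2) - u₀) ^ 2
        = ((a + r * z) ^ 2 - r ^ 2 - a ^ 2) ^ 2 := by
      rw [add_sub_cancel_left, mul_pow, hs, one_mul]
    rw [this]; ring
  rw [e]
  refine ⟨integrable_quartic_gaussian _ _ _ _ _, ?_⟩
  rw [integral_quartic_gaussian]; ring

/-- Lower bound on the correction term, as a multiple of `Var(G²)/2 = 2 a² r² + r⁴`: on the half-line
where the cross term `2 a r z` is non-negative, `G² ≥ a²`. -/
lemma corr_ge (har : 0 ≤ a * r) {z : ℝ} (hz : 0 ≤ z) :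
    20 * (2 * a ^ 2 * r ^ 2 + r ^ 4) ≤ cPert * r ^ 2 * ((a + r * z) ^ 2 + r ^ 2 / 2) := by
  have hc := cPert_ge
  have h1 : a ^ 2 ≤ (a + r * z) ^ 2 := by nlinarith [mul_nonneg har hz, sq_nonneg (r * z)]
  have h2 : 40 * (r ^ 2 * (a ^ 2 + r ^ 2 / 2))
      ≤ cPert * (r ^ 2 * ((a + r * z) ^ 2 + r ^ 2 / 2)) := by gcongr
  linarith

lemma psi_le_integral_perturbLog_of_nonneg (hs : s ^ 2 = 1) (har : 0 ≤ a * r) :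
    psi u₀ ≤ ∫ z, perturbLog a r u₀ s z ∂(gaussianReal 0 1) := by
  -- half the variance of `G²`
  set x := 2 * a ^ 2 * r ^ 2 + r ^ 4 with hx
  have hx0 : 0 ≤ x := by positivity
  have hl2 := Real.log_two_gt_d9
  have hint := integrable_perturbLog a r u₀ s
  obtain ⟨mi, me⟩ := integral_minorant (s := s) a r u₀ hs ((1 + u₀) / expTaylor u₀)
  have htan := fun z : ℝ => log_expTaylor_tangent u₀ (u₀ + s * ((a + r * z) ^ 2 - r ^ 2 - a ^ 2))
  rcases le_total u₀ (-1) with hu | hu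
  · rw [psi_of_le_neg_one hu]
    have := integral_mono (μ := gaussianReal 0 1) (integrable_const _) hint
      (perturbLog_ge_neg_log_two a r u₀ s)
    simpa using this
  rcases le_total (3 / 8) x with hx1 | hx1
  · -- the correction makes the argument of the logarithm at least `8` with probability `1/2`
    refine (psi_le_log_two u₀).trans ?_
    set f : ℝ → ℝ := fun z => -Real.log 2 + (Set.Ici (0 : ℝ)).indicator (fun _ => 4 * Real.log 2) z
    have hf : Integrable f (gaussianReal 0 1) :=
      (integrable_const _).add ((integrable_const _).indicator measurableSet_Ici)
    have hle : ∀ z, f z ≤ perturbLog a r u₀ s z := by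
      intro z
      by_cases hz : 0 ≤ z
      · have h8 : Real.log 8 = 3 * Real.log 2 := by
          rw [show (8 : ℝ) = 2 ^ 3 by norm_num, Real.log_pow]; norm_num
        have h1 := corr_ge har hz
        have h2 := half_le_expTaylor (u₀ + s * ((a + r * z) ^ 2 - r ^ 2 - a ^ 2))
        have : Real.log 8 ≤ perturbLog a r u₀ s z :=
          Real.log_le_log (by norm_num) (by linarith)
        simp only [f, Set.indicator_of_mem (Set.mem_Ici.2 hz)]
        linarith
      · simp only [f, Set.indicator_of_notMem (fun h => hz (Set.mem_Ici.1 h)), add_zero]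
        exact perturbLog_ge_neg_log_two a r u₀ s z
    refine le_trans ?_ (integral_mono hf hint hle)
    simp only [f]
    rw [integral_add (integrable_const _) ((integrable_const _).indicator measurableSet_Ici),
      integral_indicator_const _ measurableSet_Ici]
    have := gaussian_Ici_ge
    simp only [integral_const, probReal_univ, smul_eq_mul]
    nlinarith
  rcases le_total 1 u₀ with hu1 | hu1
  · -- the gap `1/5` between `ψ` and `log q` exceeds the cost `x/4 ≤ 3/32`
    have hg := log_expTaylor_gap hu1
    have h := integral_mono mi hint (fun z => (htan z).trans (perturbLog_ge_log_expTaylor a r u₀ s z))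
    rw [me] at h
    linarith
  · -- on `0 ≤ z ≤ 1` the correction increases the logarithm by a multiple of `Var (G²)`
    have hlow : ∀ z, Real.log (expTaylor u₀)
        + (1 + u₀) / expTaylor u₀ * (u₀ + s * ((a + r * z) ^ 2 - r ^ 2 - a ^ 2) - u₀)
        - (u₀ + s * ((a + r * z) ^ 2 - r ^ 2 - a ^ 2) - u₀) ^ 2 / 8
        + (Set.Icc (0 : ℝ) 1).indicator (fun _ => 1.6 * x) z ≤ perturbLog a r u₀ s z := by
      intro z
      by_cases hz : z ∈ Set.Icc (0 : ℝ) 1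
      · rw [Set.indicator_of_mem hz]
        refine (add_le_add_left (htan z) _).trans ?_
        set U := u₀ + s * ((a + r * z) ^ 2 - r ^ 2 - a ^ 2) with hU
        set R := cPert * r ^ 2 * ((a + r * z) ^ 2 + r ^ 2 / 2) with hR
        have hR20 : 20 * x ≤ R := corr_ge har hz.1
        have hq0 := expTaylor_pos U
        have hq5 : expTaylor U ≤ 5 := by
          set Δ := (a + r * z) ^ 2 - r ^ 2 - a ^ 2 with hΔ
          have hΔe : Δ = 2 * (a * r) * z + r ^ 2 * (z ^ 2 - 1) := by rw [hΔ]; ring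
          have hz2 : z ^ 2 ≤ 1 := by nlinarith [hz.1, hz.2]
          have hr2 : r ^ 2 ≤ 0.8 := by nlinarith [sq_nonneg (a * r), sq_nonneg r]
          have har2 : a * r ≤ 0.45 := by nlinarith [sq_nonneg (r ^ 2)]
          have hΔ1 : Δ ≤ 0.9 := by
            rw [hΔe]; nlinarith [mul_le_mul_of_nonneg_left hz.2 har, sq_nonneg r]
          have hΔ2 : -0.9 ≤ Δ := by
            rw [hΔe]; nlinarith [mul_nonneg har hz.1, mul_nonneg (sq_nonneg r) (sq_nonneg z)]
          have hs1 : s * Δ ≤ 0.9 ∧ -0.9 ≤ s * Δ := by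
            rcases (mul_self_eq_one_iff.1 ((sq s) ▸ hs)) with h | h <;> rw [h] <;> constructor <;> linarith
          have hU1 : U ≤ 1.9 := by linarith [hs1.1]
          have hU2 : -1.9 ≤ U := by linarith [hs1.2]
          unfold expTaylor; nlinarith
        have hrat : 1 + 4 * x ≤ 1 + R / expTaylor U := by
          have : 4 * x ≤ R / expTaylor U := by
            rw [le_div_iff₀ hq0]; nlinarith
          linarith
        have hlog : Real.log (expTaylor U + R)
            = Real.log (expTaylor U) + Real.log (1 + R / expTaylor U) := by
          rw [← Real.log_mul hq0.ne' (by linarith)]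
          congr 1; field_simp
        have h14 : 1.6 * x ≤ Real.log (1 + R / expTaylor U) := by
          have h1 := Real.one_sub_inv_le_log_of_pos (show 0 < 1 + 4 * x by linarith)
          have h2 := Real.log_le_log (by linarith) hrat
          have h3 : 1.6 * x ≤ 1 - (1 + 4 * x)⁻¹ := by
            have : 1 - (1 + 4 * x)⁻¹ = 4 * x / (1 + 4 * x) := by
              field_simp; ring
            rw [this, le_div_iff₀ (by linarith)]; nlinarith
          linarith
        have : perturbLog a r u₀ s z = Real.log (expTaylor U + R) := rfl
        rw [this, hlog]
        linarith
      · rw [Set.indicator_of_notMem hz, add_zero]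
        exact (htan z).trans (perturbLog_ge_log_expTaylor a r u₀ s z)
    have hind : Integrable ((Set.Icc (0 : ℝ) 1).indicator (fun _ => 1.6 * x)) (gaussianReal 0 1) :=
      (integrable_const _).indicator measurableSet_Icc
    have h := integral_mono (mi.add hind) hint hlow
    rw [integral_add' mi hind, me, integral_indicator_const _ measurableSet_Icc] at h
    have hP := gaussian_Icc_ge
    have := psi_le_log_expTaylor u₀
    simp only [smul_eq_mul] at h
    nlinarith

/-- The influence function is dominated by the mean of the perturbed logarithm: the symmetry of the
Gaussian law reduces the claim to `a r ≥ 0`. -/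
theorem psi_le_integral_perturbLog (a r u₀ : ℝ) (hs : s ^ 2 = 1) :
    psi u₀ ≤ ∫ z, perturbLog a r u₀ s z ∂(gaussianReal 0 1) := by
  rcases le_total 0 (a * r) with h | h
  · exact psi_le_integral_perturbLog_of_nonneg hs h
  · have h1 := psi_le_integral_perturbLog_of_nonneg (u₀ := u₀) (a := -a) (r := r) hs (by linarith)
    have h2 := gaussianReal_map_neg (μ := 0) (v := 1)
    rw [neg_zero] at h2
    rw [← h2, integral_map (by fun_prop)
      (continuous_perturbLog _ _ _ _).aestronglyMeasurable] at h1
    have e : (fun z => perturbLog (-a) r u₀ s (-z)) = perturbLog a r u₀ s := by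
      funext z; unfold perturbLog
      have e1 : (-a + r * -z) ^ 2 = (a + r * z) ^ 2 := by ring
      rw [e1, neg_sq]
    rwa [e] at h1

end

/-! ### Standard Gaussian vectors -/

section Gauss
variable {d : ℕ}
local notation "V" => EuclideanSpace ℝ (Fin d)

/-- Density of the standard Gaussian law with respect to Lebesgue measure. -/
def gaussDensity (z : V) : ℝ :=
  (2 * Real.pi) ^ (-(d : ℝ) / 2) * Real.exp (-(1 / 2) * ‖z‖ ^ 2)

lemma gaussDensity_nonneg (z : V) : 0 ≤ gaussDensity z := by
  unfold gaussDensity; have := Real.pi_pos; positivity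

lemma continuous_gaussDensity : Continuous (gaussDensity : V → ℝ) := by
  unfold gaussDensity; fun_prop

lemma integral_gaussDensity : ∫ z : V, gaussDensity z = 1 := by
  unfold gaussDensity
  rw [integral_const_mul, GaussianFourier.integral_rexp_neg_mul_sq_norm (by norm_num)]
  have hpi := Real.pi_pos
  rw [show Real.pi / (1 / 2) = 2 * Real.pi by ring, finrank_euclideanSpace_fin,
    ← Real.rpow_add (by positivity)]
  rw [show -(d : ℝ) / 2 + (d : ℝ) / 2 = 0 by ring, Real.rpow_zero]

lemma integrable_gaussDensity : Integrable (gaussDensity : V → ℝ) := by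
  by_contra h
  have := integral_gaussDensity (d := d)
  rw [integral_undef h] at this
  exact zero_ne_one this

/-- The two laws have the same characteristic function. -/
lemma stdGaussian_eq_withDensity :
    stdGaussian V = volume.withDensity (fun z => ENNReal.ofReal (gaussDensity z)) := by
  have hfin : IsFiniteMeasure (volume.withDensity fun z : V => ENNReal.ofReal (gaussDensity z)) := by
    apply isFiniteMeasure_withDensity_ofReal
    exact integrable_gaussDensity.2
  apply Measure.ext_of_charFun
  funext t
  rw [charFun_stdGaussian, charFun_apply,
    integral_withDensity_eq_integral_toReal_smul
      (continuous_gaussDensity.measurable.ennreal_ofReal) (by simp)]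
  have hpi := Real.pi_pos
  have e : ∀ z : V, (ENNReal.ofReal (gaussDensity z)).toReal • Complex.exp (inner ℝ z t * Complex.I)
      = (((2 * Real.pi) ^ (-(d : ℝ) / 2) : ℝ) : ℂ) *
        Complex.exp (-(1 / 2 : ℂ) * ‖z‖ ^ 2 + Complex.I * inner ℝ t z) := by
    intro z
    rw [ENNReal.toReal_ofReal (gaussDensity_nonneg z), gaussDensity, Complex.exp_add,
      real_inner_comm]
    rw [Complex.real_smul]
    push_cast
    ring_nf
  simp_rw [e]
  rw [integral_const_mul, GaussianFourier.integral_cexp_neg_mul_sq_norm_add (by norm_num)]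
  rw [finrank_euclideanSpace_fin]
  have e2 : ((Real.pi : ℂ) / (1 / 2)) ^ ((d : ℂ) / 2) = (((2 * Real.pi) ^ ((d : ℝ) / 2) : ℝ) : ℂ) := by
    rw [Complex.ofReal_cpow (by positivity)]
    push_cast
    congr 1; ring
  rw [e2, ← mul_assoc, ← Complex.ofReal_mul, ← Real.rpow_add (by positivity),
    show -(d : ℝ) / 2 + (d : ℝ) / 2 = 0 by ring, Real.rpow_zero]
  simp only [Complex.I_sq]
  push_cast
  rw [one_mul]; congr 1; ring

/-- Change of variables between the standard Gaussian law and its translate by `h`. -/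
lemma lintegral_stdGaussian_shift (h : V) {f : V → ENNReal} (hf : Measurable f) :
    ∫⁻ z, f z ∂(stdGaussian V)
      = ∫⁻ z, f (z + h) * ENNReal.ofReal (Real.exp (-inner ℝ h z - ‖h‖ ^ 2 / 2))
        ∂(stdGaussian V) := by
  have hm : Measurable fun z : V => ENNReal.ofReal (gaussDensity z) :=
    continuous_gaussDensity.measurable.ennreal_ofReal
  rw [stdGaussian_eq_withDensity, lintegral_withDensity_eq_lintegral_mul _ hm hf,
    lintegral_withDensity_eq_lintegral_mul _ hm (by fun_prop),
    ← lintegral_add_right_eq_self _ h]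
  congr 1; funext z
  simp only [Pi.mul_apply]
  have : gaussDensity (z + h) = gaussDensity z * Real.exp (-inner ℝ h z - ‖h‖ ^ 2 / 2) := by
    unfold gaussDensity
    rw [mul_assoc, ← Real.exp_add, norm_add_sq_real, real_inner_comm]
    congr 2; ring
  rw [this, ENNReal.ofReal_mul (gaussDensity_nonneg z)]
  ring

lemma map_inner_stdGaussian (x : V) :
    (stdGaussian V).map (fun z => inner ℝ z x) = (gaussianReal 0 1).map (fun t => ‖x‖ * t) := by
  have hm : Measurable fun z : V => inner ℝ z x := by fun_prop
  have := Measure.isProbabilityMeasure_map (μ := stdGaussian V) hm.aemeasurable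
  have := Measure.isProbabilityMeasure_map (μ := gaussianReal 0 1)
    (measurable_const_mul ‖x‖).aemeasurable
  apply Measure.ext_of_charFun
  funext t
  rw [gaussianReal_map_const_mul, charFun_gaussianReal, charFun_apply_real,
    integral_map hm.aemeasurable (by fun_prop)]
  have h := charFun_stdGaussian (t • x)
  rw [charFun_apply] at h
  simp only [inner_smul_right] at h
  push_cast at h ⊢
  rw [h, norm_smul]
  congr 1
  simp
  rw [mul_pow, ← Complex.ofReal_pow |t|, sq_abs]; push_cast; ring

lemma integral_comp_inner_stdGaussian (x : V) {f : ℝ → ℝ} (hf : Continuous f) :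
    ∫ z, f (inner ℝ z x) ∂(stdGaussian V) = ∫ t, f (‖x‖ * t) ∂(gaussianReal 0 1) := by
  rw [← integral_map (φ := fun z : V => inner ℝ z x) (by fun_prop) hf.aestronglyMeasurable,
    map_inner_stdGaussian, integral_map (by fun_prop) hf.aestronglyMeasurable]

lemma integrable_comp_inner_stdGaussian (x : V) {f : ℝ → ℝ} (hf : Continuous f)
    (hi : Integrable (fun t => f (‖x‖ * t)) (gaussianReal 0 1)) :
    Integrable (fun z => f (inner ℝ z x)) (stdGaussian V) := by
  have h1 : Integrable f ((gaussianReal 0 1).map (fun t => ‖x‖ * t)) :=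
    (integrable_map_measure hf.aestronglyMeasurable (by fun_prop)).2 hi
  rw [← map_inner_stdGaussian] at h1
  exact (integrable_map_measure (f := fun z : V => inner ℝ z x) hf.aestronglyMeasurable
    (by fun_prop)).1 h1

lemma integral_inner_stdGaussian (h : V) :
    Integrable (fun z => inner ℝ h z) (stdGaussian V) ∧
    ∫ z, inner ℝ h z ∂(stdGaussian V) = 0 := by
  have e : (fun z : V => inner ℝ h z) = fun z => id (inner ℝ z h) := by
    funext z; exact real_inner_comm _ _
  have h1 : Integrable (fun z : ℝ => z) (gaussianReal 0 1) := by
    simpa using integrable_pow_gaussian 1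
  constructor
  · rw [e]
    exact integrable_comp_inner_stdGaussian h continuous_id (h1.const_mul _)
  · rw [e, integral_comp_inner_stdGaussian h continuous_id]
    simp only [id]
    rw [integral_const_mul, integral_pow_gaussian.1, mul_zero]

/-- The change-of-measure inequality: the mean of `ℓ` under the Gaussian law centred at `h` is at
most the log-Laplace transform of `ℓ` under the centred law plus the Kullback divergence `‖h‖²/2`
of the two laws. -/
theorem integral_shift_le_log {ℓ : V → ℝ} (hℓ : Measurable ℓ) (h : V) {K : ℝ} (hK : 0 < K)
    (hle : ∫⁻ z, ENNReal.ofReal (Real.exp (ℓ z)) ∂(stdGaussian V) ≤ ENNReal.ofReal K)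
    (hint : Integrable (fun z => ℓ (z + h)) (stdGaussian V)) :
    ∫ z, ℓ (z + h) ∂(stdGaussian V) ≤ Real.log K + ‖h‖ ^ 2 / 2 := by
  obtain ⟨i1, i2⟩ := integral_inner_stdGaussian h
  set g : V → ℝ := fun z => ℓ (z + h) + (-inner ℝ h z - ‖h‖ ^ 2 / 2) with hg
  have hgm : Measurable g := by fun_prop
  have hgi : Integrable g (stdGaussian V) := hint.add (i1.neg.sub (integrable_const _))
  rw [lintegral_stdGaussian_shift h (by fun_prop)] at hle
  have e : ∀ z, ENNReal.ofReal (Real.exp (ℓ (z + h)))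
      * ENNReal.ofReal (Real.exp (-inner ℝ h z - ‖h‖ ^ 2 / 2)) = ENNReal.ofReal (Real.exp (g z)) := by
    intro z
    rw [← ENNReal.ofReal_mul (Real.exp_pos _).le, ← Real.exp_add]
  simp_rw [e] at hle
  have hexpi : Integrable (fun z => Real.exp (g z)) (stdGaussian V) := by
    refine ⟨by fun_prop, ?_⟩
    rw [hasFiniteIntegral_iff_ofReal (Filter.Eventually.of_forall fun z => (Real.exp_pos _).le)]
    exact hle.trans_lt ENNReal.ofReal_lt_top
  have hJ := convexOn_exp.map_integral_le Real.continuous_exp.continuousOn isClosed_univ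
    (Filter.Eventually.of_forall fun z => Set.mem_univ (g z)) hgi hexpi
  rw [← ofReal_integral_eq_lintegral_ofReal hexpi
    (Filter.Eventually.of_forall fun z => (Real.exp_pos _).le)] at hle
  have h2 := (ENNReal.ofReal_le_ofReal_iff hK.le).1 hle
  have h3 : ∫ z, g z ∂(stdGaussian V) ≤ Real.log K := by
    rw [Real.le_log_iff_exp_le hK]; exact hJ.trans h2
  have h4 : ∫ z, g z ∂(stdGaussian V) = ∫ z, ℓ (z + h) ∂(stdGaussian V) - ‖h‖ ^ 2 / 2 := by
    simp only [hg]
    have i3 : Integrable (fun z => -inner ℝ h z) (stdGaussian V) := i1.neg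
    have i4 : Integrable (fun z => -inner ℝ h z - ‖h‖ ^ 2 / 2) (stdGaussian V) :=
      i3.sub (integrable_const _)
    rw [integral_add hint i4, integral_sub i3 (integrable_const _), integral_neg, i2]
    simp; ring
  linarith

end Gauss

/-! ### Exponential moments of the empirical process -/

/-- If `F > 0`, the prior mean of `∏ᵢ F(z, Xᵢ) exp(-n (E F(z, X) - 1))` has expectation at most one,
so that by Markov's inequality it exceeds `1/ε'` with probability at most `ε'`. -/
theorem exists_event_lintegral_exp_le {Ω 𝒳 𝒵 : Type*} [MeasurableSpace Ω] [MeasurableSpace 𝒳]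
    [MeasurableSpace 𝒵] (μ : Measure Ω) [IsProbabilityMeasure μ] (P : Measure 𝒳)
    [IsProbabilityMeasure P] (γ : Measure 𝒵) [IsProbabilityMeasure γ] {n : ℕ}
    (X : Fin n → Ω → 𝒳) (hX : ∀ k, Measurable (X k)) (hind : iIndepFun X μ)
    (hlaw : ∀ k, μ.map (X k) = P) (F : 𝒵 → 𝒳 → ℝ) (hF : Measurable (Function.uncurry F))
    (hpos : ∀ z x, 0 < F z x) (hint : ∀ z, Integrable (F z) P) {ε' : ℝ} (hε' : 0 < ε') :
    ∃ E : Set Ω, MeasurableSet E ∧ μ Eᶜ ≤ ENNReal.ofReal ε' ∧ ∀ ω ∈ E,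
      ∫⁻ z, ENNReal.ofReal (Real.exp (∑ k, Real.log (F z (X k ω)) - n * (∫ x, F z x ∂P - 1))) ∂γ
        ≤ ENNReal.ofReal ε'⁻¹ := by
  set H : 𝒵 → ℝ := fun z => ∫ x, F z x ∂P with hH
  have hHm : Measurable H := by
    have : StronglyMeasurable fun z => ∫ x, Function.uncurry F (z, x) ∂P :=
      hF.stronglyMeasurable.integral_prod_right'
    exact this.measurable
  set M : Ω → 𝒵 → ENNReal := fun ω z =>
    ENNReal.ofReal (Real.exp (∑ k, Real.log (F z (X k ω)) - n * (H z - 1))) with hM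
  have hFz : ∀ z, Measurable (F z) := fun z => hF.comp (measurable_const.prodMk measurable_id)
  have hMm : Measurable (Function.uncurry M) := by
    apply Measurable.ennreal_ofReal
    apply Real.measurable_exp.comp
    apply Measurable.sub
    · refine Finset.measurable_sum _ fun k _ => Real.measurable_log.comp ?_
      exact hF.comp (measurable_snd.prodMk ((hX k).comp measurable_fst))
    · exact ((hHm.comp measurable_snd).sub_const 1).const_mul _
  have hLm : Measurable fun ω => ∫⁻ z, M ω z ∂γ := hMm.lintegral_prod_right'
  have hone : ∀ z, ∫⁻ ω, M ω z ∂μ ≤ 1 := by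
    intro z
    have e1 : ∀ ω, M ω z = (∏ k, ENNReal.ofReal (F z (X k ω)))
        * ENNReal.ofReal (Real.exp (-(n * (H z - 1)))) := by
      intro ω
      simp only [hM]
      rw [sub_eq_add_neg, Real.exp_add, ENNReal.ofReal_mul (Real.exp_pos _).le, Real.exp_sum,
        ENNReal.ofReal_prod_of_nonneg (fun k _ => (Real.exp_pos _).le)]
      congr 1
      exact Finset.prod_congr rfl fun k _ => by rw [Real.exp_log (hpos _ _)]
    simp_rw [e1]
    have hk : ∀ k, Measurable fun ω => ENNReal.ofReal (F z (X k ω)) := fun k =>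
      ((hFz z).comp (hX k)).ennreal_ofReal
    rw [lintegral_mul_const _ (Finset.measurable_prod _ fun k _ => hk k)]
    have hi : iIndepFun (fun k ω => ENNReal.ofReal (F z (X k ω))) μ :=
      hind.comp (fun _ x => ENNReal.ofReal (F z x)) (fun _ => (hFz z).ennreal_ofReal)
    rw [lintegral_prod_eq_prod_lintegral_of_indepFun Finset.univ _ hi hk]
    have e2 : ∀ k, ∫⁻ ω, ENNReal.ofReal (F z (X k ω)) ∂μ = ENNReal.ofReal (H z) := by
      intro k
      rw [hH, ofReal_integral_eq_lintegral_ofReal (hint z)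
        (Filter.Eventually.of_forall fun x => (hpos z x).le), ← hlaw k,
        lintegral_map (hFz z).ennreal_ofReal (hX k)]
    simp_rw [e2]
    have hH0 : 0 ≤ H z := integral_nonneg fun x => (hpos z x).le
    rw [Finset.prod_const, Finset.card_univ, Fintype.card_fin, ← ENNReal.ofReal_pow hH0,
      ← ENNReal.ofReal_mul (pow_nonneg hH0 n), ← ENNReal.ofReal_one]
    apply ENNReal.ofReal_le_ofReal
    have : H z ^ n ≤ Real.exp (n * (H z - 1)) := by
      rw [Real.exp_nat_mul]
      exact pow_le_pow_left₀ hH0 (by linarith [Real.add_one_le_exp (H z - 1)]) n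
    calc H z ^ n * Real.exp (-(n * (H z - 1)))
        ≤ Real.exp (n * (H z - 1)) * Real.exp (-(n * (H z - 1))) := by gcongr
      _ = 1 := by rw [← Real.exp_add]; simp
  have htot : ∫⁻ ω, ∫⁻ z, M ω z ∂γ ∂μ ≤ 1 := by
    rw [lintegral_lintegral_swap hMm.aemeasurable]
    calc _ ≤ ∫⁻ _ : 𝒵, 1 ∂γ := lintegral_mono hone
      _ = 1 := by simp
  refine ⟨{ω | ∫⁻ z, M ω z ∂γ ≤ ENNReal.ofReal ε'⁻¹}, measurableSet_le hLm measurable_const, ?_,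
    fun ω hω => hω⟩
  have hK0 : ENNReal.ofReal ε'⁻¹ ≠ 0 := by simp [hε']
  have hsub : {ω | ∫⁻ z, M ω z ∂γ ≤ ENNReal.ofReal ε'⁻¹}ᶜ
      ⊆ {ω | ENNReal.ofReal ε'⁻¹ ≤ ∫⁻ z, M ω z ∂γ} := fun ω hω =>
    (not_le.1 (show ¬ ∫⁻ z, M ω z ∂γ ≤ ENNReal.ofReal ε'⁻¹ from hω)).le
  refine (measure_mono hsub).trans ((meas_ge_le_lintegral_div hLm.aemeasurable hK0
    ENNReal.ofReal_ne_top).trans ?_)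
  refine (ENNReal.div_le_div_right htot _).trans ?_
  rw [one_div, ENNReal.ofReal_inv_of_pos hε', inv_inv]

/-! ### The deviation inequality for the truncated empirical energy -/

section Deviation
variable {d : ℕ}
local notation "V" => EuclideanSpace ℝ (Fin d)

/-- The energy `E⟨θ,X⟩²` of the direction `θ`. -/
def energy (P : Measure V) (θ : V) : ℝ := ∫ x, (inner ℝ θ x) ^ 2 ∂P

lemma energy_nonneg (P : Measure V) (θ : V) : 0 ≤ energy P θ :=
  integral_nonneg fun _ => sq_nonneg _

lemma energy_smul (P : Measure V) (α : ℝ) (θ : V) : energy P (α • θ) = α ^ 2 * energy P θ := by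
  unfold energy
  rw [← integral_const_mul]
  simp_rw [real_inner_smul_left, mul_pow]

/-- The Cauchy–Schwarz inequality for integrals of real functions. -/
lemma integral_mul_le_sqrt_mul_sqrt {𝒳 : Type*} [MeasurableSpace 𝒳] {P : Measure 𝒳} {f g : 𝒳 → ℝ}
    (hf : Integrable (fun x => f x ^ 2) P) (hg : Integrable (fun x => g x ^ 2) P)
    (hfg : Integrable (fun x => f x * g x) P) :
    ∫ x, f x * g x ∂P ≤ Real.sqrt (∫ x, f x ^ 2 ∂P) * Real.sqrt (∫ x, g x ^ 2 ∂P) := by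
  have hA : 0 ≤ ∫ x, f x ^ 2 ∂P := integral_nonneg fun _ => sq_nonneg _
  have key : ∀ t : ℝ, 0 ≤ (∫ x, f x ^ 2 ∂P) * (t * t) + (2 * ∫ x, f x * g x ∂P) * t
      + ∫ x, g x ^ 2 ∂P := by
    intro t
    have h0 : 0 ≤ ∫ x, (f x * t + g x) ^ 2 ∂P := integral_nonneg fun _ => sq_nonneg _
    have e : ∀ x, (f x * t + g x) ^ 2 = (t * t) * f x ^ 2 + (2 * t) * (f x * g x) + g x ^ 2 := by
      intro x; ring
    simp_rw [e] at h0
    have i1 : Integrable (fun x => (t * t) * f x ^ 2 + (2 * t) * (f x * g x)) P :=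
      (hf.const_mul _).add (hfg.const_mul _)
    rw [integral_add i1 hg, integral_add (hf.const_mul _) (hfg.const_mul _), integral_const_mul,
      integral_const_mul] at h0
    linarith
  have h := discrim_le_zero key
  rw [← Real.sqrt_mul hA]
  apply Real.le_sqrt_of_sq_le
  unfold discrim at h
  nlinarith

/-- The function under the logarithm, for the direction `ρ z` and the observation `x`; here `z` is
a Gaussian vector with unit covariance and `ρ² = 1/β`. -/
def perturbFun (ρ lam s : ℝ) (z x : V) : ℝ :=
  expTaylor (s * ((ρ * inner ℝ z x) ^ 2 - (ρ * ‖x‖) ^ 2 - lam))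
    + cPert * (ρ * ‖x‖) ^ 2 * ((ρ * inner ℝ z x) ^ 2 + (ρ * ‖x‖) ^ 2 / 2)

lemma half_le_perturbFun (ρ lam s : ℝ) (z x : V) : 1 / 2 ≤ perturbFun ρ lam s z x := by
  unfold perturbFun
  have := corr_nonneg (ρ * inner ℝ z x) (ρ * ‖x‖)
  have := half_le_expTaylor (s * ((ρ * inner ℝ z x) ^ 2 - (ρ * ‖x‖) ^ 2 - lam))
  linarith

lemma continuous_perturbFun (ρ lam s : ℝ) :
    Continuous (Function.uncurry (perturbFun ρ lam s : V → V → ℝ)) := by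
  unfold perturbFun expTaylor Function.uncurry
  fun_prop

lemma continuous_perturbFun_left (ρ lam s : ℝ) (x : V) :
    Continuous fun z : V => perturbFun ρ lam s z x := by
  unfold perturbFun expTaylor
  fun_prop

/-- Growth bound on `perturbFun`, in terms of `g = ⟨z,x⟩²`, `p = ‖z‖²`, `w = ‖x‖²` and `q = ρ²`. It
makes the function integrable under fourth moments. -/
lemma perturb_growth {g p w q lam s : ℝ} (hg0 : 0 ≤ g) (hp0 : 0 ≤ p) (hw0 : 0 ≤ w) (hq : 0 ≤ q)
    (hg : g ≤ p * w) (hl : 0 ≤ lam) (hs : s ^ 2 = 1) :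
    expTaylor (s * (q * g - q * w - lam)) + cPert * (q * w) * (q * g + q * w / 2)
      ≤ (3 / 2 + (q + lam) ^ 2 + cPert * q ^ 2) * ((1 + p) ^ 2 * (1 + w) ^ 2) := by
  have hc : 0 ≤ cPert := by linarith [cPert_ge]
  have hpw := mul_nonneg hp0 hw0
  have e : (1 + p) ^ 2 * (1 + w) ^ 2 = ((1 + p) * (1 + w)) ^ 2 := by ring
  rw [e]
  have hKe : (1 + p) * (1 + w) = 1 + p + w + p * w := by ring
  generalize (1 + p) * (1 + w) = K at *
  have hK1 : 1 ≤ K := by linarith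
  have hqg : q * g ≤ q * (p * w) := mul_le_mul_of_nonneg_left hg hq
  have hqg0 := mul_nonneg hq hg0
  have hqw := mul_nonneg hq hw0
  have hqp := mul_nonneg hq hp0
  have hqpw := mul_nonneg hq hpw
  have hlK : lam * 1 ≤ lam * K := mul_le_mul_of_nonneg_left hK1 hl
  have hqK : q * K = q + q * p + q * w + q * (p * w) := by rw [hKe]; ring
  have husq : (q * g - q * w - lam) ^ 2 ≤ ((q + lam) * K) ^ 2 := by
    apply sq_le_sq' <;> linarith
  have hsu : (s * (q * g - q * w - lam)) ^ 2 = (q * g - q * w - lam) ^ 2 := by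
    rw [mul_pow, hs, one_mul]
  generalize q * g - q * w - lam = u at *
  have hT : expTaylor (s * u) ≤ 3 / 2 + u ^ 2 := by
    unfold expTaylor; rw [hsu]; linarith [sq_nonneg (s * u - 1)]
  have hR : cPert * (q * w) * (q * g + q * w / 2) ≤ cPert * (q * K) * (q * K) := by
    gcongr
    · linarith
    · linarith
  have hK2 : 1 ≤ K ^ 2 := one_le_pow₀ hK1
  have e2 : (3 / 2 + (q + lam) ^ 2 + cPert * q ^ 2) * K ^ 2
      = 3 / 2 * K ^ 2 + ((q + lam) * K) ^ 2 + cPert * (q * K) * (q * K) := by ring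
  linarith

lemma perturbFun_le {ρ lam s : ℝ} (hl : 0 ≤ lam) (hs : s ^ 2 = 1) (z x : V) :
    perturbFun ρ lam s z x
      ≤ (3 / 2 + (ρ ^ 2 + lam) ^ 2 + cPert * (ρ ^ 2) ^ 2)
        * ((1 + ‖z‖ ^ 2) ^ 2 * (1 + ‖x‖ ^ 2) ^ 2) := by
  have hG : (inner ℝ z x) ^ 2 ≤ ‖z‖ ^ 2 * ‖x‖ ^ 2 := by
    have h2 := pow_le_pow_left₀ (abs_nonneg _) (abs_real_inner_le_norm z x) 2
    rwa [sq_abs, mul_pow] at h2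
  have := perturb_growth (sq_nonneg (inner ℝ z x)) (sq_nonneg ‖z‖) (sq_nonneg ‖x‖) (sq_nonneg ρ)
    hG hl hs
  unfold perturbFun
  rwa [mul_pow, mul_pow]

lemma integrable_one_add_norm_sq_sq {𝒳 : Type*} [MeasurableSpace 𝒳] {ν : Measure 𝒳}
    [IsFiniteMeasure ν] {f : 𝒳 → V} (hf : MemLp f 4 ν) :
    Integrable (fun x => (1 + ‖f x‖ ^ 2) ^ 2) ν := by
  have h4 : Integrable (fun x => ‖f x‖ ^ 4) ν := hf.integrable_norm_pow (by norm_num)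
  have h2 : Integrable (fun x => 2 + 2 * ‖f x‖ ^ 4) ν := (integrable_const _).add (h4.const_mul _)
  refine h2.mono' ?_ ?_
  · exact (((hf.aestronglyMeasurable.norm.pow 2).const_add 1)).pow 2
  · filter_upwards with x
    rw [Real.norm_of_nonneg (by positivity)]
    nlinarith [sq_nonneg (1 - ‖f x‖ ^ 2)]

variable {P : Measure (EuclideanSpace ℝ (Fin d))} [IsProbabilityMeasure P]

lemma integrable_perturbFun_prod (hP : MemLp (fun x : V => x) 4 P) {ρ lam s : ℝ} (hl : 0 ≤ lam)
    (hs : s ^ 2 = 1) (h : V) :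
    Integrable (fun p : V × V => perturbFun ρ lam s (p.1 + h) p.2) ((stdGaussian V).prod P) := by
  have hz : MemLp (fun z : V => z + h) 4 (stdGaussian V) :=
    (IsGaussian.memLp_id (stdGaussian V) 4 (by norm_num)).add (memLp_const h)
  have h1 := integrable_one_add_norm_sq_sq hz
  have h2 := integrable_one_add_norm_sq_sq hP
  have hprod := (h1.mul_prod h2).const_mul (3 / 2 + (ρ ^ 2 + lam) ^ 2 + cPert * (ρ ^ 2) ^ 2)
  refine hprod.mono' ?_ ?_
  · have : Continuous fun p : V × V => perturbFun ρ lam s (p.1 + h) p.2 := by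
      unfold perturbFun expTaylor
      fun_prop
    exact this.aestronglyMeasurable
  · filter_upwards with p
    rw [Real.norm_of_nonneg (by linarith [half_le_perturbFun ρ lam s (p.1 + h) p.2])]
    exact perturbFun_le hl hs _ _

lemma integrable_perturbFun (hP : MemLp (fun x : V => x) 4 P) {ρ lam s : ℝ} (hl : 0 ≤ lam)
    (hs : s ^ 2 = 1) (z : V) : Integrable (perturbFun ρ lam s z) P := by
  have h2 := integrable_one_add_norm_sq_sq hP
  have hprod := (h2.const_mul ((1 + ‖z‖ ^ 2) ^ 2)).const_mul
    (3 / 2 + (ρ ^ 2 + lam) ^ 2 + cPert * (ρ ^ 2) ^ 2)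
  refine hprod.mono' ?_ ?_
  · exact ((continuous_perturbFun ρ lam s).comp
      (continuous_const.prodMk continuous_id)).aestronglyMeasurable
  · filter_upwards with x
    rw [Real.norm_of_nonneg (by linarith [half_le_perturbFun ρ lam s z x])]
    exact perturbFun_le hl hs _ _

/-- The mean of `perturbFun` when the direction has law `N(θ, ρ² I)`. The subtraction of `ρ² ‖x‖²`
inside `q` makes the argument of `q` an unbiased estimate of `s (⟨θ,x⟩² - λ)`. -/
lemma integral_perturbFun_shift {ρ lam s : ℝ} (hρ : 0 < ρ) (hs : s ^ 2 = 1) (θ x : V) :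
    ∫ z, perturbFun ρ lam s (z + ρ⁻¹ • θ) x ∂(stdGaussian V)
      = 1 + s * ((inner ℝ θ x) ^ 2 - lam) + ((inner ℝ θ x) ^ 2 - lam) ^ 2 / 2
        + (2 + cPert) * ρ ^ 2 * ((inner ℝ θ x) ^ 2 * ‖x‖ ^ 2)
        + (2 + 3 * cPert) / 2 * ρ ^ 4 * ‖x‖ ^ 4 := by
  set a := inner ℝ θ x with ha
  have e : ∀ z : V, perturbFun ρ lam s (z + ρ⁻¹ • θ) x
      = (fun t : ℝ => expTaylor (s * ((a + ρ * t) ^ 2 - (ρ * ‖x‖) ^ 2 - lam))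
        + cPert * (ρ * ‖x‖) ^ 2 * ((a + ρ * t) ^ 2 + (ρ * ‖x‖) ^ 2 / 2)) (inner ℝ z x) := by
    intro z
    have : ρ * inner ℝ (z + ρ⁻¹ • θ) x = a + ρ * inner ℝ z x := by
      rw [inner_add_left, real_inner_smul_left]; field_simp; ring
    simp only [perturbFun, this]
  simp_rw [e]
  have hcont : Continuous (fun t : ℝ => expTaylor (s * ((a + ρ * t) ^ 2 - (ρ * ‖x‖) ^ 2 - lam))
        + cPert * (ρ * ‖x‖) ^ 2 * ((a + ρ * t) ^ 2 + (ρ * ‖x‖) ^ 2 / 2)) := by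
    unfold expTaylor; fun_prop
  rw [integral_comp_inner_stdGaussian x hcont]
  set r := ρ * ‖x‖ with hr
  have e2 : ∀ t : ℝ, expTaylor (s * ((a + ρ * (‖x‖ * t)) ^ 2 - r ^ 2 - lam))
        + cPert * r ^ 2 * ((a + ρ * (‖x‖ * t)) ^ 2 + r ^ 2 / 2)
      = (1 + s * (a ^ 2 - r ^ 2 - lam) + (a ^ 2 - r ^ 2 - lam) ^ 2 / 2
          + cPert * r ^ 2 * (a ^ 2 + r ^ 2 / 2))
        + (2 * a * r * (s + (a ^ 2 - r ^ 2 - lam) + cPert * r ^ 2)) * t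
        + (r ^ 2 * (s + (a ^ 2 - r ^ 2 - lam) + cPert * r ^ 2) + 2 * a ^ 2 * r ^ 2) * t ^ 2
        + (2 * a * r ^ 3) * t ^ 3 + (r ^ 4 / 2) * t ^ 4 := by
    intro t
    have h1 : ρ * (‖x‖ * t) = r * t := by rw [hr]; ring
    rw [h1]; unfold expTaylor
    have h2 : (s * ((a + r * t) ^ 2 - r ^ 2 - lam)) ^ 2 = ((a + r * t) ^ 2 - r ^ 2 - lam) ^ 2 := by
      rw [mul_pow, hs, one_mul]
    rw [h2]; ring
  simp_rw [e2]
  rw [integral_quartic_gaussian, hr]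
  ring

lemma integrable_inner_pow (hP : MemLp (fun x : V => x) 4 P) (θ : V) :
    Integrable (fun x => (inner ℝ θ x) ^ 2) P ∧ Integrable (fun x => (inner ℝ θ x) ^ 4) P ∧
    Integrable (fun x : V => ‖x‖ ^ 4) P ∧
    Integrable (fun x => (inner ℝ θ x) ^ 2 * ‖x‖ ^ 2) P := by
  have h4 : Integrable (fun x : V => ‖x‖ ^ 4) P := hP.integrable_norm_pow (by norm_num)
  have hin : MemLp (fun x : V => inner ℝ θ x) 4 P := hP.const_inner θ
  have hb : Integrable (fun x : V => ‖θ‖ ^ 2 * ‖x‖ ^ 4) P := h4.const_mul _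
  refine ⟨?_, ?_, h4, ?_⟩
  · exact (hin.mono_exponent (by norm_num : (2 : ENNReal) ≤ 4)).integrable_sq
  · refine (hin.integrable_norm_pow (by norm_num)).congr ?_
    filter_upwards with x
    rw [Real.norm_eq_abs, Even.pow_abs ⟨2, rfl⟩]
  · refine hb.mono' (by fun_prop) ?_
    filter_upwards with x
    rw [Real.norm_of_nonneg (by positivity)]
    have := pow_le_pow_left₀ (abs_nonneg _) (abs_real_inner_le_norm θ x) 2
    rw [sq_abs, mul_pow] at this
    nlinarith [sq_nonneg ‖x‖]

lemma integral_inner_sq_mul_norm_sq_le (hP : MemLp (fun x : V => x) 4 P) {κ : ℝ}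
    (hκ : ∀ θ : V, ∫ x, (inner ℝ θ x) ^ 4 ∂P ≤ κ * energy P θ ^ 2) (θ : V) :
    ∫ x, (inner ℝ θ x) ^ 2 * ‖x‖ ^ 2 ∂P ≤ Real.sqrt κ * energy P θ * fourthMomentRoot P := by
  obtain ⟨-, i4, n4, im⟩ := integrable_inner_pow hP θ
  have e1 : ∀ x : V, ((inner ℝ θ x) ^ 2) ^ 2 = (inner ℝ θ x) ^ 4 := fun x => by ring
  have e2 : ∀ x : V, (‖x‖ ^ 2) ^ 2 = ‖x‖ ^ 4 := fun x => by ring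
  have h := integral_mul_le_sqrt_mul_sqrt (P := P) (f := fun x => (inner ℝ θ x) ^ 2)
    (g := fun x => ‖x‖ ^ 2) (by simpa only [e1] using i4) (by simpa only [e2] using n4) im
  simp only [e1, e2] at h
  refine h.trans ?_
  apply mul_le_mul_of_nonneg_right _ (Real.sqrt_nonneg _)
  refine (Real.sqrt_le_sqrt (hκ θ)).trans (le_of_eq ?_)
  rw [Real.sqrt_mul' _ (sq_nonneg _), Real.sqrt_sq (energy_nonneg P θ)]

/-- The quantity that multiplies `n` in the deviation inequality for a direction of energy `N`: one
plus it bounds the mean of `perturbFun` over the direction and the observation. -/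
def deviationBound (κ m lam β s N : ℝ) : ℝ :=
  s * (N - lam) + (κ * N ^ 2 - 2 * lam * N + lam ^ 2) / 2 + (2 + cPert) * Real.sqrt κ * m * N / β
    + (2 + 3 * cPert) * m ^ 2 / (2 * β ^ 2)

lemma integral_integral_perturbFun_le (hP : MemLp (fun x : V => x) 4 P) {κ : ℝ}
    (hκ : ∀ θ : V, ∫ x, (inner ℝ θ x) ^ 4 ∂P ≤ κ * energy P θ ^ 2)
    {β lam s : ℝ} (hβ : 0 < β) (hs : s ^ 2 = 1) (θ : V) :
    ∫ x, ∫ z, perturbFun (Real.sqrt β)⁻¹ lam s (z + (Real.sqrt β)⁻¹⁻¹ • θ) x ∂(stdGaussian V) ∂P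
      ≤ 1 + deviationBound κ (fourthMomentRoot P) lam β s (energy P θ) := by
  obtain ⟨i2, i4, n4, im⟩ := integrable_inner_pow hP θ
  have hc := cPert_ge
  have hsβ : 0 < Real.sqrt β := Real.sqrt_pos.2 hβ
  simp_rw [integral_perturbFun_shift (lam := lam) (inv_pos.2 hsβ) hs θ]
  have hρ2 : (Real.sqrt β)⁻¹ ^ 2 = β⁻¹ := by rw [inv_pow, Real.sq_sqrt hβ.le]
  have hρ4 : (Real.sqrt β)⁻¹ ^ 4 = (β ^ 2)⁻¹ := by
    rw [show (Real.sqrt β)⁻¹ ^ 4 = ((Real.sqrt β)⁻¹ ^ 2) ^ 2 by ring, hρ2, inv_pow]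
  rw [hρ2, hρ4]
  have e : ∀ x : V, 1 + s * ((inner ℝ θ x) ^ 2 - lam) + ((inner ℝ θ x) ^ 2 - lam) ^ 2 / 2
        + (2 + cPert) * β⁻¹ * ((inner ℝ θ x) ^ 2 * ‖x‖ ^ 2)
        + (2 + 3 * cPert) / 2 * (β ^ 2)⁻¹ * ‖x‖ ^ 4
      = (1 - s * lam + lam ^ 2 / 2) + (s - lam) * (inner ℝ θ x) ^ 2
        + (1 / 2) * (inner ℝ θ x) ^ 4
        + ((2 + cPert) * β⁻¹) * ((inner ℝ θ x) ^ 2 * ‖x‖ ^ 2)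
        + ((2 + 3 * cPert) / 2 * (β ^ 2)⁻¹) * ‖x‖ ^ 4 := fun x => by ring
  simp_rw [e]
  have j1 : Integrable (fun x : V => (1 - s * lam + lam ^ 2 / 2)
    + (s - lam) * (inner ℝ θ x) ^ 2) P := (integrable_const _).add (i2.const_mul _)
  have j2 : Integrable (fun x : V => (1 - s * lam + lam ^ 2 / 2)
    + (s - lam) * (inner ℝ θ x) ^ 2 + (1 / 2) * (inner ℝ θ x) ^ 4) P := j1.add (i4.const_mul _)
  have j3 : Integrable (fun x : V => (1 - s * lam + lam ^ 2 / 2)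
    + (s - lam) * (inner ℝ θ x) ^ 2 + (1 / 2) * (inner ℝ θ x) ^ 4
    + ((2 + cPert) * β⁻¹) * ((inner ℝ θ x) ^ 2 * ‖x‖ ^ 2)) P := j2.add (im.const_mul _)
  rw [integral_add j3 (n4.const_mul _), integral_add j2 (im.const_mul _),
    integral_add j1 (i4.const_mul _), integral_add (integrable_const _) (i2.const_mul _)]
  simp only [integral_const_mul, integral_const, probReal_univ, one_smul]
  have hm2 : ∫ x : V, ‖x‖ ^ 4 ∂P = fourthMomentRoot P ^ 2 := by
    rw [fourthMomentRoot, Real.sq_sqrt (integral_nonneg fun _ => by positivity)]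
  have h1 := hκ θ
  have h2 := mul_le_mul_of_nonneg_left (integral_inner_sq_mul_norm_sq_le hP hκ θ)
    (show 0 ≤ (2 + cPert) * β⁻¹ by positivity)
  have h3 : ∫ x : V, (inner ℝ θ x) ^ 2 ∂P = energy P θ := rfl
  rw [hm2, h3]
  have e4 : deviationBound κ (fourthMomentRoot P) lam β s (energy P θ)
      = s * (energy P θ - lam) + (κ * energy P θ ^ 2 - 2 * lam * energy P θ + lam ^ 2) / 2
        + (2 + cPert) * β⁻¹ * (Real.sqrt κ * energy P θ * fourthMomentRoot P)
        + (2 + 3 * cPert) / 2 * (β ^ 2)⁻¹ * fourthMomentRoot P ^ 2 := by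
    unfold deviationBound; field_simp
  rw [e4]
  linarith

/-- The PAC-Bayesian deviation inequality, uniform over all directions, for one sign `s = ±1`. The
prior is the centred Gaussian law, the posterior its translate by `√β θ`. -/
theorem exists_event_sum_psi_le {Ω : Type*} [MeasurableSpace Ω] (μ : Measure Ω)
    [IsProbabilityMeasure μ] (hP : MemLp (fun x : V => x) 4 P) {κ : ℝ}
    (hκ : ∀ θ : V, ∫ x, (inner ℝ θ x) ^ 4 ∂P ≤ κ * energy P θ ^ 2) {n : ℕ}
    (X : Fin n → Ω → V) (hX : ∀ k, Measurable (X k)) (hind : iIndepFun X μ)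
    (hlaw : ∀ k, μ.map (X k) = P) {β lam s ε' : ℝ} (hβ : 0 < β) (hl : 0 ≤ lam) (hs : s ^ 2 = 1)
    (hε' : 0 < ε') :
    ∃ E : Set Ω, MeasurableSet E ∧ μ Eᶜ ≤ ENNReal.ofReal ε' ∧ ∀ ω ∈ E, ∀ θ : V,
      ∑ k, psi (s * ((inner ℝ θ (X k ω)) ^ 2 - lam))
        ≤ n * deviationBound κ (fourthMomentRoot P) lam β s (energy P θ)
          + β * ‖θ‖ ^ 2 / 2 + Real.log ε'⁻¹ := by
  set ρ := (Real.sqrt β)⁻¹ with hρ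
  have hsβ : 0 < Real.sqrt β := Real.sqrt_pos.2 hβ
  have hρ0 : 0 < ρ := inv_pos.2 hsβ
  obtain ⟨E, hE, hμE, hEle⟩ := exists_event_lintegral_exp_le μ P (stdGaussian V) X hX hind hlaw
    (perturbFun ρ lam s) (continuous_perturbFun ρ lam s).measurable
    (fun z x => by linarith [half_le_perturbFun ρ lam s z x])
    (fun z => integrable_perturbFun hP hl hs z) hε'
  refine ⟨E, hE, hμE, fun ω hω θ => ?_⟩
  set h : V := ρ⁻¹ • θ with hh
  have hFm : Measurable (Function.uncurry (perturbFun ρ lam s : V → V → ℝ)) :=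
    (continuous_perturbFun ρ lam s).measurable
  obtain ⟨H, hH⟩ : ∃ H : V → ℝ, ∀ z, H z = ∫ x, perturbFun ρ lam s z x ∂P := ⟨_, fun _ => rfl⟩
  have hHm : Measurable H := by
    rw [show H = fun z => ∫ x, Function.uncurry (perturbFun ρ lam s) (z, x) ∂P from funext hH]
    have : StronglyMeasurable fun z => ∫ x, Function.uncurry (perturbFun ρ lam s) (z, x) ∂P :=
      hFm.stronglyMeasurable.integral_prod_right'
    exact this.measurable
  have hprod := integrable_perturbFun_prod (ρ := ρ) hP hl hs h
  have hHi : Integrable (fun z => H (z + h)) (stdGaussian V) := by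
    simp_rw [hH]; exact hprod.integral_prod_left
  have hHe : ∫ z, H (z + h) ∂(stdGaussian V)
      ≤ 1 + deviationBound κ (fourthMomentRoot P) lam β s (energy P θ) := by
    have := integral_integral_swap (f := fun z x => perturbFun ρ lam s (z + h) x) hprod
    simp only [hH]
    rw [this]
    exact integral_integral_perturbFun_le hP hκ hβ hs θ
  have hlog : ∀ x : V, Integrable (fun z => Real.log (perturbFun ρ lam s (z + h) x)) (stdGaussian V) ∧
      psi (s * ((inner ℝ θ x) ^ 2 - lam))
        ≤ ∫ z, Real.log (perturbFun ρ lam s (z + h) x) ∂(stdGaussian V) := by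
    intro x
    set a := inner ℝ θ x with ha
    set f : ℝ → ℝ := fun t => Real.log (expTaylor (s * ((a + ρ * t) ^ 2 - (ρ * ‖x‖) ^ 2 - lam))
        + cPert * (ρ * ‖x‖) ^ 2 * ((a + ρ * t) ^ 2 + (ρ * ‖x‖) ^ 2 / 2)) with hf
    have hfc : Continuous f := by
      refine Continuous.log (by unfold expTaylor; fun_prop) fun t => ?_
      have := corr_nonneg (a + ρ * t) (ρ * ‖x‖)
      have := expTaylor_pos (s * ((a + ρ * t) ^ 2 - (ρ * ‖x‖) ^ 2 - lam))
      linarith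
    have e : (fun z : V => Real.log (perturbFun ρ lam s (z + h) x)) = fun z => f (inner ℝ z x) := by
      funext z
      have : ρ * inner ℝ (z + h) x = a + ρ * inner ℝ z x := by
        rw [hh, inner_add_left, real_inner_smul_left]; field_simp; ring
      simp only [perturbFun, this, hf]
    have e2 : (fun t => f (‖x‖ * t)) = perturbLog a (ρ * ‖x‖) (s * (a ^ 2 - lam)) s := by
      funext t
      simp only [hf, perturbLog]
      have h1 : ρ * (‖x‖ * t) = ρ * ‖x‖ * t := by ring
      rw [h1]
      have h2 : s * ((a + ρ * ‖x‖ * t) ^ 2 - (ρ * ‖x‖) ^ 2 - lam)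
        = s * (a ^ 2 - lam) + s * ((a + ρ * ‖x‖ * t) ^ 2 - (ρ * ‖x‖) ^ 2 - a ^ 2) := by ring
      rw [h2]
    rw [e, integral_comp_inner_stdGaussian x hfc, e2]
    refine ⟨integrable_comp_inner_stdGaussian x hfc ?_, psi_le_integral_perturbLog _ _ _ hs⟩
    rw [e2]; exact integrable_perturbLog _ _ _ _
  set ℓ : V → ℝ := fun z => ∑ k, Real.log (perturbFun ρ lam s z (X k ω)) - n * (H z - 1) with hℓ
  have hℓm : Measurable ℓ := by
    refine Measurable.sub (Finset.measurable_sum _ fun k _ => ?_) ((hHm.sub_const 1).const_mul _)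
    exact Real.measurable_log.comp (continuous_perturbFun_left ρ lam s (X k ω)).measurable
  have hsum : Integrable (fun z => ∑ k, Real.log (perturbFun ρ lam s (z + h) (X k ω)))
      (stdGaussian V) := integrable_finsetSum _ fun k _ => (hlog (X k ω)).1
  have hH1 : Integrable (fun z => n * (H (z + h) - 1)) (stdGaussian V) :=
    (hHi.sub (integrable_const _)).const_mul _
  have hexp := hEle ω hω
  simp_rw [← hH] at hexp
  have hmain := integral_shift_le_log hℓm h (inv_pos.2 hε') hexp (hsum.sub hH1)
  have e5 : ∫ z, ℓ (z + h) ∂(stdGaussian V)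
      = ∑ k, ∫ z, Real.log (perturbFun ρ lam s (z + h) (X k ω)) ∂(stdGaussian V)
        - n * (∫ z, H (z + h) ∂(stdGaussian V) - 1) := by
    simp only [hℓ]
    rw [integral_sub hsum hH1, integral_finsetSum _ (fun k _ => (hlog (X k ω)).1),
      integral_const_mul, integral_sub hHi (integrable_const _)]
    simp
  have e6 : ‖h‖ ^ 2 / 2 = β * ‖θ‖ ^ 2 / 2 := by
    rw [hh, norm_smul, hρ, inv_inv, Real.norm_of_nonneg hsβ.le, mul_pow, Real.sq_sqrt hβ.le]
  have e7 : ∑ k, psi (s * ((inner ℝ θ (X k ω)) ^ 2 - lam))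
      ≤ ∑ k, ∫ z, Real.log (perturbFun ρ lam s (z + h) (X k ω)) ∂(stdGaussian V) :=
    Finset.sum_le_sum fun k _ => (hlog (X k ω)).2
  have e8 : (n : ℝ) * (∫ z, H (z + h) ∂(stdGaussian V) - 1)
      ≤ n * deviationBound κ (fourthMomentRoot P) lam β s (energy P θ) :=
    mul_le_mul_of_nonneg_left (by linarith) (Nat.cast_nonneg n)
  rw [e5, e6] at hmain
  linarith

end Deviation

/-! ### Validity of the confidence bounds -/

section Energy
variable {d n : ℕ}

/-- The truncated sum `∑ᵢ ψ(λ ⟨θ,xᵢ⟩² / s - λ)`, as a function of the candidate energy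
`s = λ / α²`. -/
def truncSum (x : Fin n → EuclideanSpace ℝ (Fin d)) (θ : EuclideanSpace ℝ (Fin d))
    (lam s : ℝ) : ℝ :=
  ∑ i, psi (lam / s * (inner ℝ θ (x i)) ^ 2 - lam)

variable (x : Fin n → EuclideanSpace ℝ (Fin d)) (θ : EuclideanSpace ℝ (Fin d)) {lam s : ℝ}

lemma energyHat_nonneg : 0 ≤ energyHat x θ lam := ENNReal.toReal_nonneg

lemma continuousAt_truncSum (hs : 0 < s) : ContinuousAt (truncSum x θ lam) s := by
  unfold truncSum
  refine tendsto_finsetSum _ fun i _ => ?_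
  apply continuous_psi.continuousAt.comp (f := fun s => lam / s * (inner ℝ θ (x i)) ^ 2 - lam)
  exact ((continuousAt_const.div continuousAt_id hs.ne').mul continuousAt_const).sub
    continuousAt_const

lemma alphaHat_pos (hn : 0 < n) (hl : 0 < lam) : 0 < alphaHat x θ lam := by
  have hcont : Continuous fun α : ℝ => ∑ i, psi (α ^ 2 * (inner ℝ θ (x i)) ^ 2 - lam) :=
    continuous_finsetSum _ fun i _ => continuous_psi.comp (by fun_prop)
  have hzero : ∑ i, psi ((0 : ℝ) ^ 2 * (inner ℝ θ (x i)) ^ 2 - lam) < 0 := by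
    have := psi_neg_of_neg (t := -lam) (by linarith)
    simp only [ne_eq, OfNat.ofNat_ne_zero, not_false_eq_true, zero_pow, zero_mul, zero_sub,
      Finset.sum_const, Finset.card_univ, Fintype.card_fin, nsmul_eq_mul]
    exact mul_neg_of_pos_of_neg (by exact_mod_cast hn) this
  have hev := (hcont.tendsto 0).eventually (gt_mem_nhds hzero)
  obtain ⟨r, hr, hball⟩ := Metric.eventually_nhds_iff.1 hev
  have hmem : ENNReal.ofReal (r / 2) ≤ alphaHat x θ lam := by
    apply le_sSup
    refine ⟨r / 2, by linarith, rfl, le_of_lt (hball ?_)⟩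
    rw [Real.dist_eq, sub_zero, abs_of_pos (by linarith)]; linarith
  exact lt_of_lt_of_le (ENNReal.ofReal_pos.2 (by linarith)) hmem

lemma energyHat_eq (hl : 0 < lam) :
    energyHat x θ lam = lam / (alphaHat x θ lam).toReal ^ 2 := by
  unfold energyHat
  rw [ENNReal.toReal_div, ENNReal.toReal_pow, ENNReal.toReal_ofReal hl.le]

/-- A candidate energy above the estimate corresponds to some `α < α̂`. -/
lemma truncSum_nonpos_of_lt (hn : 0 < n) (hl : 0 < lam) (hs0 : 0 < s)
    (hs : energyHat x θ lam < s) : truncSum x θ lam s ≤ 0 := by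
  have hlt : ENNReal.ofReal (Real.sqrt (lam / s)) < alphaHat x θ lam := by
    by_cases htop : alphaHat x θ lam = ⊤
    · rw [htop]; exact ENNReal.ofReal_lt_top
    · have hpos := ENNReal.toReal_pos (alphaHat_pos x θ hn hl).ne' htop
      rw [energyHat_eq x θ hl] at hs
      rw [← ENNReal.ofReal_toReal htop]
      apply (ENNReal.ofReal_lt_ofReal_iff hpos).2
      rw [Real.sqrt_lt' hpos, div_lt_iff₀ hs0]
      rw [div_lt_iff₀ (by positivity)] at hs
      linarith
  obtain ⟨_, ⟨α, hα0, rfl, hα⟩, hlt'⟩ := lt_sSup_iff.1 hlt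
  have h1 : Real.sqrt (lam / s) < α := (ENNReal.ofReal_lt_ofReal_iff_of_nonneg
    (Real.sqrt_nonneg _)).1 hlt'
  have h2 : lam / s ≤ α ^ 2 := by
    rw [← Real.sq_sqrt (show 0 ≤ lam / s by positivity)]
    exact pow_le_pow_left₀ (Real.sqrt_nonneg _) h1.le 2
  refine le_trans (Finset.sum_le_sum fun i _ => psi_mono ?_) hα
  have := mul_le_mul_of_nonneg_right h2 (sq_nonneg (inner ℝ θ (x i)))
  linarith

lemma truncSum_nonpos (hn : 0 < n) (hl : 0 < lam) (hs0 : 0 < s)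
    (hs : energyHat x θ lam ≤ s) : truncSum x θ lam s ≤ 0 := by
  have hc : Filter.Tendsto (truncSum x θ lam) (nhdsWithin s (Set.Ioi s))
      (nhds (truncSum x θ lam s)) :=
    (continuousAt_truncSum x θ hs0).tendsto.mono_left nhdsWithin_le_nhds
  refine le_of_tendsto hc ?_
  filter_upwards [self_mem_nhdsWithin] with t ht
  exact truncSum_nonpos_of_lt x θ hn hl (hs0.trans ht) (hs.trans_lt ht)

/-- Energies below the estimate correspond to `α > α̂`, where the sum is positive; at the estimate
itself the inequality follows by continuity. -/
lemma truncSum_nonneg (hl : 0 < lam) (h : 0 < energyHat x θ lam) :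
    0 ≤ truncSum x θ lam (energyHat x θ lam) := by
  have htop : alphaHat x θ lam ≠ ⊤ := by
    intro htop
    simp [energyHat, htop] at h
  have he := energyHat_eq x θ hl
  set τ := energyHat x θ lam
  have hA0 : 0 < (alphaHat x θ lam).toReal := by
    rcases (ENNReal.toReal_nonneg (a := alphaHat x θ lam)).lt_or_eq with h' | h'
    · exact h'
    · rw [← h'] at he; simp at he; linarith
  have hc : Filter.Tendsto (truncSum x θ lam) (nhdsWithin τ (Set.Iio τ))
      (nhds (truncSum x θ lam τ)) :=
    (continuousAt_truncSum x θ h).tendsto.mono_left nhdsWithin_le_nhds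
  refine ge_of_tendsto hc ?_
  filter_upwards [Ioo_mem_nhdsLT h] with t ht
  by_contra hneg
  have hq : 0 ≤ lam / t := by have := ht.1; positivity
  have hmem : ENNReal.ofReal (Real.sqrt (lam / t)) ≤ alphaHat x θ lam := by
    apply le_sSup
    refine ⟨_, Real.sqrt_nonneg _, rfl, ?_⟩
    rw [Real.sq_sqrt hq]; exact (not_le.1 hneg).le
  have h1 : Real.sqrt (lam / t) ≤ (alphaHat x θ lam).toReal :=
    (ENNReal.ofReal_le_iff_le_toReal htop).1 hmem
  have h2 : lam / t ≤ (alphaHat x θ lam).toReal ^ 2 := by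
    rw [← Real.sq_sqrt hq]; exact pow_le_pow_left₀ (Real.sqrt_nonneg _) h1 2
  have h3 : τ ≤ t := by
    rw [he, div_le_iff₀ (by positivity)]
    rw [div_le_iff₀ ht.1] at h2
    linarith
  linarith [ht.2]

end Energy

section Bounds
variable {d : ℕ} (p : Params) (g : GridPoint)

/-- Rewriting of the deviation bound in terms of the relative error `y = N/s - 1`. -/
lemma deviationBound_eq {N s σ b : ℝ} (hn : 0 < p.n) (hl : 0 < g.lam) (hβ : 0 < g.beta)
    (hs : 0 < s) :
    p.n * deviationBound p.kappa p.m g.lam g.beta σ (g.lam / s * N)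
        + p.n * (g.lam / s * b) + Real.log (g.weight * p.eps)⁻¹
      = p.n * g.lam * (σ * (N / s - 1) + muCoef p g * (N / s - 1) + xiCoef p g * (N / s - 1) ^ 2
        + gammaCoef p g + b / s) := by
  have hn' : (p.n : ℝ) ≠ 0 := by exact_mod_cast hn.ne'
  unfold deviationBound muCoef xiCoef gammaCoef
  field_simp
  ring

/-- The deviation inequalities of both signs at one grid point for all multiples of `θ`, in terms of
the candidate energy `s`. -/
def DeviationHolds (x : Fin p.n → EuclideanSpace ℝ (Fin d)) (θ : EuclideanSpace ℝ (Fin d))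
    (N : ℝ) : Prop :=
  ∀ s : ℝ, 0 < s →
    truncSum x θ g.lam s ≤ p.n * g.lam * ((N / s - 1) + muCoef p g * (N / s - 1)
      + xiCoef p g * (N / s - 1) ^ 2 + gammaCoef p g + perturbCost p g θ / s) ∧
    -truncSum x θ g.lam s ≤ p.n * g.lam * (-(N / s - 1) + muCoef p g * (N / s - 1)
      + xiCoef p g * (N / s - 1) ^ 2 + gammaCoef p g + perturbCost p g θ / s)

variable {p g} {x : Fin p.n → EuclideanSpace ℝ (Fin d)} {θ : EuclideanSpace ℝ (Fin d)} {N : ℝ}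

lemma lowerBoundAt_le (hn : 0 < p.n) (hl : 0 < g.lam) (hξ : 0 ≤ xiCoef p g)
    (hγ : 0 ≤ gammaCoef p g) (hb : 0 ≤ perturbCost p g θ) (hN : 0 ≤ N)
    (h : DeviationHolds p g x θ N) : lowerBoundAt p g x θ ≤ N := by
  have hn' : (0 : ℝ) < p.n := by exact_mod_cast hn
  unfold lowerBoundAt
  simp only
  split_ifs with hD
  swap
  · exact hN
  refine max_le hN ?_
  set τ := energyHat x θ g.lam with hτ
  set D := 1 + muCoef p g - xiCoef p g
  have hτ0 : 0 ≤ τ := energyHat_nonneg x θ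
  have hfrac : 0 ≤ (gammaCoef p g * τ + perturbCost p g θ) / D := by positivity
  rcases hτ0.eq_or_lt with h0 | hpos
  · linarith
  by_cases hNτ : τ ≤ N
  · linarith
  have h1 := truncSum_nonneg x θ hl hpos
  have h2 := (h τ hpos).1
  have h3 : 0 ≤ (N / τ - 1) + muCoef p g * (N / τ - 1)
      + xiCoef p g * (N / τ - 1) ^ 2 + gammaCoef p g + perturbCost p g θ / τ :=
    nonneg_of_mul_nonneg_right (h1.trans h2) (by positivity)
  have hy0 : N / τ - 1 ≤ 0 := by
    rw [sub_nonpos, div_le_one hpos]; linarith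
  have hy1 : -1 ≤ N / τ - 1 := by
    have : 0 ≤ N / τ := by positivity
    linarith
  -- the relative error lies in `[-1, 0]`, where the quadratic term is linearized
  have hy2 : (N / τ - 1) ^ 2 ≤ -(N / τ - 1) := by nlinarith
  have h4 : 0 ≤ D * (N / τ - 1) + gammaCoef p g + perturbCost p g θ / τ := by
    have := mul_le_mul_of_nonneg_left hy2 hξ
    have e : D * (N / τ - 1) = (N / τ - 1) + muCoef p g * (N / τ - 1)
      - xiCoef p g * (N / τ - 1) := by simp only [D]; ring
    linarith
  have h5 : 0 ≤ D * (N - τ) + gammaCoef p g * τ + perturbCost p g θ := by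
    have := mul_nonneg h4 hpos.le
    have e : (D * (N / τ - 1) + gammaCoef p g + perturbCost p g θ / τ) * τ
        = D * (N - τ) + gammaCoef p g * τ + perturbCost p g θ := by field_simp
    linarith
  rw [sub_le_comm, le_div_iff₀ hD]
  linarith

lemma le_upperBoundAt (hn : 0 < p.n) (hl : 0 < g.lam) (hξ : 0 ≤ xiCoef p g)
    (hγ : 0 ≤ gammaCoef p g) (hb : 0 < perturbCost p g θ)
    (h : DeviationHolds p g x θ N) : (N : EReal) ≤ upperBoundAt p g x θ := by
  have hn' : (0 : ℝ) < p.n := by exact_mod_cast hn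
  unfold upperBoundAt
  simp only
  split_ifs with hD
  swap
  · exact le_top
  set D := 1 - muCoef p g - xiCoef p g
  set S := max (energyHat x θ g.lam) (perturbCost p g θ / (D - gammaCoef p g))
  have hDg : 0 < D - gammaCoef p g := by linarith
  have hS0 : 0 < S := lt_max_of_lt_right (by positivity)
  have hbS : perturbCost p g θ / S ≤ D - gammaCoef p g := by
    rw [div_le_comm₀ hS0 hDg]; exact le_max_right _ _
  have hτS : energyHat x θ g.lam ≤ S := le_max_left _ _
  have hD0 : 0 < D := by linarith
  -- above the estimate the truncated sum is non-positive
  have hdev : ∀ s, S ≤ s → 0 ≤ -(N / s - 1) + muCoef p g * (N / s - 1)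
      + xiCoef p g * (N / s - 1) ^ 2 + gammaCoef p g + perturbCost p g θ / s := by
    intro s hs
    have hs0 := hS0.trans_le hs
    have h1 := truncSum_nonpos x θ hn hl hs0 (hτS.trans hs)
    exact nonneg_of_mul_nonneg_right ((neg_nonneg.2 h1).trans (h s hs0).2) (by positivity)
  rw [EReal.coe_le_coe_iff]
  have hfrac : 0 ≤ (gammaCoef p g * S + perturbCost p g θ) / D := by positivity
  rcases le_total N S with hNS | hNS
  · linarith
  rcases le_or_gt N (2 * S) with hN2 | hN2
  · have h3 := hdev S le_rfl
    have hy0 : 0 ≤ N / S - 1 := by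
      rw [sub_nonneg, one_le_div hS0]; exact hNS
    have hy1 : N / S - 1 ≤ 1 := by
      rw [sub_le_iff_le_add, div_le_iff₀ hS0]; linarith
    have hy2 : (N / S - 1) ^ 2 ≤ N / S - 1 := by nlinarith
    have h4 : D * (N / S - 1) ≤ gammaCoef p g + perturbCost p g θ / S := by
      have := mul_le_mul_of_nonneg_left hy2 hξ
      have e : D * (N / S - 1) = (N / S - 1) - muCoef p g * (N / S - 1)
        - xiCoef p g * (N / S - 1) := by simp only [D]; ring
      linarith
    have h5 : D * (N - S) ≤ gammaCoef p g * S + perturbCost p g θ := by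
      have := mul_le_mul_of_nonneg_right h4 hS0.le
      have e1 : D * (N / S - 1) * S = D * (N - S) := by field_simp
      have e2 : (gammaCoef p g + perturbCost p g θ / S) * S
        = gammaCoef p g * S + perturbCost p g θ := by field_simp
      linarith
    rw [← sub_le_iff_le_add', le_div_iff₀ hD0]
    linarith
  · -- at `s = N/2` the relative error is `1`, which the resolution of the bound excludes
    have h3 := hdev (N / 2) (by linarith)
    have hN0 : 0 < N := by linarith
    have e : N / (N / 2) - 1 = 1 := by field_simp; norm_num
    rw [e] at h3
    have h4 : perturbCost p g θ / (N / 2) < perturbCost p g θ / S :=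
      div_lt_div_of_pos_left hb hS0 (by linarith)
    exfalso
    simp only [D] at hbS
    linarith

end Bounds

/-! ### Quadratic forms and eigenvalues -/

section Spectral
variable {d : ℕ}

lemma quadForm_eq_sum (A : Matrix (Fin d) (Fin d) ℝ) (θ : EuclideanSpace ℝ (Fin d)) :
    quadForm A θ = ∑ i, ∑ j, A i j * (θ i * θ j) := by
  unfold quadForm dotProduct Matrix.mulVec dotProduct
  refine Finset.sum_congr rfl fun i _ => ?_
  rw [Finset.mul_sum]
  exact Finset.sum_congr rfl fun j _ => by ring

/-- The symmetric matrix `A` has the eigenvalues `a`, in non-increasing order. Only the quadratic form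
of `A` enters, which is diagonal in an orthonormal basis. -/
def HasEigenvalues (A : Matrix (Fin d) (Fin d) ℝ) (a : Fin d → ℝ) : Prop :=
  Antitone a ∧ ∃ v : OrthonormalBasis (Fin d) ℝ (EuclideanSpace ℝ (Fin d)),
    ∀ θ, quadForm A θ = ∑ i, a i * (inner ℝ (v i) θ) ^ 2

lemma quadForm_eq_of_mulVec_eq {A : Matrix (Fin d) (Fin d) ℝ} {a : Fin d → ℝ}
    (v : OrthonormalBasis (Fin d) ℝ (EuclideanSpace ℝ (Fin d)))
    (h : ∀ j, A.mulVec (v j).ofLp = a j • (v j).ofLp) (θ : EuclideanSpace ℝ (Fin d)) :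
    quadForm A θ = ∑ i, a i * (inner ℝ (v i) θ) ^ 2 := by
  have e1 : quadForm A θ = inner ℝ (Matrix.toEuclideanLin A θ) θ := by
    simp [quadForm, Matrix.toLpLin_apply, PiLp.inner_apply, dotProduct]
  have e2 : Matrix.toEuclideanLin A θ = ∑ i, inner ℝ (v i) θ • (a i • v i) := by
    conv_lhs => rw [← v.sum_repr' θ]
    rw [map_sum]
    refine Finset.sum_congr rfl fun i _ => ?_
    rw [map_smul, Matrix.toLpLin_apply, h]
    rfl
  rw [e1, e2, sum_inner]
  refine Finset.sum_congr rfl fun i _ => ?_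
  rw [real_inner_smul_left, real_inner_smul_left]; ring

/-- Correspondence between the two enumerations of the eigenvalues in Mathlib: by size and by the
index type of the matrix. -/
def eigenIndex (d : ℕ) : Fin d ≃ Fin d :=
  (finCongr (Fintype.card_fin d).symm).trans (Fintype.equivOfCardEq (Fintype.card_fin _))

open Classical in
lemma sortedEigenvalues_eq {A : Matrix (Fin d) (Fin d) ℝ} (hA : A.IsHermitian) (j : Fin d) :
    sortedEigenvalues A j = hA.eigenvalues (eigenIndex d j) := by
  rw [sortedEigenvalues, dif_pos hA]
  simp [Matrix.IsHermitian.eigenvalues, eigenIndex]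

lemma hasEigenvalues_sortedEigenvalues {A : Matrix (Fin d) (Fin d) ℝ} (hA : A.IsHermitian) :
    HasEigenvalues A (sortedEigenvalues A) := by
  classical
  refine ⟨fun i j hij => ?_, ?_⟩
  · simp only [sortedEigenvalues, hA, dif_pos]
    exact hA.eigenvalues₀_antitone hij
  · refine ⟨hA.eigenvectorBasis.reindex (eigenIndex d).symm, ?_⟩
    refine quadForm_eq_of_mulVec_eq _ fun j => ?_
    rw [OrthonormalBasis.reindex_apply, Equiv.symm_symm, sortedEigenvalues_eq hA]
    exact hA.mulVec_eigenvectorBasis (eigenIndex d j)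

/-- A unit vector orthogonal to the first `i` vectors of one basis and to the vectors after the
`i`-th of another one: the two orthogonal complements intersect for reasons of dimension. -/
lemma exists_unit_orthogonal (v w : OrthonormalBasis (Fin d) ℝ (EuclideanSpace ℝ (Fin d)))
    (i : Fin d) : ∃ θ : EuclideanSpace ℝ (Fin d), ‖θ‖ = 1 ∧ (∀ j < i, inner ℝ (v j) θ = 0) ∧
      ∀ j > i, inner ℝ (w j) θ = 0 := by
  classical
  let f : EuclideanSpace ℝ (Fin d) →ₗ[ℝ] ({j : Fin d // j ≠ i} → ℝ) :=
    LinearMap.pi fun j => (innerSL ℝ (if j.1 < i then v j else w j)).toLinearMap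
  have hlt : Module.finrank ℝ ({j : Fin d // j ≠ i} → ℝ)
      < Module.finrank ℝ (EuclideanSpace ℝ (Fin d)) := by
    rw [Module.finrank_fintype_fun_eq_card, finrank_euclideanSpace_fin]
    have := Fintype.card_subtype_lt (p := fun j : Fin d => j ≠ i) (x := i) (by simp)
    simpa using this
  obtain ⟨x, hx, hx0⟩ := Submodule.exists_mem_ne_zero_of_ne_bot (f.ker_ne_bot_of_finrank_lt hlt)
  have hfx : ∀ j : Fin d, j ≠ i → inner ℝ (if j < i then v j else w j) x = 0 := fun j hj => by
    have := congr_fun (LinearMap.mem_ker.1 hx) ⟨j, hj⟩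
    simpa [f] using this
  refine ⟨‖x‖⁻¹ • x, norm_smul_inv_norm hx0, fun j hj => ?_, fun j hj => ?_⟩
  · have := hfx j hj.ne
    rw [if_pos hj] at this
    rw [real_inner_smul_right, this, mul_zero]
  · have := hfx j hj.ne'
    rw [if_neg (not_lt.2 (le_of_lt hj))] at this
    rw [real_inner_smul_right, this, mul_zero]

/-- The half of the Courant–Fischer principle that compares eigenvalues of two matrices. -/
lemma exists_unit_quadForm_le_ge {A B : Matrix (Fin d) (Fin d) ℝ} {a b : Fin d → ℝ}
    (hA : HasEigenvalues A a) (hB : HasEigenvalues B b) (i : Fin d) :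
    ∃ θ : EuclideanSpace ℝ (Fin d), ‖θ‖ = 1 ∧ quadForm A θ ≤ a i ∧ b i ≤ quadForm B θ := by
  obtain ⟨ha, v, hv⟩ := hA
  obtain ⟨hb, w, hw⟩ := hB
  obtain ⟨θ, h1, h2, h3⟩ := exists_unit_orthogonal v w i
  refine ⟨θ, h1, ?_, ?_⟩
  · rw [hv]
    calc ∑ j, a j * (inner ℝ (v j) θ) ^ 2 ≤ ∑ j, a i * (inner ℝ (v j) θ) ^ 2 := by
          refine Finset.sum_le_sum fun j _ => ?_
          rcases lt_or_ge j i with hj | hj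
          · rw [h2 j hj]; simp
          · exact mul_le_mul_of_nonneg_right (ha hj) (sq_nonneg _)
      _ = a i := by rw [← Finset.mul_sum, v.sum_sq_inner_right, h1]; simp
  · rw [hw]
    calc b i = ∑ j, b i * (inner ℝ (w j) θ) ^ 2 := by
          rw [← Finset.mul_sum, w.sum_sq_inner_right, h1]; simp
      _ ≤ ∑ j, b j * (inner ℝ (w j) θ) ^ 2 := by
          refine Finset.sum_le_sum fun j _ => ?_
          rcases lt_or_ge i j with hj | hj
          · rw [h3 j hj]; simp
          · exact mul_le_mul_of_nonneg_right (hb hj) (sq_nonneg _)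

lemma HasEigenvalues.unique {A : Matrix (Fin d) (Fin d) ℝ} {a b : Fin d → ℝ}
    (ha : HasEigenvalues A a) (hb : HasEigenvalues A b) : a = b := by
  funext i
  obtain ⟨θ, -, h1, h2⟩ := exists_unit_quadForm_le_ge ha hb i
  obtain ⟨θ', -, h3, h4⟩ := exists_unit_quadForm_le_ge hb ha i
  exact le_antisymm (h4.trans h3) (h2.trans h1)

lemma sortedEigenvalues_positivePart {A : Matrix (Fin d) (Fin d) ℝ} (hA : A.IsHermitian)
    (i : Fin d) : sortedEigenvalues (positivePart A) i = max (sortedEigenvalues A i) 0 := by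
  classical
  have e0 : positivePart A = hA.cfc (fun t => max t 0) := by
    unfold positivePart; rw [dif_pos hA]
  have hherm : (positivePart A).IsHermitian := by
    rw [e0, ← hA.cfc_eq]
    exact cfc_predicate (p := IsSelfAdjoint) _ A
  have hmul : ∀ j, (positivePart A).mulVec (hA.eigenvectorBasis j).ofLp
      = (max (hA.eigenvalues j) 0) • (hA.eigenvectorBasis j).ofLp := by
    intro j
    rw [e0, Matrix.IsHermitian.cfc, Unitary.conjStarAlgAut_apply, ← Matrix.mulVec_mulVec,
      ← Matrix.mulVec_mulVec, hA.star_eigenvectorUnitary_mulVec, Matrix.diagonal_mulVec_single,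
      mul_one, ← hA.eigenvectorUnitary_mulVec j]
    rw [← Matrix.mulVec_smul]
    congr 1
    simp [Pi.single_apply, funext_iff]
  have hspec : HasEigenvalues (positivePart A) (fun j => max (sortedEigenvalues A j) 0) := by
    refine ⟨fun j k hjk => max_le_max_right _ ((hasEigenvalues_sortedEigenvalues hA).1 hjk),
      hA.eigenvectorBasis.reindex (eigenIndex d).symm, quadForm_eq_of_mulVec_eq _ fun j => ?_⟩
    rw [OrthonormalBasis.reindex_apply, Equiv.symm_symm, sortedEigenvalues_eq hA]
    exact hmul (eigenIndex d j)
  exact congr_fun ((hasEigenvalues_sortedEigenvalues hherm).unique hspec) i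

/-! ### The Frobenius norm -/

lemma hsNorm_nonneg (A : Matrix (Fin d) (Fin d) ℝ) : 0 ≤ hsNorm A := Real.sqrt_nonneg _

lemma hsNorm_sq (A : Matrix (Fin d) (Fin d) ℝ) : hsNorm A ^ 2 = ∑ i, ∑ j, A i j ^ 2 := by
  have e : (A.transpose * A).trace = ∑ i, ∑ j, A i j ^ 2 := by
    rw [Finset.sum_comm]
    simp only [Matrix.trace, Matrix.diag, Matrix.mul_apply, Matrix.transpose_apply, sq]
  rw [hsNorm, e]
  exact Real.sq_sqrt (Finset.sum_nonneg fun i _ => Finset.sum_nonneg fun j _ => sq_nonneg _)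

lemma abs_entry_le_hsNorm (A : Matrix (Fin d) (Fin d) ℝ) (i j : Fin d) : |A i j| ≤ hsNorm A := by
  refine abs_le_of_sq_le_sq ?_ (hsNorm_nonneg A)
  rw [hsNorm_sq]
  have h1 : A i j ^ 2 ≤ ∑ j, A i j ^ 2 :=
    Finset.single_le_sum (f := fun j => A i j ^ 2) (fun _ _ => sq_nonneg _) (Finset.mem_univ j)
  exact h1.trans (Finset.single_le_sum (f := fun i => ∑ j, A i j ^ 2)
    (fun _ _ => Finset.sum_nonneg fun _ _ => sq_nonneg _) (Finset.mem_univ i))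

lemma continuous_hsNorm : Continuous (hsNorm : Matrix (Fin d) (Fin d) ℝ → ℝ) := by
  unfold hsNorm
  exact ((continuous_id.matrix_transpose.matrix_mul continuous_id).matrix_trace).sqrt

lemma continuous_quadForm (θ : EuclideanSpace ℝ (Fin d)) :
    Continuous fun A : Matrix (Fin d) (Fin d) ℝ => quadForm A θ := by
  unfold quadForm
  exact continuous_const.dotProduct (continuous_id.matrix_mulVec continuous_const)

lemma abs_bilin_le (A : Matrix (Fin d) (Fin d) ℝ) (u v : EuclideanSpace ℝ (Fin d)) :
    |∑ i, ∑ j, A i j * (u i * v j)| ≤ hsNorm A * (‖u‖ * ‖v‖) := by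
  refine abs_le_of_sq_le_sq ?_ (mul_nonneg (hsNorm_nonneg A) (by positivity))
  rw [mul_pow, mul_pow, hsNorm_sq, EuclideanSpace.real_norm_sq_eq, EuclideanSpace.real_norm_sq_eq]
  have h := Finset.sum_mul_sq_le_sq_mul_sq (Finset.univ : Finset (Fin d × Fin d))
    (fun p => A p.1 p.2) (fun p => u p.1 * v p.2)
  simp only [Fintype.sum_prod_type] at h
  refine h.trans (le_of_eq ?_)
  congr 1
  rw [Finset.sum_mul_sum]
  simp only [mul_pow]

lemma abs_quadForm_sub_le {A : Matrix (Fin d) (Fin d) ℝ} (hA : A.IsSymm)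
    {θ ξ : EuclideanSpace ℝ (Fin d)} (hθ : ‖θ‖ = 1) (hξ : ‖ξ‖ = 1) :
    |quadForm A θ - quadForm A ξ| ≤ 2 * ‖θ - ξ‖ * hsNorm A := by
  have e : quadForm A θ - quadForm A ξ = ∑ i, ∑ j, A i j * ((θ - ξ) i * (θ + ξ) j) := by
    have hsym : ∑ i, ∑ j, A i j * (θ i * ξ j) = ∑ i, ∑ j, A i j * (ξ i * θ j) := by
      rw [Finset.sum_comm]
      refine Finset.sum_congr rfl fun i _ => Finset.sum_congr rfl fun j _ => ?_
      rw [hA.apply i j]; ring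
    have e1 : ∀ i j, A i j * ((θ - ξ) i * (θ + ξ) j) = A i j * (θ i * θ j) + A i j * (θ i * ξ j)
        - A i j * (ξ i * θ j) - A i j * (ξ i * ξ j) := by
      intro i j; simp only [PiLp.sub_apply, PiLp.add_apply]; ring
    simp_rw [e1, Finset.sum_sub_distrib, Finset.sum_add_distrib]
    rw [hsym, quadForm_eq_sum, quadForm_eq_sum]; ring
  rw [e]
  have h1 : ‖θ + ξ‖ ≤ 2 := by
    have := norm_add_le θ ξ
    rw [hθ, hξ] at this; linarith
  have h2 := abs_bilin_le A (θ - ξ) (θ + ξ)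
  have h3 := mul_le_mul_of_nonneg_left h1 (mul_nonneg (hsNorm_nonneg A) (norm_nonneg (θ - ξ)))
  linarith

end Spectral

/-! ### Existence of the estimator -/

section Existence
variable {d : ℕ} {p : Params} {Λ : Finset GridPoint} {Θ : Finset (EuclideanSpace ℝ (Fin d))}
  {x : Fin p.n → EuclideanSpace ℝ (Fin d)}

/-- The constraints are closed, and the norm is minimized over the compact set of the feasible
matrices that are not larger than `S`. -/
lemma isMinimalFeasible_sigmaHat {S : Matrix (Fin d) (Fin d) ℝ} (hS : IsFeasible p Λ Θ x S) :
    IsMinimalFeasible p Λ Θ x (sigmaHat p Λ Θ x) := by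
  classical
  have hclosed : IsClosed {Q | IsFeasible p Λ Θ x Q} := by
    have e : {Q | IsFeasible p Λ Θ x Q} = {Q | Q.transpose = Q} ∩ ⋂ θ ∈ Θ,
        ({Q | lowerBound p Λ x θ ≤ ((quadForm Q θ : ℝ) : EReal)}
          ∩ {Q | ((quadForm Q θ : ℝ) : EReal) ≤ upperBound p Λ x θ}) := by
      ext Q; simp [IsFeasible, Matrix.IsSymm]
    rw [e]
    refine (isClosed_eq continuous_id.matrix_transpose continuous_id).inter
      (isClosed_biInter fun θ _ => ?_)
    have hc : Continuous fun Q : Matrix (Fin d) (Fin d) ℝ => ((quadForm Q θ : ℝ) : EReal) :=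
      continuous_coe_real_ereal.comp (continuous_quadForm θ)
    exact (isClosed_le continuous_const hc).inter (isClosed_le hc continuous_const)
  set K : Set (Matrix (Fin d) (Fin d) ℝ) := {Q | IsFeasible p Λ Θ x Q} ∩ {Q | hsNorm Q ≤ hsNorm S}
  have hbox : IsCompact (Set.pi Set.univ fun _ : Fin d => Set.pi Set.univ fun _ : Fin d =>
      Set.Icc (-hsNorm S) (hsNorm S)) :=
    isCompact_univ_pi fun _ => isCompact_univ_pi fun _ => isCompact_Icc
  have hK : IsCompact K := by
    refine hbox.of_isClosed_subset
      (hclosed.inter (isClosed_le continuous_hsNorm continuous_const)) fun Q hQ => ?_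
    intro i _ j _
    exact abs_le.1 ((abs_entry_le_hsNorm Q i j).trans hQ.2)
  obtain ⟨Q, hQ, hmin⟩ := hK.exists_isMinOn ⟨S, hS, le_refl (hsNorm S)⟩ continuous_hsNorm.continuousOn
  have hex : ∃ Q, IsMinimalFeasible p Λ Θ x Q := by
    refine ⟨Q, hQ.1, fun Q' hQ' => ?_⟩
    rcases le_total (hsNorm Q') (hsNorm S) with h | h
    · exact hmin ⟨hQ', h⟩
    · exact hQ.2.trans h
  unfold sigmaHat
  rw [dif_pos hex]
  exact hex.choose_spec

end Existence

/-! ### Moments of the law -/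

section Law
variable {d : ℕ} {P : Measure (EuclideanSpace ℝ (Fin d))} [IsProbabilityMeasure P]

lemma integrable_mul_coord (hP : MemLp (fun x : EuclideanSpace ℝ (Fin d) => x) 4 P) (i j : Fin d) :
    Integrable (fun x : EuclideanSpace ℝ (Fin d) => x i * x j) P := by
  have h2 : MemLp (fun x : EuclideanSpace ℝ (Fin d) => x) 2 P :=
    hP.mono_exponent (by norm_num)
  have hn : Integrable (fun x : EuclideanSpace ℝ (Fin d) => ‖x‖ ^ 2) P :=
    h2.integrable_norm_pow (by norm_num)
  refine hn.mono' (by fun_prop) ?_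
  filter_upwards with x
  rw [norm_mul, sq]
  exact mul_le_mul (PiLp.norm_apply_le x i) (PiLp.norm_apply_le x j) (norm_nonneg _) (norm_nonneg _)

lemma quadForm_covMatrix (hP : MemLp (fun x : EuclideanSpace ℝ (Fin d) => x) 4 P)
    (θ : EuclideanSpace ℝ (Fin d)) : quadForm (covMatrix P) θ = energy P θ := by
  have e : ∀ x : EuclideanSpace ℝ (Fin d), (inner ℝ θ x) ^ 2
      = ∑ i, ∑ j, (x i * x j) * (θ i * θ j) := by
    intro x
    rw [PiLp.inner_apply, sq, Finset.sum_mul_sum]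
    refine Finset.sum_congr rfl fun i _ => Finset.sum_congr rfl fun j _ => ?_
    simp; ring
  rw [quadForm_eq_sum, energy]
  simp_rw [e]
  have hi := fun i j => (integrable_mul_coord hP i j).mul_const (θ i * θ j)
  rw [integral_finsetSum _ fun i _ => integrable_finsetSum _ fun j _ => hi i j]
  refine Finset.sum_congr rfl fun i _ => ?_
  rw [integral_finsetSum _ fun j _ => hi i j]
  refine Finset.sum_congr rfl fun j _ => ?_
  rw [integral_mul_const]
  rfl

lemma isSymm_covMatrix (P : Measure (EuclideanSpace ℝ (Fin d))) : (covMatrix P).IsSymm := by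
  ext i j
  simp only [covMatrix, Matrix.transpose_apply, Matrix.of_apply]
  simp_rw [mul_comm]

lemma isHermitian_of_isSymm {A : Matrix (Fin d) (Fin d) ℝ} (h : A.IsSymm) : A.IsHermitian := by
  rw [Matrix.IsHermitian, Matrix.conjTranspose_eq_transpose_of_trivial]; exact h

/-- A law whose kurtosis is at least `3/2` (hence not the junk value `0` of an unbounded supremum)
satisfies the fourth moment inequality in every direction. -/
lemma integral_inner_pow_four_le (hP : MemLp (fun x : EuclideanSpace ℝ (Fin d) => x) 4 P)
    (hκ : 3 / 2 ≤ kurtosis P) (θ : EuclideanSpace ℝ (Fin d)) :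
    ∫ x, (inner ℝ θ x) ^ 4 ∂P ≤ kurtosis P * energy P θ ^ 2 := by
  obtain ⟨i2, i4, -, -⟩ := integrable_inner_pow hP θ
  rcases (energy_nonneg P θ).eq_or_lt with h0 | hpos
  · have hae : (fun x => (inner ℝ θ x) ^ 2) =ᵐ[P] 0 :=
      (integral_eq_zero_iff_of_nonneg (fun _ => sq_nonneg _) i2).1 h0.symm
    have h4 : ∫ x, (inner ℝ θ x) ^ 4 ∂P = 0 := by
      rw [integral_eq_zero_of_ae]
      filter_upwards [hae] with x hx
      simp only [Pi.zero_apply, ne_eq, OfNat.ofNat_ne_zero, not_false_eq_true, pow_eq_zero_iff]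
        at hx ⊢
      exact hx
    rw [h4, ← h0]; simp
  · have hb : BddAbove {r : ℝ | ∃ θ : EuclideanSpace ℝ (Fin d), 0 < ∫ x, (inner ℝ θ x) ^ 2 ∂P ∧
        r = (∫ x, (inner ℝ θ x) ^ 4 ∂P) / (∫ x, (inner ℝ θ x) ^ 2 ∂P) ^ 2} := by
      by_contra hb
      have := Real.sSup_of_not_bddAbove hb
      unfold kurtosis at hκ
      linarith
    have h1 : (∫ x, (inner ℝ θ x) ^ 4 ∂P) / energy P θ ^ 2 ≤ kurtosis P :=
      le_csSup hb ⟨θ, hpos, rfl⟩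
    rwa [div_le_iff₀ (by positivity)] at h1

/-- If the law were concentrated at the origin the kurtosis would be the supremum of the empty set,
which is `0`. -/
lemma fourthMomentRoot_pos {Q : Measure (EuclideanSpace ℝ (Fin d))}
    (hP : MemLp (fun x : EuclideanSpace ℝ (Fin d) => x) 4 Q)
    (hκ : 3 / 2 ≤ kurtosis Q) : 0 < fourthMomentRoot Q := by
  by_contra hneg
  have h4 : Integrable (fun x : EuclideanSpace ℝ (Fin d) => ‖x‖ ^ 4) Q :=
    hP.integrable_norm_pow (by norm_num)
  have h0 : ∫ x : EuclideanSpace ℝ (Fin d), ‖x‖ ^ 4 ∂Q = 0 := by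
    refine le_antisymm (Real.sqrt_eq_zero'.1 ?_) (integral_nonneg fun _ => by positivity)
    exact le_antisymm (not_lt.1 hneg) (Real.sqrt_nonneg _)
  have hae := (integral_eq_zero_iff_of_nonneg (fun _ => by positivity) h4).1 h0
  have hempty : {r : ℝ | ∃ θ : EuclideanSpace ℝ (Fin d), 0 < ∫ x, (inner ℝ θ x) ^ 2 ∂Q ∧
        r = (∫ x, (inner ℝ θ x) ^ 4 ∂Q) / (∫ x, (inner ℝ θ x) ^ 2 ∂Q) ^ 2} = ∅ := by
    rw [Set.eq_empty_iff_forall_notMem]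
    rintro r ⟨θ, hθ, -⟩
    have : ∫ x, (inner ℝ θ x) ^ 2 ∂Q = 0 := by
      rw [integral_eq_zero_of_ae]
      filter_upwards [hae] with x hx
      have hx0 : x = 0 := by simpa using hx
      simp [hx0]
    linarith
  unfold kurtosis at hκ
  rw [hempty, Real.sSup_empty] at hκ
  linarith

/-- Expansion of `‖x‖⁴` in coordinates and the Cauchy–Schwarz inequality. -/
lemma fourthMomentRoot_le (hP : MemLp (fun x : EuclideanSpace ℝ (Fin d) => x) 4 P)
    (hκ : 3 / 2 ≤ kurtosis P) :
    fourthMomentRoot P ≤ Real.sqrt (kurtosis P) * (covMatrix P).trace := by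
  set N : Fin d → ℝ := fun i => energy P (EuclideanSpace.single i 1) with hN
  have hN0 : ∀ i, 0 ≤ N i := fun i => energy_nonneg P _
  have hinner : ∀ (i : Fin d) (x : EuclideanSpace ℝ (Fin d)),
      inner ℝ (EuclideanSpace.single i (1 : ℝ)) x = x i := by
    intro i x; simp [EuclideanSpace.inner_single_left]
  have htr : (covMatrix P).trace = ∑ i, N i := by
    unfold Matrix.trace
    refine Finset.sum_congr rfl fun i _ => ?_
    simp only [hN, energy, hinner, Matrix.diag, covMatrix, Matrix.of_apply, sq]
  have h4 : ∀ i : Fin d, Integrable (fun x : EuclideanSpace ℝ (Fin d) => x i ^ 4) P ∧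
      ∫ x : EuclideanSpace ℝ (Fin d), x i ^ 4 ∂P ≤ kurtosis P * N i ^ 2 := by
    intro i
    have h1 := (integrable_inner_pow hP (EuclideanSpace.single i (1 : ℝ))).2.1
    have h2 := integral_inner_pow_four_le hP hκ (EuclideanSpace.single i (1 : ℝ))
    simp only [hinner] at h1 h2
    exact ⟨h1, h2⟩
  have hij : ∀ i j : Fin d,
      Integrable (fun x : EuclideanSpace ℝ (Fin d) => x i ^ 2 * x j ^ 2) P ∧
      ∫ x : EuclideanSpace ℝ (Fin d), x i ^ 2 * x j ^ 2 ∂P ≤ kurtosis P * (N i * N j) := by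
    intro i j
    have hint : Integrable (fun x : EuclideanSpace ℝ (Fin d) => x i ^ 2 * x j ^ 2) P := by
      refine ((h4 i).1.add (h4 j).1).mono' (by fun_prop) ?_
      filter_upwards with x
      rw [Real.norm_of_nonneg (by positivity)]
      simp only [Pi.add_apply]
      nlinarith [sq_nonneg (x i ^ 2 - x j ^ 2), sq_nonneg (x i ^ 2), sq_nonneg (x j ^ 2)]
    refine ⟨hint, ?_⟩
    have e : ∀ t : ℝ, (t ^ 2) ^ 2 = t ^ 4 := fun t => by ring
    have h := integral_mul_le_sqrt_mul_sqrt (P := P)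
      (f := fun x : EuclideanSpace ℝ (Fin d) => x i ^ 2)
      (g := fun x : EuclideanSpace ℝ (Fin d) => x j ^ 2)
      (by simpa only [e] using (h4 i).1) (by simpa only [e] using (h4 j).1) hint
    simp only [e] at h
    have hk : 0 ≤ kurtosis P := by linarith
    have hb : ∀ i, Real.sqrt (∫ x : EuclideanSpace ℝ (Fin d), x i ^ 4 ∂P)
        ≤ Real.sqrt (kurtosis P) * N i := by
      intro i
      refine (Real.sqrt_le_sqrt (h4 i).2).trans (le_of_eq ?_)
      rw [Real.sqrt_mul' _ (sq_nonneg _), Real.sqrt_sq (hN0 i)]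
    refine h.trans ((mul_le_mul (hb i) (hb j) (Real.sqrt_nonneg _)
      (mul_nonneg (Real.sqrt_nonneg _) (hN0 i))).trans (le_of_eq ?_))
    have := Real.mul_self_sqrt hk
    calc Real.sqrt (kurtosis P) * N i * (Real.sqrt (kurtosis P) * N j)
        = (Real.sqrt (kurtosis P) * Real.sqrt (kurtosis P)) * (N i * N j) := by ring
      _ = _ := by rw [this]
  have hnorm : ∀ x : EuclideanSpace ℝ (Fin d), ‖x‖ ^ 4 = ∑ i, ∑ j, x i ^ 2 * x j ^ 2 := by
    intro x
    rw [show ‖x‖ ^ 4 = ‖x‖ ^ 2 * ‖x‖ ^ 2 by ring, EuclideanSpace.real_norm_sq_eq,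
      Finset.sum_mul_sum]
  have hsum : ∫ x : EuclideanSpace ℝ (Fin d), ‖x‖ ^ 4 ∂P
      ≤ kurtosis P * (covMatrix P).trace ^ 2 := by
    simp_rw [hnorm]
    rw [integral_finsetSum _ fun i _ => integrable_finsetSum _ fun j _ => (hij i j).1, htr, sq,
      Finset.sum_mul_sum, Finset.mul_sum]
    refine Finset.sum_le_sum fun i _ => ?_
    rw [integral_finsetSum _ fun j _ => (hij i j).1, Finset.mul_sum]
    exact Finset.sum_le_sum fun j _ => (hij i j).2
  have htr0 : 0 ≤ (covMatrix P).trace := by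
    rw [htr]; exact Finset.sum_nonneg fun i _ => hN0 i
  refine (Real.sqrt_le_sqrt hsum).trans (le_of_eq ?_)
  rw [Real.sqrt_mul' _ (sq_nonneg _), Real.sqrt_sq htr0]

/-! ### The event on which all confidence bounds hold -/

/-- The inequalities at the candidate energy `s` are those for the direction `√(λ/s) θ`. -/
lemma deviationHolds_of_sum_psi_le {P : Measure (EuclideanSpace ℝ (Fin d))} {p : Params}
    {g : GridPoint} (hn : 0 < p.n) (hl : 0 < g.lam) (hβ : 0 < g.beta) {x : Fin p.n → EuclideanSpace ℝ (Fin d)}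
    (h : ∀ s : ℝ, s = 1 ∨ s = -1 → ∀ θ : EuclideanSpace ℝ (Fin d),
      ∑ k, psi (s * ((inner ℝ θ (x k)) ^ 2 - g.lam))
        ≤ p.n * deviationBound p.kappa p.m g.lam g.beta s (energy P θ)
          + g.beta * ‖θ‖ ^ 2 / 2 + Real.log (g.weight * p.eps)⁻¹)
    (θ : EuclideanSpace ℝ (Fin d)) : DeviationHolds p g x θ (energy P θ) := by
  intro s hs
  set α := Real.sqrt (g.lam / s) with hα
  have hα2 : α ^ 2 = g.lam / s := Real.sq_sqrt (by positivity)
  have hn' : (p.n : ℝ) ≠ 0 := by exact_mod_cast hn.ne'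
  have hcost : g.beta * ‖α • θ‖ ^ 2 / 2 = p.n * (g.lam / s * perturbCost p g θ) := by
    rw [norm_smul, mul_pow, Real.norm_eq_abs, sq_abs, hα2]
    unfold perturbCost; field_simp
  have key : ∀ σ : ℝ, σ = 1 ∨ σ = -1 → ∑ k, psi (σ * (g.lam / s * (inner ℝ θ (x k)) ^ 2 - g.lam))
      ≤ p.n * g.lam * (σ * (energy P θ / s - 1) + muCoef p g * (energy P θ / s - 1)
        + xiCoef p g * (energy P θ / s - 1) ^ 2 + gammaCoef p g + perturbCost p g θ / s) := by
    intro σ hσ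
    have h1 := h σ hσ (α • θ)
    rw [energy_smul, hα2, hcost, deviationBound_eq p g hn hl hβ hs] at h1
    simpa only [real_inner_smul_left, mul_pow, hα2] using h1
  constructor
  · have := key 1 (Or.inl rfl)
    simp only [one_mul] at this
    exact this
  · have := key (-1) (Or.inr rfl)
    simp only [neg_one_mul, psi_neg, Finset.sum_neg_distrib] at this
    exact this

/-- With probability at least `1 - 2ε` the deviation inequalities hold at all points of the grid
and in all directions: a union bound over the grid and over the two signs. -/
theorem exists_event_deviationHolds (hP : MemLp (fun x : EuclideanSpace ℝ (Fin d) => x) 4 P)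
    {p : Params} (hn : 0 < p.n) (hε : 0 < p.eps) (hκ : 3 / 2 ≤ p.kappa)
    (hκP : kurtosis P = p.kappa) (hm : fourthMomentRoot P = p.m) {Λ : Finset GridPoint}
    (hΛ : IsGrid Λ) {Ω : Type*} [MeasurableSpace Ω] (μ : Measure Ω) [IsProbabilityMeasure μ]
    (X : Fin p.n → Ω → EuclideanSpace ℝ (Fin d)) (hX : ∀ k, Measurable (X k))
    (hind : iIndepFun X μ) (hlaw : ∀ k, μ.map (X k) = P) :
    ∃ E : Set Ω, MeasurableSet E ∧ ENNReal.ofReal (1 - 2 * p.eps) ≤ μ E ∧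
      ∀ ω ∈ E, ∀ g ∈ Λ, ∀ θ, DeviationHolds p g (fun k => X k ω) θ (energy P θ) := by
  classical
  obtain ⟨-, hpos, hsum⟩ := hΛ
  have hκ4 : ∀ θ : EuclideanSpace ℝ (Fin d),
      ∫ x, (inner ℝ θ x) ^ 4 ∂P ≤ p.kappa * energy P θ ^ 2 := by
    intro θ; rw [← hκP]; exact integral_inner_pow_four_le hP (by rw [hκP]; exact hκ) θ
  have hev : ∀ g : GridPoint, ∀ s : ℝ, ∃ E : Set Ω, MeasurableSet E ∧
      (g ∈ Λ → s ^ 2 = 1 → μ Eᶜ ≤ ENNReal.ofReal (g.weight * p.eps) ∧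
        ∀ ω ∈ E, ∀ θ : EuclideanSpace ℝ (Fin d),
          ∑ k, psi (s * ((inner ℝ θ (X k ω)) ^ 2 - g.lam))
            ≤ p.n * deviationBound p.kappa p.m g.lam g.beta s (energy P θ)
              + g.beta * ‖θ‖ ^ 2 / 2 + Real.log (g.weight * p.eps)⁻¹) := by
    intro g s
    by_cases hg : g ∈ Λ
    · by_cases hs : s ^ 2 = 1
      · obtain ⟨hl, hβ, hw⟩ := hpos g hg
        obtain ⟨E, h1, h2, h3⟩ := exists_event_sum_psi_le μ hP hκ4 X hX hind hlaw hβ hl.le hs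
          (mul_pos hw hε)
        rw [hm] at h3
        exact ⟨E, h1, fun _ _ => ⟨h2, h3⟩⟩
      · exact ⟨∅, MeasurableSet.empty, fun _ h => absurd h hs⟩
    · exact ⟨∅, MeasurableSet.empty, fun h => absurd h hg⟩
  choose E hEm hE using hev
  set A : Set Ω := ⋂ g ∈ Λ, (E g 1 ∩ E g (-1)) with hA
  have hAm : MeasurableSet A :=
    Finset.measurableSet_biInter Λ fun g _ => (hEm g 1).inter (hEm g (-1))
  have hAc : μ Aᶜ ≤ ENNReal.ofReal (2 * p.eps) := by
    have e : Aᶜ = ⋃ g ∈ Λ, ((E g 1)ᶜ ∪ (E g (-1))ᶜ) := by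
      simp only [hA, Set.compl_iInter, Set.compl_inter]
    rw [e]
    refine (measure_biUnion_finset_le Λ _).trans ?_
    calc ∑ g ∈ Λ, μ ((E g 1)ᶜ ∪ (E g (-1))ᶜ)
        ≤ ∑ g ∈ Λ, ENNReal.ofReal (2 * p.eps * g.weight) := by
          refine Finset.sum_le_sum fun g hg => (measure_union_le _ _).trans ?_
          have hw := (hpos g hg).2.2
          refine (add_le_add (hE g 1 hg (by norm_num)).1 (hE g (-1) hg (by norm_num)).1).trans ?_
          rw [← ENNReal.ofReal_add (by positivity) (by positivity)]
          exact ENNReal.ofReal_le_ofReal (by linarith)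
      _ = ENNReal.ofReal (∑ g ∈ Λ, 2 * p.eps * g.weight) := by
          rw [ENNReal.ofReal_sum_of_nonneg]
          intro g hg
          have := (hpos g hg).2.2
          positivity
      _ ≤ ENNReal.ofReal (2 * p.eps) := by
          apply ENNReal.ofReal_le_ofReal
          rw [← Finset.mul_sum]
          nlinarith
  refine ⟨A, hAm, ?_, fun ω hω g hg θ => ?_⟩
  · have h1 : μ A = 1 - μ Aᶜ := by
      have := prob_compl_eq_one_sub (μ := μ) hAm.compl
      rwa [compl_compl] at this
    rw [h1, ENNReal.ofReal_sub _ (by positivity), ENNReal.ofReal_one]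
    exact tsub_le_tsub_left hAc 1
  · obtain ⟨hl, hβ, hw⟩ := hpos g hg
    have hmem := Set.mem_iInter₂.1 hω g hg
    refine deviationHolds_of_sum_psi_le hn hl hβ ?_ θ
    rintro s (rfl | rfl) θ
    · exact (hE g 1 hg (by norm_num)).2 ω hmem.1 θ
    · exact (hE g (-1) hg (by norm_num)).2 ω hmem.2 θ

end Law

/-! ### From the confidence bounds to relative errors -/

section Core
variable {d : ℕ} {p : Params} {g : GridPoint}

/-- At a grid point where `μ = γ`, two numbers lying between the confidence bounds are related by a
linear inequality, up to the resolution of the upper bound. The condition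
`(6 + (κ-1)⁻¹) γ(t) ≤ 1` is what keeps the slope below `3/2`. -/
lemma exists_slope {x : Fin p.n → EuclideanSpace ℝ (Fin d)} {t γ k : ℝ} (hn : 0 < p.n)
    (hβ : 0 < g.beta) (ht : 0 < t) (hk0 : 0 ≤ k) (hk2 : k ≤ 2)
    (hμ : muCoef p g = gammaCoef p g) (hG : 0 ≤ gammaCoef p g) (hξ0 : 0 ≤ xiCoef p g)
    (hξ : xiCoef p g ≤ (1 + k) / 2 * gammaCoef p g)
    (hγ : gammaCoef p g + g.beta / (2 * p.n) / t ≤ γ) (hγ1 : (6 + k) * γ ≤ 1) :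
    ∃ s e : ℝ, 1 ≤ s ∧ s ≤ 3 / 2 ∧ s * t + e ≤ t * (1 + 2 * (γ / (1 - 4 * γ))) ∧
      ∀ θ : EuclideanSpace ℝ (Fin d), ‖θ‖ = 1 → ∀ N N' : ℝ, lowerBoundAt p g x θ ≤ N →
        (N' : EReal) ≤ upperBoundAt p g x θ → N' ≤ max (s * N + e) (3 / 5 * t) := by
  have hn' : (0 : ℝ) < p.n := by exact_mod_cast hn
  set G := gammaCoef p g with hGdef
  set ξ := xiCoef p g with hξdef
  set b := g.beta / (2 * p.n) with hb
  have hb0 : 0 < b := by positivity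
  set B := b / t with hB
  have hB0 : 0 < B := by positivity
  have hbB : b = B * t := by rw [hB]; field_simp
  have hγ0 : 0 < γ := by linarith
  have hkG : k * G ≤ k * γ := mul_le_mul_of_nonneg_left (by linarith) hk0
  have hkG2 : k * G ≤ 2 * G := mul_le_mul_of_nonneg_right hk2 hG
  have hkγ : 0 ≤ k * γ := by positivity
  have hD : 0 < 1 - G - ξ := by nlinarith
  have hDG : 0 < 1 - G - ξ - G := by nlinarith
  have h1ξ : 0 < 1 - ξ := by linarith
  have h4γ : 0 < 1 - 4 * γ := by nlinarith
  refine ⟨(1 + G - ξ) / (1 - G - ξ), 2 * b / (1 - G - ξ), ?_, ?_, ?_, ?_⟩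
  · rw [one_le_div hD]; linarith
  · rw [div_le_iff₀ hD]; nlinarith
  · have e1 : (1 + G - ξ) / (1 - G - ξ) * t + 2 * b / (1 - G - ξ)
        = t * (1 + 2 * ((G + B) / (1 - G - ξ))) := by
      rw [hbB]; field_simp; ring
    rw [e1]
    have : (G + B) / (1 - G - ξ) ≤ γ / (1 - 4 * γ) :=
      div_le_div₀ hγ0.le hγ h4γ (by nlinarith)
    gcongr
  · intro θ hθ N N' hN hN'
    have hcost : perturbCost p g θ = b := by
      unfold perturbCost; rw [hθ, hb]; ring
    have hτ0 := energyHat_nonneg (lam := g.lam) x θ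
    unfold lowerBoundAt at hN
    unfold upperBoundAt at hN'
    simp only [hcost, hμ, ← hξdef] at hN hN'
    rw [if_pos (show 0 < 1 + G - ξ by linarith)] at hN
    rw [if_pos (show G < 1 - G - ξ by linarith), EReal.coe_le_coe_iff] at hN'
    generalize energyHat x θ g.lam = τ at *
    have hlow : τ * (1 - ξ) ≤ (1 + G - ξ) * N + b := by
      have h1 := (le_max_right _ _).trans hN
      rw [sub_le_comm, le_div_iff₀ (by linarith)] at h1
      linarith
    rcases le_total τ (b / (1 - G - ξ - G)) with hle | hle
    · -- the estimate is below the resolution, so that the bound is `2b / (1 - 2γ - ξ)`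
      rw [max_eq_right hle] at hN'
      refine le_max_of_le_right (hN'.trans ?_)
      have e2 : b / (1 - G - ξ - G) + (G * (b / (1 - G - ξ - G)) + b) / (1 - G - ξ)
          = 2 * b / (1 - G - ξ - G) := by
        field_simp; ring
      rw [e2, div_le_iff₀ hDG, hbB]
      have : 2 * B ≤ 3 / 5 * (1 - G - ξ - G) := by nlinarith
      nlinarith
    · rw [max_eq_left hle] at hN'
      refine le_max_of_le_left (hN'.trans ?_)
      have e3 : τ + (G * τ + b) / (1 - G - ξ) = (τ * (1 - ξ) + b) / (1 - G - ξ) := by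
        field_simp; ring
      have e4 : (1 + G - ξ) / (1 - G - ξ) * N + 2 * b / (1 - G - ξ)
          = ((1 + G - ξ) * N + 2 * b) / (1 - G - ξ) := by
        field_simp
      rw [e3, e4]
      gcongr ?_ / _
      linarith

end Core

section Compare
variable {d : ℕ} {A A' : Matrix (Fin d) (Fin d) ℝ} {a a' : Fin d → ℝ}
  {Θ : Finset (EuclideanSpace ℝ (Fin d))} {δ H : ℝ}

/-- Comparison of eigenvalues from a comparison of the quadratic forms on a net: with `t` the
eigenvalue of `A` brought up to `σ`, the linear inequality is used at the level `t`. -/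
lemma abs_max_sub_max_le (hA : A.IsSymm) (hA' : A'.IsSymm) (ha : HasEigenvalues A a)
    (ha' : HasEigenvalues A' a') (hH : hsNorm A ≤ H) (hH' : hsNorm A' ≤ H) (hδ : 0 ≤ δ)
    (hΘ : IsSphereNet Θ δ) (i : Fin d) {σ t s e η : ℝ} (hσ : 0 < σ) (ht : t = max (a i) σ)
    (hs1 : 1 ≤ s) (hs2 : s ≤ 3 / 2) (hη : 0 ≤ η) (he : s * t + e ≤ t * (1 + 2 * η))
    (h : ∀ ξ ∈ Θ, quadForm A' ξ ≤ max (s * quadForm A ξ + e) (3 / 5 * t))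
    (h' : ∀ ξ ∈ Θ, quadForm A ξ ≤ max (s * quadForm A' ξ + e) (3 / 5 * t)) :
    |max (a i) σ - max (a' i) σ| ≤ 2 * max (a i) σ * η + 5 * δ * H := by
  have hH0 : 0 ≤ H := (hsNorm_nonneg A).trans hH
  have ht0 : 0 < t := by rw [ht]; exact lt_max_of_lt_right hσ
  have hδH : 0 ≤ δ * H := mul_nonneg hδ hH0
  have hnet : ∀ {Q : Matrix (Fin d) (Fin d) ℝ}, Q.IsSymm → hsNorm Q ≤ H →
      ∀ {θ ξ : EuclideanSpace ℝ (Fin d)}, ‖θ‖ = 1 → ‖ξ‖ = 1 → ‖θ - ξ‖ ≤ δ →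
      quadForm Q θ ≤ quadForm Q ξ + 2 * (δ * H) ∧ quadForm Q ξ ≤ quadForm Q θ + 2 * (δ * H) := by
    intro Q hQ hQH θ ξ hθ hξ hd
    have h1 := abs_quadForm_sub_le hQ hθ hξ
    have h2 : ‖θ - ξ‖ * hsNorm Q ≤ δ * H := mul_le_mul hd hQH (hsNorm_nonneg Q) hδ
    have h3 := abs_le.1 h1
    constructor <;> linarith [h3.1, h3.2]
  have hηt : 0 ≤ η * t := by positivity
  rw [← ht, abs_le]
  constructor
  · -- upper bound on the eigenvalue of `A'`
    obtain ⟨θ, hθ, h1, h2⟩ := exists_unit_quadForm_le_ge ha ha' i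
    obtain ⟨ξ, hξΘ, hξ⟩ := hΘ.2 θ hθ
    have hξ1 := hΘ.1 ξ hξΘ
    have n1 := (hnet hA hH hθ hξ1 hξ).2
    have n2 := (hnet hA' hH' hθ hξ1 hξ).1
    have hai : a i ≤ t := by rw [ht]; exact le_max_left _ _
    have hσt : σ ≤ t := by rw [ht]; exact le_max_right _ _
    have h3 : a' i ≤ t + 2 * t * η + 5 * δ * H := by
      rcases le_max_iff.1 (h ξ hξΘ) with h4 | h4
      · have h5 : s * quadForm A ξ ≤ s * t + 3 * (δ * H) := by
          have : s * quadForm A ξ ≤ s * (t + 2 * (δ * H)) :=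
            mul_le_mul_of_nonneg_left (by linarith) (by linarith)
          nlinarith
        linarith
      · linarith
    have h6 : max (a' i) σ ≤ t + 2 * t * η + 5 * δ * H := max_le h3 (by nlinarith)
    linarith
  · -- lower bound on the eigenvalue of `A'`
    rcases le_total (a i) σ with hle | hle
    · have e1 : t = σ := by rw [ht, max_eq_right hle]
      have := le_max_right (a' i) σ
      rw [e1] at hηt ⊢
      linarith
    have e1 : a i = t := by rw [ht, max_eq_left hle]
    obtain ⟨θ, hθ, h1, h2⟩ := exists_unit_quadForm_le_ge ha' ha i
    obtain ⟨ξ, hξΘ, hξ⟩ := hΘ.2 θ hθ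
    have hξ1 := hΘ.1 ξ hξΘ
    have n1 := (hnet hA hH hθ hξ1 hξ).1
    have n2 := (hnet hA' hH' hθ hξ1 hξ).2
    have hm1 := le_max_left (a' i) σ
    have hm2 := le_max_right (a' i) σ
    rcases le_max_iff.1 (h' ξ hξΘ) with h4 | h4
    · -- the claim is weakened by dividing by `s ≥ 1`
      have h5 : s * quadForm A' ξ ≤ s * (a' i + 2 * (δ * H)) :=
        mul_le_mul_of_nonneg_left (by linarith) (by linarith)
      have h6 : s * (t - 2 * (t * η) - 5 * (δ * H)) ≤ s * a' i := by
        have h7 : η * t ≤ s * (η * t) := le_mul_of_one_le_left hηt hs1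
        have h8 : δ * H ≤ s * (δ * H) := le_mul_of_one_le_left hδH hs1
        nlinarith
      have h9 := le_of_mul_le_mul_left h6 (by linarith)
      linarith
    · -- here `2t/5 ≤ 2δH`, so that the claimed lower bound is not positive
      nlinarith

end Compare

/-! ### The grid -/

/-- The value of the ratio `m / (√κ t)` to which the `j`-th grid point is tuned. -/
def gridRatio (j : ℕ) : ℝ := (3 / 2 : ℝ) ^ j / 1000

/-- The share of the error probability spent at the `j`-th grid point. The factor `2.032 = 2 · 1.016`
in `γ(t)` leaves `1.016 · 4.35 = 4.4196`, plus a small multiple of the ratio, for the logarithm of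
its inverse. -/
def gridWeight (j : ℕ) : ℝ :=
  if j = 0 then 1 / 2 else Real.exp (-(4.4196 + 0.011 * gridRatio j))

/-- The constant `(2+3c) / (4(2+c))`, just below `0.73`. -/
def traceCoef : ℝ := (2 + 3 * cPert) / (4 * (2 + cPert))

/-- The complexity `L_j`: at `β_j` the last two terms of `γ̄` add up to `L_j / (nλ)`. -/
def gridComplexity (ε : ℝ) (j : ℕ) : ℝ :=
  traceCoef * gridRatio j + Real.log (gridWeight j * ε)⁻¹

/-- The `j`-th grid point. The choice of `λ_j` makes `L_j / (nλ)` equal to `(κ-1)λ/2`, and `β_j`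
minimizes the perturbation cost `(2+c) √κ m / β + β / (2nt)` at the level `t = m / (√κ x)`, where
`x` is the ratio of the grid point. -/
def gridPoint (p : Params) (j : ℕ) : GridPoint where
  lam := Real.sqrt (2 * gridComplexity p.eps j / ((p.kappa - 1) * p.n))
  beta := p.m / Real.sqrt p.kappa * (Real.sqrt (2 * p.n * (2 + cPert) * p.kappa)
    / Real.sqrt (gridRatio j))
  weight := gridWeight j

lemma gridRatio_pos (j : ℕ) : 0 < gridRatio j := by unfold gridRatio; positivity

lemma gridWeight_pos (j : ℕ) : 0 < gridWeight j := by
  unfold gridWeight; split_ifs <;> positivity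

lemma gridWeight_le_one (j : ℕ) : gridWeight j ≤ 1 := by
  unfold gridWeight
  split_ifs
  · norm_num
  · have := gridRatio_pos j
    rw [Real.exp_le_one_iff]; linarith

lemma neg_log_gridWeight_le (j : ℕ) : -Real.log (gridWeight j) ≤ 4.4196 + 0.011 * gridRatio j := by
  have h := gridRatio_pos j
  unfold gridWeight
  split_ifs
  · rw [one_div, Real.log_inv]; linarith [Real.log_two_lt_d9]
  · rw [Real.log_exp]; linarith

lemma exp_const_ge : 80 ≤ Real.exp 4.4196 := by
  have h1 : Real.exp 4.4196 = Real.exp 1 ^ 4 * Real.exp 0.4196 := by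
    rw [← Real.exp_nat_mul, ← Real.exp_add]; norm_num
  have h2 : 2.718 ^ 4 ≤ Real.exp 1 ^ 4 :=
    pow_le_pow_left₀ (by norm_num) (by linarith [Real.exp_one_gt_d9]) 4
  have h3 := Real.quadratic_le_exp_of_nonneg (show (0 : ℝ) ≤ 0.4196 by norm_num)
  rw [h1]
  calc (80 : ℝ) ≤ 2.718 ^ 4 * (1 + 0.4196 + 0.4196 ^ 2 / 2) := by norm_num
    _ ≤ _ := by gcongr

lemma sum_gridWeight_le (J : ℕ) : ∑ j ∈ Finset.range (J + 1), gridWeight j ≤ 1 := by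
  -- beyond `j = 31` the weights are dominated by a geometric sequence
  set u : ℕ → ℝ := fun j => Real.exp (-(0.011 * gridRatio (j + 1))) with hu
  have hterm : ∀ j, gridWeight (j + 1) ≤ u j / 80 := by
    intro j
    simp only [gridWeight, Nat.succ_ne_zero, if_false, hu]
    rw [neg_add, Real.exp_add, Real.exp_neg, mul_comm, div_eq_mul_inv]
    have := exp_const_ge
    gcongr
  have hu1 : ∀ j, u j ≤ 1 := fun j => by
    have := gridRatio_pos (j + 1)
    simp only [hu]; rw [Real.exp_le_one_iff]; linarith
  have hu0 : ∀ j, 0 ≤ u j := fun j => (Real.exp_pos _).le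
  have hu2 : ∀ i, u (31 + i) ≤ (2 / 3 : ℝ) ^ i := by
    intro i
    have hr : 1 ≤ 0.011 * gridRatio (31 + 1) := by unfold gridRatio; norm_num
    have hri : gridRatio (31 + i + 1) = gridRatio (31 + 1) * (3 / 2) ^ i := by
      unfold gridRatio; ring
    have h3 : (3 / 2 : ℝ) ^ i ≤ Real.exp (0.011 * gridRatio (31 + i + 1)) := by
      have h4 := Real.add_one_le_exp (0.011 * gridRatio (31 + i + 1))
      rw [hri] at h4 ⊢
      have h5 : (0 : ℝ) < (3 / 2) ^ i := by positivity
      nlinarith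
    have h6 : (2 / 3 : ℝ) ^ i = ((3 / 2 : ℝ) ^ i)⁻¹ := by rw [← inv_pow]; norm_num
    simp only [hu]
    rw [Real.exp_neg, h6]
    gcongr
  have hgeo : ∑ i ∈ Finset.range J, (2 / 3 : ℝ) ^ i ≤ 3 := by
    rw [geom_sum_eq (by norm_num)]
    have : (0 : ℝ) ≤ (2 / 3) ^ J := by positivity
    rw [div_le_iff_of_neg (by norm_num)]
    linarith
  have hsum : ∑ j ∈ Finset.range J, u j ≤ 34 := by
    calc ∑ j ∈ Finset.range J, u j ≤ ∑ j ∈ Finset.range (31 + J), u j :=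
          Finset.sum_le_sum_of_subset_of_nonneg
            (Finset.range_mono (by omega)) fun j _ _ => hu0 j
      _ = ∑ j ∈ Finset.range 31, u j + ∑ i ∈ Finset.range J, u (31 + i) :=
          Finset.sum_range_add _ _ _
      _ ≤ ∑ j ∈ Finset.range 31, (1 : ℝ) + ∑ i ∈ Finset.range J, (2 / 3 : ℝ) ^ i :=
          add_le_add (Finset.sum_le_sum fun j _ => hu1 j) (Finset.sum_le_sum fun i _ => hu2 i)
      _ ≤ 34 := by
          simp only [Finset.sum_const, Finset.card_range, nsmul_eq_mul]
          norm_num; linarith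
  rw [Finset.sum_range_succ']
  have h0 : gridWeight 0 = 1 / 2 := by simp [gridWeight]
  have h1 : ∑ j ∈ Finset.range J, gridWeight (j + 1) ≤ (∑ j ∈ Finset.range J, u j) / 80 := by
    rw [Finset.sum_div]; exact Finset.sum_le_sum fun j _ => hterm j
  rw [h0]; linarith

lemma traceCoef_pos : 0 < traceCoef := by
  have := cPert_ge
  unfold traceCoef; positivity

lemma traceCoef_le : traceCoef ≤ 0.73 := by
  have h1 := cPert_ge
  have h2 := cPert_le
  unfold traceCoef
  rw [div_le_iff₀ (by linarith)]
  linarith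

section Params
variable {p : Params} (hn : 0 < p.n) (hε : 0 < p.eps) (hε2 : p.eps < 1 / 2)
  (hκ : 3 / 2 ≤ p.kappa) (hm : 0 < p.m)
include hε

lemma log_gridWeight_inv (j : ℕ) :
    Real.log (gridWeight j * p.eps)⁻¹ = -Real.log (gridWeight j) + Real.log p.eps⁻¹ := by
  rw [Real.log_inv, Real.log_mul (gridWeight_pos j).ne' hε.ne', Real.log_inv]; ring

include hε2

lemma log_inv_eps_pos : 0 < Real.log p.eps⁻¹ :=
  Real.log_pos ((one_lt_inv₀ hε).2 (by linarith))

lemma gridComplexity_pos (j : ℕ) : 0 < gridComplexity p.eps j := by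
  unfold gridComplexity
  rw [log_gridWeight_inv hε]
  have h1 := mul_pos traceCoef_pos (gridRatio_pos j)
  have h2 := Real.log_nonpos (gridWeight_pos j).le (gridWeight_le_one j)
  have h3 := log_inv_eps_pos hε hε2
  linarith

include hn hκ hm

lemma gridPoint_pos (j : ℕ) : 0 < (gridPoint p j).lam ∧ 0 < (gridPoint p j).beta ∧
    0 < (gridPoint p j).weight := by
  have hn' : (0 : ℝ) < p.n := by exact_mod_cast hn
  have hL := gridComplexity_pos hε hε2 j
  have hx := gridRatio_pos j
  have hc := cPert_ge
  have hκ0 : 0 < p.kappa := by linarith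
  have hκ1 : 0 < p.kappa - 1 := by linarith
  refine ⟨?_, ?_, gridWeight_pos j⟩
  · unfold gridPoint; positivity
  · unfold gridPoint; positivity

/-- At the grid points the coefficients `γ̄` and `μ` coincide, by the choice of `λ_j`. -/
lemma gridPoint_coef (j : ℕ) :
    (p.kappa - 1) * (gridPoint p j).lam = Real.sqrt (2 * (p.kappa - 1) / p.n
        * gridComplexity p.eps j) ∧
    muCoef p (gridPoint p j) = (p.kappa - 1) * (gridPoint p j).lam
      + Real.sqrt (2 * p.n * (2 + cPert) * p.kappa) / (2 * p.n) * Real.sqrt (gridRatio j) ∧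
    gammaCoef p (gridPoint p j) = muCoef p (gridPoint p j) := by
  have hn' : (0 : ℝ) < p.n := by exact_mod_cast hn
  have hL := gridComplexity_pos hε hε2 j
  have hx := gridRatio_pos j
  have hc := cPert_ge
  have hκ0 : 0 < p.kappa := by linarith
  have hκ1 : 0 < p.kappa - 1 := by linarith
  obtain ⟨hl0, hβ0, -⟩ := gridPoint_pos hn hε hε2 hκ hm j
  have hlsq : (gridPoint p j).lam ^ 2 = 2 * gridComplexity p.eps j / ((p.kappa - 1) * p.n) := by
    unfold gridPoint; exact Real.sq_sqrt (by positivity)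
  set v := Real.sqrt (2 * p.n * (2 + cPert) * p.kappa) with hv
  have hv0 : 0 < v := Real.sqrt_pos.2 (by positivity)
  have hv2 : v ^ 2 = 2 * p.n * (2 + cPert) * p.kappa := Real.sq_sqrt (by positivity)
  set y := Real.sqrt (gridRatio j) with hy
  have hy0 : 0 < y := Real.sqrt_pos.2 hx
  have hy2 : y ^ 2 = gridRatio j := Real.sq_sqrt hx.le
  set r := Real.sqrt p.kappa with hr
  have hr0 : 0 < r := Real.sqrt_pos.2 hκ0
  have hr2 : r ^ 2 = p.kappa := Real.sq_sqrt hκ0.le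
  have hβ : (gridPoint p j).beta = p.m / r * (v / y) := rfl
  have hM : (2 + cPert) * r * p.m / (gridPoint p j).beta = v / (2 * p.n) * y := by
    rw [hβ]
    have h1 : (2 + cPert) * r * p.m / (p.m / r * (v / y)) = (2 + cPert) * r ^ 2 * y / v := by
      field_simp
    have h2 : v / (2 * p.n) * y = v ^ 2 * y / (2 * p.n * v) := by field_simp
    rw [h1, h2, hv2, hr2]; field_simp
  have hR3 : (2 + 3 * cPert) * p.m ^ 2 / (2 * (gridPoint p j).beta ^ 2 * (gridPoint p j).lam)
      = traceCoef * gridRatio j / (p.n * (gridPoint p j).lam) := by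
    rw [hβ]
    have h1 : (2 + 3 * cPert) * p.m ^ 2 / (2 * (p.m / r * (v / y)) ^ 2 * (gridPoint p j).lam)
        = (2 + 3 * cPert) * r ^ 2 * y ^ 2 / (2 * v ^ 2 * (gridPoint p j).lam) := by
      field_simp
    rw [h1, hv2, hr2, hy2]
    unfold traceCoef; field_simp; ring
  have hL2 : gridComplexity p.eps j / (p.n * (gridPoint p j).lam)
      = (p.kappa - 1) * (gridPoint p j).lam / 2 := by
    have : gridComplexity p.eps j = (p.kappa - 1) * p.n * (gridPoint p j).lam ^ 2 / 2 := by
      rw [hlsq]; field_simp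
    rw [this]; field_simp
  have hmu : muCoef p (gridPoint p j) = (p.kappa - 1) * (gridPoint p j).lam
      + v / (2 * p.n) * y := by
    unfold muCoef; rw [← hr, hM]
  refine ⟨?_, hmu, ?_⟩
  · rw [eq_comm, Real.sqrt_eq_iff_mul_self_eq (by positivity) (by positivity)]
    have : (p.kappa - 1) * (gridPoint p j).lam * ((p.kappa - 1) * (gridPoint p j).lam)
        = (p.kappa - 1) ^ 2 * (gridPoint p j).lam ^ 2 := by ring
    rw [this, hlsq]; field_simp
  · rw [hmu]
    unfold gammaCoef
    rw [← hr, hM, hR3]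
    have hw : (gridPoint p j).weight = gridWeight j := rfl
    have e : traceCoef * gridRatio j / (p.n * (gridPoint p j).lam)
        + Real.log ((gridPoint p j).weight * p.eps)⁻¹ / (p.n * (gridPoint p j).lam)
        = (p.kappa - 1) * (gridPoint p j).lam / 2 := by
      rw [← add_div, hw, ← hL2]; rfl
    linarith

/-- The total error at the `j`-th grid point: at the level `t` the perturbation costs
`√x_j + x / √x_j` up to a constant factor, where `x_j` is the ratio of the grid point and
`x = m / (√κ t)`. -/
lemma gamma_add_cost_eq (j : ℕ) {t : ℝ} (ht : 0 < t) :
    gammaCoef p (gridPoint p j) + (gridPoint p j).beta / (2 * p.n) / t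
      = Real.sqrt (2 * (p.kappa - 1) / p.n * gridComplexity p.eps j)
        + Real.sqrt (2 * p.n * (2 + cPert) * p.kappa) / (2 * p.n) * (Real.sqrt (gridRatio j)
          + p.m / Real.sqrt p.kappa / t / Real.sqrt (gridRatio j)) := by
  have hn' : (0 : ℝ) < p.n := by exact_mod_cast hn
  obtain ⟨h1, h2, h3⟩ := gridPoint_coef hn hε hε2 hκ hm j
  have hy0 : 0 < Real.sqrt (gridRatio j) := Real.sqrt_pos.2 (gridRatio_pos j)
  have hκ0 : 0 < Real.sqrt p.kappa := Real.sqrt_pos.2 (by linarith)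
  rw [h3, h2, h1]
  have e : (gridPoint p j).beta = p.m / Real.sqrt p.kappa
    * (Real.sqrt (2 * p.n * (2 + cPert) * p.kappa) / Real.sqrt (gridRatio j)) := rfl
  rw [e]
  field_simp
  ring

/-- Grid points tuned to a ratio within a factor `3/2` of the actual one: there
`(√x_j + x / √x_j)² ≤ 25/6 x`, and `(2+c)/2 · 25/6 ≤ 98.5`. -/
lemma gamma_add_cost_le_of_near (j : ℕ) {T t : ℝ} (ht : 0 < t)
    (hT : p.m / Real.sqrt p.kappa ≤ T) (h1 : gridRatio j ≤ p.m / Real.sqrt p.kappa / t)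
    (h2 : p.m / Real.sqrt p.kappa / t ≤ 3 / 2 * gridRatio j) :
    gammaCoef p (gridPoint p j) + (gridPoint p j).beta / (2 * p.n) / t
      ≤ gammaFun p.n p.eps p.kappa T t := by
  have hn' : (0 : ℝ) < p.n := by exact_mod_cast hn
  have hc := cPert_ge
  have hc2 := cPert_le
  have hκ0 : 0 < p.kappa := by linarith
  have hκ1 : 0 < p.kappa - 1 := by linarith
  rw [gamma_add_cost_eq hn hε hε2 hκ hm j ht]
  have hxX : p.m / Real.sqrt p.kappa / t ≤ T / t := by gcongr
  generalize p.m / Real.sqrt p.kappa / t = x at *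
  have hz := gridRatio_pos j
  have hlw := neg_log_gridWeight_le j
  unfold gammaFun gridComplexity
  rw [log_gridWeight_inv hε]
  have hℓ := log_inv_eps_pos hε hε2
  have hq := traceCoef_le
  set z := gridRatio j
  set y := Real.sqrt z with hy
  have hy0 : 0 < y := Real.sqrt_pos.2 hz
  have hy2 : y ^ 2 = z := Real.sq_sqrt hz.le
  have hx0 : 0 < x := hz.trans_le h1
  set v := Real.sqrt (2 * p.n * (2 + cPert) * p.kappa) with hv
  have hv2 : v ^ 2 = 2 * p.n * (2 + cPert) * p.kappa := Real.sq_sqrt (by positivity)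
  apply add_le_add
  · apply Real.sqrt_le_sqrt
    have e : 2.032 * (p.kappa - 1) / p.n * (0.73 * T / t + 4.35 + Real.log p.eps⁻¹)
        = (2 * (p.kappa - 1) / p.n) * (1.016 * (0.73 * (T / t) + 4.35 + Real.log p.eps⁻¹)) := by
      ring
    rw [e]
    apply mul_le_mul_of_nonneg_left _ (by positivity)
    have := mul_le_mul_of_nonneg_right hq hz.le
    linarith
  · apply Real.le_sqrt_of_sq_le
    have e : (v / (2 * p.n) * (y + x / y)) ^ 2
        = (2 + cPert) * p.kappa / (2 * p.n) * (z + 2 * x + x ^ 2 / z) := by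
      have : (v / (2 * p.n) * (y + x / y)) ^ 2
          = v ^ 2 / (2 * p.n) ^ 2 * (y ^ 2 + 2 * x + x ^ 2 / y ^ 2) := by
        field_simp; ring
      rw [this, hv2, hy2]; field_simp
    have e2 : 98.5 * p.kappa * T / (p.n * t) = p.kappa / p.n * (98.5 * (T / t)) := by
      field_simp
    have e3 : (2 + cPert) * p.kappa / (2 * p.n) * (z + 2 * x + x ^ 2 / z)
        = p.kappa / p.n * ((2 + cPert) / 2 * (z + 2 * x + x ^ 2 / z)) := by
      field_simp
    rw [e, e2, e3]
    apply mul_le_mul_of_nonneg_left _ (by positivity)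
    have h5 : z + 2 * x + x ^ 2 / z ≤ 25 / 6 * x := by
      have h6 : x ^ 2 / z = x * x / z := by rw [sq]
      have : z ^ 2 + x ^ 2 ≤ 13 / 6 * x * z := by
        nlinarith [mul_nonneg (sub_nonneg.2 h1) (sub_nonneg.2 h2)]
      have h7 : z + x ^ 2 / z = (z ^ 2 + x ^ 2) / z := by field_simp
      have h8 : (z ^ 2 + x ^ 2) / z ≤ 13 / 6 * x := by
        rw [div_le_iff₀ hz]; linarith
      linarith
    have h9 : (2 + cPert) / 2 * (z + 2 * x + x ^ 2 / z) ≤ 47 / 2 * (25 / 6 * x) :=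
      mul_le_mul (by linarith) h5 (by positivity) (by norm_num)
    linarith

/-- For ratios below the smallest one of the grid the first grid point is used; its large weight
leaves room for the excess perturbation cost, because `κ/(κ-1) ≤ 3`. -/
lemma gamma_add_cost_le_of_small {T t : ℝ} (ht : 0 < t)
    (hT : p.m / Real.sqrt p.kappa ≤ T) (h1 : p.m / Real.sqrt p.kappa / t ≤ gridRatio 0) :
    gammaCoef p (gridPoint p 0) + (gridPoint p 0).beta / (2 * p.n) / t
      ≤ gammaFun p.n p.eps p.kappa T t := by
  have hn' : (0 : ℝ) < p.n := by exact_mod_cast hn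
  have hc := cPert_ge
  have hc2 := cPert_le
  have hκ0 : 0 < p.kappa := by linarith
  have hκ1 : 0 < p.kappa - 1 := by linarith
  rw [gamma_add_cost_eq hn hε hε2 hκ hm 0 ht]
  have hxX : p.m / Real.sqrt p.kappa / t ≤ T / t := by gcongr
  have hx0 : 0 < p.m / Real.sqrt p.kappa / t := by positivity
  generalize p.m / Real.sqrt p.kappa / t = x at *
  have hz : gridRatio 0 = 1 / 1000 := by norm_num [gridRatio]
  have hL : gridComplexity p.eps 0 ≤ 0.694 + Real.log p.eps⁻¹ := by
    unfold gridComplexity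
    rw [log_gridWeight_inv hε, hz]
    have h0 : gridWeight 0 = 2⁻¹ := by simp [gridWeight]
    rw [h0, Real.log_inv 2]
    have := traceCoef_le
    linarith [Real.log_two_lt_d9]
  have hL0 := gridComplexity_pos hε hε2 0
  have hℓ := log_inv_eps_pos hε hε2
  generalize gridComplexity p.eps 0 = L at *
  rw [hz] at h1 ⊢
  unfold gammaFun
  set v := Real.sqrt (2 * p.n * (2 + cPert) * p.kappa) with hv
  have hv0 : 0 ≤ v := Real.sqrt_nonneg _
  have hv2 : v ^ 2 = 2 * p.n * (2 + cPert) * p.kappa := Real.sq_sqrt (by positivity)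
  set y := Real.sqrt (1 / 1000) with hy
  have hy0 : 0 < y := Real.sqrt_pos.2 (by norm_num)
  have hy2 : y ^ 2 = 1 / 1000 := Real.sq_sqrt (by norm_num)
  set P := Real.sqrt (2 * (p.kappa - 1) / p.n * L) with hP
  have hP2 : P ^ 2 = 2 * (p.kappa - 1) / p.n * L := Real.sq_sqrt (by positivity)
  set Q := v / (2 * p.n) * y with hQ
  have hvn : (v / (2 * p.n)) ^ 2 = (2 + cPert) / 2 * (p.kappa / p.n) := by
    rw [div_pow, hv2]; field_simp
  have hQ2 : Q ^ 2 ≤ 0.0705 * ((p.kappa - 1) / p.n) := by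
    have e : Q ^ 2 = (2 + cPert) / 2000 * p.kappa / p.n := by
      rw [hQ, mul_pow, hvn, hy2]; ring
    have e2 : 0.0705 * ((p.kappa - 1) / p.n) = 0.0705 * (p.kappa - 1) / p.n := by ring
    rw [e, e2]
    apply div_le_div_of_nonneg_right _ hn'.le
    have h6 : (2 + cPert) / 2000 * p.kappa ≤ 47 / 2000 * (3 * (p.kappa - 1)) :=
      mul_le_mul (by linarith) (by linarith) hκ0.le (by norm_num)
    linarith
  have hfirst : P + Q ≤ Real.sqrt (2.032 * (p.kappa - 1) / p.n
      * (0.73 * T / t + 4.35 + Real.log p.eps⁻¹)) := by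
    apply Real.le_sqrt_of_sq_le
    have h3 : (P + Q) ^ 2 ≤ 1.016 * P ^ 2 + 63.5 * Q ^ 2 := by
      -- `(P + Q)² ≤ (1 + a) P² + (1 + 1/a) Q²` with `a = 0.016`
      nlinarith [sq_nonneg (0.016 * P - Q)]
    have e : 2.032 * (p.kappa - 1) / p.n * (0.73 * T / t + 4.35 + Real.log p.eps⁻¹)
        = (p.kappa - 1) / p.n * (2.032 * (0.73 * (T / t) + 4.35 + Real.log p.eps⁻¹)) := by ring
    have e1 : 1.016 * P ^ 2 = (p.kappa - 1) / p.n * (2.032 * L) := by rw [hP2]; ring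
    have h4 : (p.kappa - 1) / p.n * (2.032 * L) + 63.5 * (0.0705 * ((p.kappa - 1) / p.n))
        ≤ (p.kappa - 1) / p.n * (2.032 * (0.73 * (T / t) + 4.35 + Real.log p.eps⁻¹)) := by
      have h5 : 0 ≤ (p.kappa - 1) / p.n := by positivity
      have h6 : 2.032 * L + 63.5 * 0.0705
          ≤ 2.032 * (0.73 * (T / t) + 4.35 + Real.log p.eps⁻¹) := by linarith
      have := mul_le_mul_of_nonneg_left h6 h5
      linarith
    rw [e]; linarith
  have hsecond : v / (2 * p.n) * (x / y) ≤ Real.sqrt (98.5 * p.kappa * T / (p.n * t)) := by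
    apply Real.le_sqrt_of_sq_le
    have e2 : 98.5 * p.kappa * T / (p.n * t) = p.kappa / p.n * (98.5 * (T / t)) := by
      field_simp
    have e3 : (v / (2 * p.n) * (x / y)) ^ 2 = p.kappa / p.n * ((2 + cPert) / 2 * (1000 * x ^ 2)) := by
      rw [mul_pow, hvn, div_pow, hy2]; ring
    rw [e2, e3]
    apply mul_le_mul_of_nonneg_left _ (by positivity)
    have h6 : 1000 * x ^ 2 ≤ x := by nlinarith
    have h7 : (2 + cPert) / 2 * (1000 * x ^ 2) ≤ 47 / 2 * x :=
      mul_le_mul (by linarith) h6 (by positivity) (by norm_num)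
    linarith
  rw [mul_add]
  linarith

end Params

/-- A finite grid covers all levels `t` at which the error level is finite. -/
theorem exists_grid {p : Params} (hn : 0 < p.n) (hε : 0 < p.eps) (hε2 : p.eps < 1 / 2)
    (hκ : 3 / 2 ≤ p.kappa) (hm : 0 < p.m) :
    ∃ Λ : Finset GridPoint, IsGrid Λ ∧ ∀ T t : ℝ, 0 < t → p.m / Real.sqrt p.kappa ≤ T →
      (6 + (p.kappa - 1)⁻¹) * gammaFun p.n p.eps p.kappa T t ≤ 1 →
      ∃ g ∈ Λ, 0 < g.lam ∧ 0 < g.beta ∧ muCoef p g = gammaCoef p g ∧ 0 ≤ gammaCoef p g ∧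
        0 ≤ xiCoef p g ∧ xiCoef p g ≤ (1 + (p.kappa - 1)⁻¹) / 2 * gammaCoef p g ∧
        gammaCoef p g + g.beta / (2 * p.n) / t ≤ gammaFun p.n p.eps p.kappa T t := by
  classical
  have hn' : (0 : ℝ) < p.n := by exact_mod_cast hn
  have hκ0 : 0 < p.kappa := by linarith
  have hκ1 : 0 < p.kappa - 1 := by linarith
  obtain ⟨J, hJ⟩ := pow_unbounded_of_one_lt (1000 * (p.n : ℝ)) (show (1 : ℝ) < 3 / 2 by norm_num)
  refine ⟨(Finset.range (J + 1)).image (gridPoint p), ⟨?_, ?_, ?_⟩, ?_⟩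
  · exact ⟨gridPoint p 0, Finset.mem_image_of_mem _ (by simp)⟩
  · intro g hg
    obtain ⟨j, -, rfl⟩ := Finset.mem_image.1 hg
    exact gridPoint_pos hn hε hε2 hκ hm j
  · refine (Finset.sum_image_le_of_nonneg ?_).trans (sum_gridWeight_le J)
    intro g hg
    obtain ⟨j, -, rfl⟩ := Finset.mem_image.1 hg
    exact (gridWeight_pos j).le
  · intro T t ht hT hγ
    have hcoef : ∀ j, 0 < (gridPoint p j).lam ∧ 0 < (gridPoint p j).beta ∧
        muCoef p (gridPoint p j) = gammaCoef p (gridPoint p j) ∧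
        0 ≤ gammaCoef p (gridPoint p j) ∧ 0 ≤ xiCoef p (gridPoint p j) ∧
        xiCoef p (gridPoint p j) ≤ (1 + (p.kappa - 1)⁻¹) / 2 * gammaCoef p (gridPoint p j) := by
      intro j
      obtain ⟨h1, h2, -⟩ := gridPoint_pos hn hε hε2 hκ hm j
      obtain ⟨-, h4, h5⟩ := gridPoint_coef hn hε hε2 hκ hm j
      have h6 : (p.kappa - 1) * (gridPoint p j).lam ≤ gammaCoef p (gridPoint p j) := by
        rw [h5, h4, le_add_iff_nonneg_right]; positivity
      have h7 : 0 ≤ (p.kappa - 1) * (gridPoint p j).lam := by positivity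
      refine ⟨h1, h2, h5.symm, h7.trans h6, ?_, ?_⟩
      · unfold xiCoef; positivity
      · have e : xiCoef p (gridPoint p j)
            = (1 + (p.kappa - 1)⁻¹) / 2 * ((p.kappa - 1) * (gridPoint p j).lam) := by
          unfold xiCoef; field_simp; ring
        rw [e]; gcongr
    suffices h : ∃ j ≤ J, gammaCoef p (gridPoint p j) + (gridPoint p j).beta / (2 * p.n) / t
        ≤ gammaFun p.n p.eps p.kappa T t by
      obtain ⟨j, hj, hle⟩ := h
      obtain ⟨c1, c2, c3, c4, c5, c6⟩ := hcoef j
      exact ⟨gridPoint p j, Finset.mem_image_of_mem _ (Finset.mem_range.2 (by omega)),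
        c1, c2, c3, c4, c5, c6, hle⟩
    rcases le_total (p.m / Real.sqrt p.kappa / t) (gridRatio 0) with hx | hx
    · exact ⟨0, Nat.zero_le _, gamma_add_cost_le_of_small hn hε hε2 hκ hm ht hT hx⟩
    · have hx1 : 1 ≤ 1000 * (p.m / Real.sqrt p.kappa / t) := by
        have : gridRatio 0 = 1 / 1000 := by norm_num [gridRatio]
        linarith
      obtain ⟨j, hj1, hj2⟩ := exists_nat_pow_near hx1 (show (1 : ℝ) < 3 / 2 by norm_num)
      refine ⟨j, ?_, gamma_add_cost_le_of_near hn hε hε2 hκ hm j ht hT ?_ ?_⟩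
      · -- a finite error level forces `T / t ≤ n`, which bounds the index of the grid point
        have hγ2 : Real.sqrt (98.5 * p.kappa * T / (p.n * t)) ≤ 1 := by
          have h1 : Real.sqrt (98.5 * p.kappa * T / (p.n * t)) ≤ gammaFun p.n p.eps p.kappa T t := by
            unfold gammaFun; linarith [Real.sqrt_nonneg (2.032 * (p.kappa - 1) / p.n
              * (0.73 * T / t + 4.35 + Real.log p.eps⁻¹))]
          have h0 := Real.sqrt_nonneg (98.5 * p.kappa * T / (p.n * t))
          have h2 : 0 < (p.kappa - 1)⁻¹ := inv_pos.2 hκ1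
          nlinarith
        rw [Real.sqrt_le_one, div_le_one (by positivity)] at hγ2
        have hT0 : 0 < T := lt_of_lt_of_le (by positivity) hT
        have hTn : T / t ≤ p.n := by
          rw [div_le_iff₀ ht]; nlinarith
        have hxT : p.m / Real.sqrt p.kappa / t ≤ T / t := by gcongr
        have : (3 / 2 : ℝ) ^ j < (3 / 2) ^ J := by linarith
        exact ((pow_lt_pow_iff_right₀ (by norm_num)).1 this).le
      · unfold gridRatio; linarith
      · have e : 3 / 2 * gridRatio j = (3 / 2 : ℝ) ^ (j + 1) / 1000 := by
          unfold gridRatio; ring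
        rw [e]; linarith

/-! ### Error bounds for the eigenvalues -/

lemma IsGrid.coef_nonneg {p : Params} {Λ : Finset GridPoint} (hΛ : IsGrid Λ) (hε : 0 < p.eps)
    (hε2 : p.eps < 1 / 2) (hκ : 3 / 2 ≤ p.kappa) (hm : 0 < p.m) {g : GridPoint} (hg : g ∈ Λ) :
    0 ≤ xiCoef p g ∧ 0 ≤ gammaCoef p g := by
  obtain ⟨-, hpos, hsum⟩ := hΛ
  obtain ⟨hl, hβ, hw⟩ := hpos g hg
  have hκ1 : 0 < p.kappa - 1 := by linarith
  have hκ0 : 0 < p.kappa := by linarith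
  have hc := cPert_ge
  have hw1 : g.weight ≤ 1 :=
    (Finset.single_le_sum (fun g hg => (hpos g hg).2.2.le) hg).trans hsum
  have hlog : 0 ≤ Real.log (g.weight * p.eps)⁻¹ := by
    apply Real.log_nonneg
    rw [one_le_inv₀ (by positivity)]
    nlinarith
  constructor
  · unfold xiCoef; positivity
  · unfold gammaCoef; positivity

/-- If the confidence bounds hold then the constraints of the minimization problem can be satisfied,
namely by the covariance matrix itself. -/
lemma isFeasible_covMatrix {d : ℕ} {P : Measure (EuclideanSpace ℝ (Fin d))}
    [IsProbabilityMeasure P]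
    (hP : MemLp (fun x : EuclideanSpace ℝ (Fin d) => x) 4 P) {p : Params} {Λ : Finset GridPoint}
    {Θ : Finset (EuclideanSpace ℝ (Fin d))} {x : Fin p.n → EuclideanSpace ℝ (Fin d)}
    (h : ∀ g ∈ Λ, ∀ θ ∈ Θ, lowerBoundAt p g x θ ≤ energy P θ ∧
      (energy P θ : EReal) ≤ upperBoundAt p g x θ) :
    IsFeasible p Λ Θ x (covMatrix P) := by
  refine ⟨isSymm_covMatrix P, fun θ hθ => ?_⟩
  rw [quadForm_covMatrix hP]
  exact ⟨iSup₂_le fun g hg => EReal.coe_le_coe_iff.2 (h g hg θ hθ).1,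
    le_iInf₂ fun g hg => (h g hg θ hθ).2⟩

lemma IsFeasible.bounds {d : ℕ} {p : Params} {Λ : Finset GridPoint}
    {Θ : Finset (EuclideanSpace ℝ (Fin d))} {x : Fin p.n → EuclideanSpace ℝ (Fin d)}
    {Q : Matrix (Fin d) (Fin d) ℝ} (h : IsFeasible p Λ Θ x Q) {g : GridPoint} (hg : g ∈ Λ)
    {θ : EuclideanSpace ℝ (Fin d)} (hθ : θ ∈ Θ) :
    lowerBoundAt p g x θ ≤ quadForm Q θ ∧ (quadForm Q θ : EReal) ≤ upperBoundAt p g x θ :=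
  ⟨EReal.coe_le_coe_iff.1 ((le_iSup₂ (f := fun g (_ : g ∈ Λ) => (lowerBoundAt p g x θ : EReal))
      g hg).trans (h.2 θ hθ).1),
    (h.2 θ hθ).2.trans (iInf₂_le (f := fun g (_ : g ∈ Λ) => upperBoundAt p g x θ) g hg)⟩

lemma gammaFun_anti {n : ℕ} {ε κ T t t' : ℝ} (hε : 0 < ε) (hε2 : ε < 1 / 2)
    (hκ : 3 / 2 ≤ κ) (hT : 0 ≤ T) (ht : 0 < t) (htt' : t ≤ t') :
    gammaFun n ε κ T t' ≤ gammaFun n ε κ T t := by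
  rcases Nat.eq_zero_or_pos n with rfl | hn
  · simp [gammaFun]
  have hn' : (0 : ℝ) < n := by exact_mod_cast hn
  have hκ1 : 0 ≤ κ - 1 := by linarith
  have hκ0 : 0 ≤ κ := by linarith
  unfold gammaFun
  gcongr

/-- Where `η` is infinite a bound by a positive multiple of it is void. -/
lemma coe_le_mul_etaFun_add {n : ℕ} {ε κ T σ s a c b : ℝ} (hc : 0 < c)
    (h : (6 + (κ - 1)⁻¹) * gammaFun n ε κ T (max s σ) ≤ 1 →
      a ≤ c * (gammaFun n ε κ T (max s σ) / (1 - 4 * gammaFun n ε κ T (max s σ))) + b) :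
    (a : EReal) ≤ (c : EReal) * etaFun n ε κ T σ s + (b : EReal) := by
  unfold etaFun
  split_ifs with hcond
  · exact_mod_cast h hcond
  · rw [EReal.coe_mul_top_of_pos hc, EReal.top_add_coe]; exact le_top

/-- Two matrices lying between the confidence bounds on the net have close eigenvalues. -/
lemma abs_max_sub_max_le_of_isFeasible {d : ℕ} {p : Params} {Λ : Finset GridPoint}
    {Θ : Finset (EuclideanSpace ℝ (Fin d))} {δ H T γ σ : ℝ} {A A' : Matrix (Fin d) (Fin d) ℝ}
    {a a' : Fin d → ℝ} {x : Fin p.n → EuclideanSpace ℝ (Fin d)}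
    (hn : 0 < p.n) (hκ : 3 / 2 ≤ p.kappa)
    (hΛ : ∃ g ∈ Λ, 0 < g.lam ∧ 0 < g.beta ∧ muCoef p g = gammaCoef p g ∧ 0 ≤ gammaCoef p g ∧
        0 ≤ xiCoef p g ∧ xiCoef p g ≤ (1 + (p.kappa - 1)⁻¹) / 2 * gammaCoef p g ∧
        gammaCoef p g + g.beta / (2 * p.n) / T ≤ γ)
    (hA : IsFeasible p Λ Θ x A) (hA' : IsFeasible p Λ Θ x A') (ha : HasEigenvalues A a)
    (ha' : HasEigenvalues A' a') (hH : hsNorm A ≤ H) (hH' : hsNorm A' ≤ H) (hδ : 0 ≤ δ)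
    (hΘ : IsSphereNet Θ δ) (i : Fin d) (hσ : 0 < σ) (hT : T = max (a i) σ)
    (hγ : (6 + (p.kappa - 1)⁻¹) * γ ≤ 1) :
    |max (a i) σ - max (a' i) σ| ≤ 2 * max (a i) σ * (γ / (1 - 4 * γ)) + 5 * δ * H := by
  obtain ⟨g, hg, hl, hβ, hμ, hG, hξ0, hξ, hle⟩ := hΛ
  have hn' : (0 : ℝ) < p.n := by exact_mod_cast hn
  have hk0 : 0 ≤ (p.kappa - 1)⁻¹ := inv_nonneg.2 (by linarith)
  have hk2 : (p.kappa - 1)⁻¹ ≤ 2 := inv_le_of_inv_le₀ (by norm_num) (by linarith)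
  have hT0 : 0 < T := by rw [hT]; exact lt_max_of_lt_right hσ
  obtain ⟨s, e, hs1, hs2, he, hall⟩ :=
    exists_slope (x := x) hn hβ hT0 hk0 hk2 hμ hG hξ0 hξ hle hγ
  have hγ0 : 0 ≤ γ := le_trans (by positivity) hle
  have hη : 0 ≤ γ / (1 - 4 * γ) := div_nonneg hγ0 (by nlinarith)
  exact abs_max_sub_max_le hA.1 hA'.1 ha ha' hH hH' hδ hΘ i hσ hT hs1 hs2 hη he
    (fun ξ hξ => hall ξ (hΘ.1 ξ hξ) _ _ (hA.bounds hg hξ).1 (hA'.bounds hg hξ).2)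
    (fun ξ hξ => hall ξ (hΘ.1 ξ hξ) _ _ (hA'.bounds hg hξ).1 (hA.bounds hg hξ).2)

lemma IsSphereNet.delta_nonneg {d : ℕ} {Θ : Finset (EuclideanSpace ℝ (Fin d))} {δ : ℝ}
    (hΘ : IsSphereNet Θ δ) (i : Fin d) : 0 ≤ δ := by
  obtain ⟨ξ, -, h⟩ := hΘ.2 (EuclideanSpace.single i 1) (by simp)
  exact (norm_nonneg _).trans h

lemma sortedEigenvalues_covMatrix_nonneg {d : ℕ} {P : Measure (EuclideanSpace ℝ (Fin d))}
    [IsProbabilityMeasure P]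
    (hP : MemLp (fun x : EuclideanSpace ℝ (Fin d) => x) 4 P) (i : Fin d) :
    0 ≤ sortedEigenvalues (covMatrix P) i := by
  have h := hasEigenvalues_sortedEigenvalues (isHermitian_of_isSymm (isSymm_covMatrix P))
  obtain ⟨θ, -, h1, -⟩ := exists_unit_quadForm_le_ge h h i
  rw [quadForm_covMatrix hP] at h1
  exact (energy_nonneg P θ).trans h1

end RobustPCA

end

open RobustPCA in
theorem mainTheorem3 (n : ℕ) (hn : 0 < n) (ε : ℝ) (hε : 0 < ε) (κ : ℝ) (hκ : 3 / 2 ≤ κ) (m : ℝ) :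
    ∃ Λ : Finset RobustPCA.GridPoint, RobustPCA.IsGrid Λ ∧
      ∀ (d : ℕ) (P : Measure (EuclideanSpace ℝ (Fin d))) [IsProbabilityMeasure P],
        MemLp (fun x : EuclideanSpace ℝ (Fin d) => x) 4 P →
        ∫ x, x ∂P = 0 →
        RobustPCA.kurtosis P = κ →
        RobustPCA.fourthMomentRoot P = m →
        ∀ (Ω : Type*) [MeasurableSpace Ω] (μ : Measure Ω) [IsProbabilityMeasure μ]
          (X : Fin n → Ω → EuclideanSpace ℝ (Fin d)),
          (∀ k, Measurable (X k)) → iIndepFun X μ → (∀ k, μ.map (X k) = P) →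
          ∀ (σ : ℝ), 0 < σ → ∀ (s₄ δ : ℝ) (Θ : Finset (EuclideanSpace ℝ (Fin d))),
            RobustPCA.IsSphereNet Θ δ →
            ∃ E : Set Ω, MeasurableSet E ∧ ENNReal.ofReal (1 - 2 * ε) ≤ μ E ∧
              ∀ ω ∈ E,
                let p : RobustPCA.Params := ⟨n, ε, κ, m⟩
                let S := RobustPCA.covMatrix P
                let Shat := RobustPCA.sigmaHat p Λ Θ (fun k => X k ω)
                let η := RobustPCA.etaFun n ε κ S.trace σ
                RobustPCA.IsMinimalFeasible p Λ Θ (fun k => X k ω) Shat ∧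
                ∀ i : Fin d,
                  let l := RobustPCA.sortedEigenvalues S i
                  let lhat := RobustPCA.sortedEigenvalues (RobustPCA.positivePart Shat) i
                  ((|max l σ - max lhat σ| : ℝ) : EReal)
                      ≤ ((2 * max l σ : ℝ) : EReal) * η l
                        + ((5 * δ * RobustPCA.hsNorm S : ℝ) : EReal) ∧
                  ((|max l σ - max lhat σ| : ℝ) : EReal)
                      ≤ ((2 * max lhat σ : ℝ) : EReal) * η (min lhat s₄)
                        + ((5 * δ * RobustPCA.hsNorm S : ℝ) : EReal) ∧
                  ((|l - lhat| : ℝ) : EReal)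
                      ≤ ((2 * max l σ : ℝ) : EReal) * η l
                        + ((5 * δ * RobustPCA.hsNorm S : ℝ) : EReal) + (σ : EReal) ∧
                  ((|l - lhat| : ℝ) : EReal)
                      ≤ ((2 * max lhat σ : ℝ) : EReal) * η (min lhat s₄)
                        + ((5 * δ * RobustPCA.hsNorm S : ℝ) : EReal) + (σ : EReal) := by
  have hgrid1 : IsGrid {⟨1, 1, 1⟩} := by
    refine ⟨by simp, fun g hg => ?_, by simp⟩
    rw [Finset.mem_singleton.1 hg]; norm_num
  by_cases hε2 : ε < 1 / 2
  swap
  · -- the claimed probability is not positive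
    refine ⟨_, hgrid1, ?_⟩
    intro d P _ _ _ _ _ Ω _ μ _ X _ _ _ σ _ s₄ δ Θ _
    refine ⟨∅, MeasurableSet.empty, ?_, fun ω hω => absurd hω (Set.notMem_empty ω)⟩
    rw [ENNReal.ofReal_of_nonpos (by linarith)]; exact zero_le
  by_cases hm : 0 < m
  swap
  · -- a law with kurtosis at least `3/2` is not concentrated at the origin
    refine ⟨_, hgrid1, ?_⟩
    intro d P _ hP _ hκP hmP
    exact absurd (hmP ▸ fourthMomentRoot_pos hP (hκP ▸ hκ)) hm
  obtain ⟨Λ, hΛ, hgood⟩ := exists_grid (p := ⟨n, ε, κ, m⟩) hn hε hε2 hκ hm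
  refine ⟨Λ, hΛ, ?_⟩
  intro d P _ hP _ hκP hmP Ω _ μ _ X hX hind hlaw σ hσ s₄ δ Θ hΘ
  obtain ⟨E, hE, hμE, hdev⟩ := exists_event_deviationHolds hP (p := ⟨n, ε, κ, m⟩) hn hε hκ hκP hmP
    hΛ μ X hX hind hlaw
  refine ⟨E, hE, hμE, fun ω hω => ?_⟩
  intro p S Shat η
  have hn' : (0 : ℝ) < n := by exact_mod_cast hn
  have hbounds : ∀ g ∈ Λ, ∀ θ ∈ Θ, lowerBoundAt p g (fun k => X k ω) θ ≤ energy P θ ∧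
      (energy P θ : EReal) ≤ upperBoundAt p g (fun k => X k ω) θ := by
    intro g hg θ hθ
    obtain ⟨hl, hβ, -⟩ := hΛ.2.1 g hg
    obtain ⟨hξ, hγ⟩ := hΛ.coef_nonneg (p := p) hε hε2 hκ hm hg
    have hb : 0 < perturbCost p g θ := by
      unfold perturbCost; rw [hΘ.1 θ hθ]
      have : (0 : ℝ) < p.n := hn'
      positivity
    exact ⟨lowerBoundAt_le hn hl hξ hγ hb.le (energy_nonneg P θ) (hdev ω hω g hg θ),
      le_upperBoundAt hn hl hξ hγ hb (hdev ω hω g hg θ)⟩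
  have hSf : IsFeasible p Λ Θ (fun k => X k ω) S := isFeasible_covMatrix hP hbounds
  have hmin : IsMinimalFeasible p Λ Θ (fun k => X k ω) Shat := isMinimalFeasible_sigmaHat hSf
  refine ⟨hmin, fun i => ?_⟩
  intro l lhat
  have hherm := isHermitian_of_isSymm hmin.1.1
  have hSe : HasEigenvalues S (sortedEigenvalues S) :=
    hasEigenvalues_sortedEigenvalues (isHermitian_of_isSymm hSf.1)
  have hShe : HasEigenvalues Shat (sortedEigenvalues Shat) :=
    hasEigenvalues_sortedEigenvalues hherm
  have hlhat : lhat = max (sortedEigenvalues Shat i) 0 := sortedEigenvalues_positivePart hherm i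
  have hlhatσ : max lhat σ = max (sortedEigenvalues Shat i) σ := by
    rw [hlhat, max_assoc, max_eq_right hσ.le]
  have hl0 : 0 ≤ l := sortedEigenvalues_covMatrix_nonneg hP i
  have hlhat0 : 0 ≤ lhat := by rw [hlhat]; exact le_max_right _ _
  have hδ := hΘ.delta_nonneg i
  have hκ0 : 0 < κ := by linarith
  have hTr : m / Real.sqrt κ ≤ S.trace := by
    rw [div_le_iff₀ (Real.sqrt_pos.2 hκ0), mul_comm, ← hmP, ← hκP]
    exact fourthMomentRoot_le hP (hκP ▸ hκ)
  have hTr0 : 0 ≤ S.trace := le_trans (by positivity) hTr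
  have hSle := hmin.2 S hSf
  have hpos1 : 0 < max l σ := lt_max_of_lt_right hσ
  have hpos2 : 0 < max lhat σ := lt_max_of_lt_right hσ
  have h1 : ((|max l σ - max lhat σ| : ℝ) : EReal) ≤ ((2 * max l σ : ℝ) : EReal) * η l
      + ((5 * δ * hsNorm S : ℝ) : EReal) := by
    refine coe_le_mul_etaFun_add (by positivity) fun hγ => ?_
    rw [hlhatσ]
    exact abs_max_sub_max_le_of_isFeasible hn hκ (hgood S.trace _ hpos1 hTr hγ) hSf hmin.1 hSe hShe
      le_rfl hSle hδ hΘ i hσ rfl hγ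
  have h2 : ((|max l σ - max lhat σ| : ℝ) : EReal) ≤ ((2 * max lhat σ : ℝ) : EReal)
      * η (min lhat s₄) + ((5 * δ * hsNorm S : ℝ) : EReal) := by
    refine coe_le_mul_etaFun_add (by positivity) fun hγ => ?_
    -- `γ` is used at the level `max (min λ̂ s₄) σ`, where it is at least its value at `max λ̂ σ`
    have hanti := gammaFun_anti (n := n) hε hε2 hκ hTr0
      (lt_max_of_lt_right hσ : 0 < max (min lhat s₄) σ)
      (max_le_max_right σ (min_le_left lhat s₄))
    have hk : 0 < (κ - 1)⁻¹ := inv_pos.2 (by linarith)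
    obtain ⟨g, hg, c1, c2, c3, c4, c5, c6, c7⟩ := hgood S.trace _ hpos2 hTr
      ((mul_le_mul_of_nonneg_left hanti (by positivity)).trans hγ)
    rw [abs_sub_comm]
    rw [hlhatσ] at c7 hanti ⊢
    exact abs_max_sub_max_le_of_isFeasible hn hκ
      ⟨g, hg, c1, c2, c3, c4, c5, c6, c7.trans hanti⟩ hmin.1 hSf hShe hSe
      hSle le_rfl hδ hΘ i hσ rfl hγ
  have h3 : ((|l - lhat| : ℝ) : EReal) ≤ ((|max l σ - max lhat σ| : ℝ) : EReal) + (σ : EReal) := by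
    rw [← EReal.coe_add, EReal.coe_le_coe_iff]
    rcases le_total l σ with h | h <;> rcases le_total lhat σ with h' | h' <;>
      simp only [max_eq_left, max_eq_right, h, h'] <;>
      rw [abs_le] <;> constructor <;>
      linarith [neg_abs_le (l - lhat), le_abs_self (l - lhat), le_abs_self (σ - lhat),
        neg_abs_le (σ - lhat), le_abs_self (l - σ), neg_abs_le (l - σ), abs_nonneg (σ - σ)]
  exact ⟨h1, h2, h3.trans (add_le_add_left h1 _), h3.trans (add_le_add_left h2 _)⟩
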